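/- **Setting.** Let $(Z_i, D_{i1}, D_{i2})$, $i\ge 1$, be i.i.d. random triples, where $Z_i$ has a nondegenerate law $F$ and $D_{i1}, D_{i2}\in\{0,1\}$ are, given $Z_i$, conditionally independent with $\mathbb E(D_{i1}\mid Z_i)=\alpha_{10}$ and $\mathbb E(D_{i2}\mid Z_i)=\pi(Z_i)$ for a measurable function $\pi$ with values in $[0,1]$. Let $Z\sim F$, $\alpha_{20}=\mathbb E\{\pi(Z)\}$, and suppose that $\alpha_{10},\alpha_{20}\in(0,1)$ are fixed and known. Put $D_i=I(D_{i1}+D_{i2}>0)$, $\varphi(z)=1-(1-\alpha_{10})\{1-\pi(z)\}$ and $\alpha_0=1-(1-\alpha_{10})(1-\alpha_{20})$. **Loss.** Let $\ell(z,\theta)$, $\theta\in\mathbb R^q$, be convex in $\theta$ and let $\theta_0$ minimize the risk $R(\theta)=\mathbb E\{\ell(Z,\theta)\}$. Suppose that for almost all $z$ the gradient $\dot\ell(z)=\partial \ell(z,\theta_0)/\partial\theta$ exists, that $\mathbb E\{\dot\ell(Z)\}=0$, that $B_{\dot\ell\dot\ell}=\mathbb E\{\dot\ell(Z)\dot\ell(Z)^\top/\varphi(Z)\}$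 is finite, and that the remainder $\xi(z,t)=\ell(z,\theta_0+t)-\ell(z,\theta_0)-\dot\ell(z)^\top t$ is square integrable for $t$ near $0$ and satisfies, as $\|t\|\to 0$, $\mathbb E\{\xi(Z,t)\}=\tfrac12 t^\top Vt+o(\|t\|^2)$ and $\mathbb E\{\xi^2(Z,t)\}=o(\|t\|^2)$ for a positive-definite matrix $V$. **Auxiliary information.** Let $h$ be an $\mathbb R^m$-valued function with $\mathbb E\{h(Z)\}=0$, let $h_e(z)=(\varphi(z)-\alpha_0,\,h(z)^\top)^\top$, and suppose that $B_{hh}=\mathbb E\{h_e(Z)h_e(Z)^\top/\varphi(Z)\}$ is finite and positive definite. **Estimator.** For each $N$, the weights $\hat p_1,\dots,\hat p_N$ maximize the empirical log-likelihood $$\sum_{i=1}^N\bigl[D_i\log p_i+D_i\log\varphi(Z_i)+(1-D_i)\log(1-\alpha)\bigr],\qquad \alpha=\alpha_0,$$ over the weights with $p_i>0$ if $D_i=1$, $p_i=0$ if $D_i=0$, $\sum_i p_i=1$ and $\sum_i p_ih_e(Z_i)=0$. If no maximizer exists, $\hat p_i$ are instead the weights that maximize the same log-likelihood jointly in $\alpha\in(0,1)$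 and $p$ under the same conditions except that $\sum_i p_ih_e(Z_i)=0$ is replaced by $\sum_ip_i\{\varphi(Z_i)-\alpha\}=0$; if this maximizer does not exist either, the weights are arbitrary. Let $\hat\theta_{\rm ELW}$ be a (measurable) minimizer of $\theta\mapsto\sum_{i=1}^N\hat p_i\,\ell(Z_i,\theta)$, arbitrary where there is no minimizer. **Theorem.** As $N\to\infty$: (a) $\hat\theta_{\rm ELW}\to\theta_0$ in probability, and $\sqrt N(\hat\theta_{\rm ELW}-\theta_0)=-V^{-1}\,N^{1/2}\sum_{i=1}^N\hat p_i\dot\ell(Z_i)+o_p(1)$. (b) $\sqrt N(\hat\theta_{\rm ELW}-\theta_0)\overset{d}{\to}\mathcal N(0,\Sigma_{\rm ELW})$ with $\Sigma_{\rm ELW}=V^{-1}\bigl(B_{\dot\ell\dot\ell}-B_{\dot\ell h}B_{hh}^{-1}B_{\dot\ell h}^\top\bigr)V^{-1}$, where $B_{\dot\ell h}=\mathbb E\{\dot\ell(Z)h_e(Z)^\top/\varphi(Z)\}$. (c) If the auxiliary constraint $\sum_ip_ih(Z_i)=0$ is dropped, so that $h_e$ is replaced by $\varphi-\alpha_0$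 in the definition of the weights, then $\sqrt N(\hat\theta_{\rm ELW}-\theta_0)\overset{d}{\to}\mathcal N(0,\Sigma_{\rm ELW0})$ with $\Sigma_{\rm ELW0}=V^{-1}\bigl\{B_{\dot\ell\dot\ell}-B_{\dot\ell1}B_{\dot\ell1}^\top/(B_{11}-\alpha_0^{-1})\bigr\}V^{-1}$, where $B_{\dot\ell1}=\mathbb E\{\dot\ell(Z)/\varphi(Z)\}$ and $B_{11}=\mathbb E\{1/\varphi(Z)\}$. -/

import Mathlib

open MeasureTheory ProbabilityTheory Filter Topology Matrix Asymptotics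
open scoped BigOperators

noncomputable section

namespace ELW

variable {Ω 𝒵 : Type*} [MeasurableSpace Ω] [MeasurableSpace 𝒵]

/-! ### Capture–recapture Poisson sampling -/

/-- The overall inclusion indicator `D_i = I(D_{i1} + D_{i2} > 0)` as a real number. -/
def incl (D1 D2 : ℕ → Ω → ℝ) (i : ℕ) (ω : Ω) : ℝ :=
  open Classical in if 0 < D1 i ω + D2 i ω then 1 else 0

/-- Overall inclusion probability `φ(z) = 1 - (1 - α₁₀) (1 - π(z))`. -/
def phi (α10 : ℝ) (π : 𝒵 → ℝ) (z : 𝒵) : ℝ := 1 - (1 - α10) * (1 - π z)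

/-- Overall sampling fraction `α₀ = 1 - (1 - α₁₀) (1 - α₂₀)`. -/
def alpha0 (α10 α20 : ℝ) : ℝ := 1 - (1 - α10) * (1 - α20)

/-- The triples `(Z_i, D_{i1}, D_{i2})` are i.i.d., `Z_i` has the nondegenerate law `F`, the two
captures are Bernoulli experiments with success probabilities `α₁₀` and `π(Z_i)` given `Z_i`, and
the two experiments are conditionally independent given `Z_i` (for indicators: the conditional
expectation of the product is the product of the conditional expectations). -/
structure CaptureRecapture (P : Measure Ω) (F : Measure 𝒵) (Z : ℕ → Ω → 𝒵)
    (D1 D2 : ℕ → Ω → ℝ) (α10 α20 : ℝ) (π : 𝒵 → ℝ) : Prop where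
  measurable_Z : ∀ i, Measurable (Z i)
  measurable_D1 : ∀ i, Measurable (D1 i)
  measurable_D2 : ∀ i, Measurable (D2 i)
  D1_zero_one : ∀ i ω, D1 i ω = 0 ∨ D1 i ω = 1
  D2_zero_one : ∀ i ω, D2 i ω = 0 ∨ D2 i ω = 1
  indep : iIndepFun (fun i ω => (Z i ω, D1 i ω, D2 i ω)) P
  ident : ∀ i, IdentDistrib (fun ω => (Z i ω, D1 i ω, D2 i ω))
    (fun ω => (Z 0 ω, D1 0 ω, D2 0 ω)) P P
  law_Z : ∀ i, P.map (Z i) = F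
  nondegenerate : ¬ ∃ z₀ : 𝒵, ∀ᵐ z ∂F, z = z₀
  measurable_pi : Measurable π
  pi_mem : ∀ z, π z ∈ Set.Icc (0 : ℝ) 1
  condExp_D1 : ∀ i, P[D1 i | MeasurableSpace.comap (Z i) inferInstance] =ᵐ[P] fun _ => α10
  condExp_D2 : ∀ i, P[D2 i | MeasurableSpace.comap (Z i) inferInstance] =ᵐ[P] fun ω => π (Z i ω)
  condExp_D1_mul_D2 : ∀ i,
    P[fun ω => D1 i ω * D2 i ω | MeasurableSpace.comap (Z i) inferInstance]
      =ᵐ[P] fun ω => α10 * π (Z i ω)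
  alpha20_eq : α20 = ∫ z, π z ∂F

/-! ### The loss function -/

/-- `θ₀` minimizes the risk `R(θ) = E ℓ(Z, θ)`. Only those `θ` at which the expectation is finite
compete (for a loss that is convex in `θ` and has an integrable gradient at `θ₀`, the risk is `+∞`
at all the others). -/
def IsRiskMinimizer {q : ℕ} (F : Measure 𝒵) (ℓ : 𝒵 → EuclideanSpace ℝ (Fin q) → ℝ)
    (θ₀ : EuclideanSpace ℝ (Fin q)) : Prop :=
  Integrable (fun z => ℓ z θ₀) F ∧
    ∀ θ, Integrable (fun z => ℓ z θ) F → ∫ z, ℓ z θ₀ ∂F ≤ ∫ z, ℓ z θ ∂F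

/-- Remainder `ξ(z, t) = ℓ(z, θ₀ + t) - ℓ(z, θ₀) - ℓ̇(z)ᵀ t` of the linear expansion at `θ₀`. -/
def remainder {q : ℕ} (ℓ : 𝒵 → EuclideanSpace ℝ (Fin q) → ℝ) (θ₀ : EuclideanSpace ℝ (Fin q))
    (dl : 𝒵 → EuclideanSpace ℝ (Fin q)) (t : EuclideanSpace ℝ (Fin q)) (z : 𝒵) : ℝ :=
  ℓ z (θ₀ + t) - ℓ z θ₀ - inner ℝ (dl z) t

/-- Conditions on the loss: convexity in `θ`, gradient `ℓ̇(z)` at `θ₀` (for almost every `z`) with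
mean zero and finite `E{ℓ̇ ℓ̇ᵀ / φ}`, and a quadratic expansion of the risk with positive definite
matrix `V`. -/
structure LossConditions {q : ℕ} (F : Measure 𝒵) (φ : 𝒵 → ℝ)
    (ℓ : 𝒵 → EuclideanSpace ℝ (Fin q) → ℝ) (θ₀ : EuclideanSpace ℝ (Fin q))
    (dl : 𝒵 → EuclideanSpace ℝ (Fin q)) (V : Matrix (Fin q) (Fin q) ℝ) : Prop where
  measurable_loss : ∀ θ, Measurable (fun z => ℓ z θ)
  measurable_grad : Measurable dl
  convex : ∀ z, ConvexOn ℝ Set.univ (ℓ z)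
  risk_min : IsRiskMinimizer F ℓ θ₀
  grad : ∀ᵐ z ∂F, HasGradientAt (ℓ z) (dl z) θ₀
  integral_grad : ∫ z, dl z ∂F = 0
  finite_Bll : ∀ j k, Integrable (fun z => dl z j * dl z k / φ z) F
  memLp_remainder : ∀ᶠ t in 𝓝 (0 : EuclideanSpace ℝ (Fin q)), MemLp (remainder ℓ θ₀ dl t) 2 F
  posDef : V.PosDef
  mean_remainder :
    (fun t : EuclideanSpace ℝ (Fin q) =>
        (∫ z, remainder ℓ θ₀ dl t z ∂F) - (1 / 2 : ℝ) * (t.ofLp ⬝ᵥ (V *ᵥ t.ofLp)))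
      =o[𝓝 0] fun t => ‖t‖ ^ 2
  sq_remainder :
    (fun t : EuclideanSpace ℝ (Fin q) => ∫ z, (remainder ℓ θ₀ dl t z) ^ 2 ∂F)
      =o[𝓝 0] fun t => ‖t‖ ^ 2

/-! ### Empirical likelihood weights

Here `z : Fin N → 𝒵` are the data, `d : Fin N → ℝ` the inclusion indicators. -/

/-- Empirical log-likelihood
`∑ i, [D_i log p_i + D_i log φ(Z_i) + (1 - D_i) log (1 - α)]`. -/
def logEL {N : ℕ} (φ : 𝒵 → ℝ) (z : Fin N → 𝒵) (d : Fin N → ℝ) (α : ℝ) (p : Fin N → ℝ) : ℝ :=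
  ∑ i, (d i * Real.log (p i) + d i * Real.log (φ (z i)) + (1 - d i) * Real.log (1 - α))

/-- Probability weights carried by the sampled data: positive exactly at the sampled indices
(a zero weight there would give log-likelihood `-∞`), zero at the unobserved ones, total mass 1. -/
def IsWeight {N : ℕ} (d : Fin N → ℝ) (p : Fin N → ℝ) : Prop :=
  (∀ i, d i = 1 → 0 < p i) ∧ (∀ i, d i = 0 → p i = 0) ∧ ∑ i, p i = 1

/-- Weights satisfying the moment constraints `∑ i, p_i g(Z_i) = 0`. -/
def Feasible {N k : ℕ} (g : 𝒵 → Fin k → ℝ) (z : Fin N → 𝒵) (d : Fin N → ℝ) (p : Fin N → ℝ) :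
    Prop :=
  IsWeight d p ∧ ∑ i, p i • g (z i) = 0

/-- `p` maximizes the empirical log-likelihood, with `α = α₀` known, under the constraints
`∑ i, p_i g(Z_i) = 0`. -/
def IsMaxEL {N k : ℕ} (φ : 𝒵 → ℝ) (α₀ : ℝ) (g : 𝒵 → Fin k → ℝ) (z : Fin N → 𝒵)
    (d : Fin N → ℝ) (p : Fin N → ℝ) : Prop :=
  Feasible g z d p ∧ ∀ p', Feasible g z d p' → logEL φ z d α₀ p' ≤ logEL φ z d α₀ p

/-- `p` (with some `α`) maximizes the empirical log-likelihood, with `α` unknown, under the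
constraint `∑ i, p_i (φ(Z_i) - α) = 0`. -/
def IsMaxELUnknown {N : ℕ} (φ : 𝒵 → ℝ) (z : Fin N → 𝒵) (d : Fin N → ℝ) (p : Fin N → ℝ) :
    Prop :=
  ∃ α ∈ Set.Ioo (0 : ℝ) 1,
    IsWeight d p ∧ ∑ i, p i * (φ (z i) - α) = 0 ∧
    ∀ α' ∈ Set.Ioo (0 : ℝ) 1, ∀ p', IsWeight d p' → ∑ i, p' i * (φ (z i) - α') = 0 →
      logEL φ z d α' p' ≤ logEL φ z d α p

/-- The empirical likelihood weights: the constrained maximizer with known `α₀` if there is one,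
otherwise the maximizer with unknown `α` if there is one (otherwise they are left arbitrary). -/
def IsELWeights {N k : ℕ} (φ : 𝒵 → ℝ) (α₀ : ℝ) (g : 𝒵 → Fin k → ℝ) (z : Fin N → 𝒵)
    (d : Fin N → ℝ) (p : Fin N → ℝ) : Prop :=
  ((∃ p', IsMaxEL φ α₀ g z d p') → IsMaxEL φ α₀ g z d p) ∧
  ((¬ ∃ p', IsMaxEL φ α₀ g z d p') → (∃ p', IsMaxELUnknown φ z d p') → IsMaxELUnknown φ z d p)

/-- Weighted empirical risk `∑ i, p_i ℓ(Z_i, θ)`. -/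
def weightedRisk {q N : ℕ} (ℓ : 𝒵 → EuclideanSpace ℝ (Fin q) → ℝ) (z : Fin N → 𝒵)
    (p : Fin N → ℝ) (θ : EuclideanSpace ℝ (Fin q)) : ℝ :=
  ∑ i, p i * ℓ (z i) θ

/-- For every sample size `N`, `phat N` are the empirical likelihood weights for the constraint
function `g` computed from the first `N` data, and `θhat N` is a minimizer of the weighted
empirical risk (whenever a minimizer exists); `θhat N` is measurable. -/
structure IsELWEstimator {q k : ℕ} (P : Measure Ω) (Z : ℕ → Ω → 𝒵) (D1 D2 : ℕ → Ω → ℝ)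
    (φ : 𝒵 → ℝ) (α₀ : ℝ) (g : 𝒵 → Fin k → ℝ) (ℓ : 𝒵 → EuclideanSpace ℝ (Fin q) → ℝ)
    (phat : (N : ℕ) → Ω → Fin N → ℝ) (θhat : ℕ → Ω → EuclideanSpace ℝ (Fin q)) : Prop where
  weights : ∀ N ω, IsELWeights φ α₀ g (fun i : Fin N => Z i ω) (fun i : Fin N => incl D1 D2 i ω)
    (phat N ω)
  argmin : ∀ N ω,
    (∃ θ, IsMinOn (weightedRisk ℓ (fun i : Fin N => Z i ω) (phat N ω)) Set.univ θ) →
      IsMinOn (weightedRisk ℓ (fun i : Fin N => Z i ω) (phat N ω)) Set.univ (θhat N ω)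
  aemeasurable : ∀ N, AEMeasurable (θhat N) P

/-! ### Constraint functions and asymptotic covariances -/

/-- `h_e(z) = (φ(z) - α₀, h(z)ᵀ)ᵀ`. -/
def hExt {m : ℕ} (φ : 𝒵 → ℝ) (α₀ : ℝ) (h : 𝒵 → Fin m → ℝ) (z : 𝒵) : Fin (m + 1) → ℝ :=
  Fin.cons (φ z - α₀) (h z)

/-- The one-dimensional constraint function `φ(z) - α₀`: no auxiliary information. -/
def hNone (φ : 𝒵 → ℝ) (α₀ : ℝ) (z : 𝒵) : Fin 1 → ℝ := fun _ => φ z - α₀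

/-- The matrix `E{a(Z) b(Z)ᵀ / φ(Z)}`, entrywise. -/
def B {r s : ℕ} (F : Measure 𝒵) (φ : 𝒵 → ℝ) (a : 𝒵 → Fin r → ℝ) (b : 𝒵 → Fin s → ℝ) :
    Matrix (Fin r) (Fin s) ℝ :=
  Matrix.of fun j k => ∫ z, a z j * b z k / φ z ∂F

/-- `Σ_ELW = V⁻¹ (B_ℓ̇ℓ̇ - B_ℓ̇h B_hh⁻¹ B_ℓ̇hᵀ) V⁻¹`, with `he` in the role of `h_e`. -/
def SigmaELW {q k : ℕ} (F : Measure 𝒵) (φ : 𝒵 → ℝ) (he : 𝒵 → Fin k → ℝ)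
    (dl : 𝒵 → EuclideanSpace ℝ (Fin q)) (V : Matrix (Fin q) (Fin q) ℝ) :
    Matrix (Fin q) (Fin q) ℝ :=
  V⁻¹ * (B F φ (fun z => (dl z).ofLp) (fun z => (dl z).ofLp)
    - B F φ (fun z => (dl z).ofLp) he * (B F φ he he)⁻¹ * (B F φ (fun z => (dl z).ofLp) he)ᵀ) * V⁻¹

/-- `B_ℓ̇1 = E{ℓ̇(Z) / φ(Z)}`. -/
def Bl1 {q : ℕ} (F : Measure 𝒵) (φ : 𝒵 → ℝ) (dl : 𝒵 → EuclideanSpace ℝ (Fin q)) : Fin q → ℝ :=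
  fun j => ∫ z, dl z j / φ z ∂F

/-- `B₁₁ = E{1 / φ(Z)}`. -/
def B11 (F : Measure 𝒵) (φ : 𝒵 → ℝ) : ℝ := ∫ z, 1 / φ z ∂F

/-- `Σ_ELW0 = V⁻¹ {B_ℓ̇ℓ̇ - B_ℓ̇1 B_ℓ̇1ᵀ / (B₁₁ - α₀⁻¹)} V⁻¹`. -/
def SigmaELW0 {q : ℕ} (F : Measure 𝒵) (φ : 𝒵 → ℝ) (α₀ : ℝ)
    (dl : 𝒵 → EuclideanSpace ℝ (Fin q)) (V : Matrix (Fin q) (Fin q) ℝ) :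
    Matrix (Fin q) (Fin q) ℝ :=
  V⁻¹ * (B F φ (fun z => (dl z).ofLp) (fun z => (dl z).ofLp)
    - (B11 F φ - α₀⁻¹)⁻¹ • vecMulVec (Bl1 F φ dl) (Bl1 F φ dl)) * V⁻¹

/-- `√N (θhat N - θ₀)` converges in distribution, as `N → ∞`, to the centred Gaussian law with
(positive semidefinite) covariance matrix `S`. -/
def AsympNormal {q : ℕ} (P : Measure Ω) [IsProbabilityMeasure P]
    (θhat : ℕ → Ω → EuclideanSpace ℝ (Fin q)) (θ₀ : EuclideanSpace ℝ (Fin q))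
    (S : Matrix (Fin q) (Fin q) ℝ) : Prop :=
  S.PosSemidef ∧
    TendstoInDistribution (fun (N : ℕ) ω => √(N : ℝ) • (θhat N ω - θ₀)) atTop
      (id : EuclideanSpace ℝ (Fin q) → EuclideanSpace ℝ (Fin q)) (fun _ => P)
      (multivariateGaussian 0 S)

end ELW

end

/-!
The weights have an explicit dual form. Since `φ - α₀` is a component of the constraint function
`g`, `φ = α₀ + eᵀg` for a unit vector `e`, and the Lagrange conditions of the empirical likelihood
problem reduce to `p_i = (α₀ / n) D_i / (φ(Z_i) + μᵀg(Z_i))` with `n = ∑ D_i`, where the multiplier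
`μ` is a root of `∑ D_i g(Z_i) / (φ(Z_i) + μᵀg(Z_i)) = 0`. By strict concavity of the logarithm any
root with positive denominators gives the unique maximizer (`isMaxEL_iff_eq_multWeight`). With
probability tending to one there is such a root with `√N μ` bounded (`exists_multiplier`,
`exists_multiplier_along`). In particular the case in which the constrained maximizer does not exist
has vanishing probability.

With `A_N = N^{-1/2} ∑ D_i g(Z_i) / φ(Z_i)`, expanding the score equation in `μ` gives
`√N μ = B_gg⁻¹ A_N + o_p(1)`, and the same expansion of the weights then gives
`√N ∑ p_i ℓ̇(Z_i) = U_N + o_p(1)`, where `U_N` is the inverse-probability-weighted sum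
`N^{-1/2} ∑ D_i r(Z_i) / φ(Z_i)` of the residual `r = ℓ̇ - B_ℓ̇g B_gg⁻¹ g`
(`tendsto_weighted_mean_of_root`). Likewise `N ∑ p_i ξ(Z_i, t / √N) → ½ tᵀVt` in probability for
each fixed `t`: first with the weights `D_i / (N φ(Z_i))`, by Chebyshev's inequality for triangular
arrays (`CaptureRecapture.tendsto_sum_incl_div`), then with `p_i`, the difference being controlled
by Cauchy-Schwarz (`tendsto_weighted_remainder`). The rescaled weighted risk is therefore convex and
pointwise close to `⟪U_N, t⟫ + ½ tᵀVt`, and convexity makes its minimizer close to `-V⁻¹ U_N`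
(`eventually_isMinOn_near_of_quadratic`, `estimator_expansion_along`). The central limit theorem for
`U_N` and the identity `E{(rᵀu)² / φ} = uᵀ(B_ℓ̇ℓ̇ - B_ℓ̇g B_gg⁻¹ B_ℓ̇gᵀ)u` then give the limit law.

Convergence in probability is treated as convergence along one filter, `highProb P`, on pairs
`(N, ω)`. Tightness of `A_N` and `U_N` allows this filter to be restricted to a set on which both
are bounded (`tendsto_of_isTight`), so that the expansions become deterministic statements about
filter limits.
-/

namespace ELW

/-! ### Convergence in probability as convergence along a filter -/

/-- The filter on `ℕ × Ω` of the sets whose section at `N` has a complement of (outer) probability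
tending to zero as `N → ∞`. Convergence of `X N` in probability is convergence of `fun x => X x.1 x.2` along this
filter, with no measurability needed. -/
def highProb {Ω : Type*} [MeasurableSpace Ω] (P : Measure Ω) : Filter (ℕ × Ω) where
  sets := {S | Tendsto (fun N => P {ω | (N, ω) ∉ S}) atTop (𝓝 0)}
  univ_sets := by simp
  sets_of_superset {S T} hS hST :=
    tendsto_of_tendsto_of_tendsto_of_le_of_le tendsto_const_nhds hS (fun _ => zero_le)
      fun N => measure_mono fun ω hω h => hω (hST h)
  inter_sets {S T} hS hT := by
    have h := Tendsto.add hS hT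
    rw [add_zero] at h
    refine tendsto_of_tendsto_of_tendsto_of_le_of_le tendsto_const_nhds h (fun _ => zero_le)
      fun N => (measure_mono fun ω hω => ?_).trans (measure_union_le _ _)
    by_contra h'
    simp only [Set.mem_union, Set.mem_ofPred_eq, not_or, not_not] at h'
    exact hω h'

section HighProb

variable {Ω : Type*} [MeasurableSpace Ω] {P : Measure Ω}

lemma eventually_highProb_iff {p : ℕ × Ω → Prop} :
    (∀ᶠ x in highProb P, p x) ↔ Tendsto (fun N => P {ω | ¬ p (N, ω)}) atTop (𝓝 0) :=
  Iff.rfl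

lemma tendsto_fst_highProb : Tendsto Prod.fst (highProb P) atTop := by
  refine tendsto_atTop.2 fun b => ?_
  rw [eventually_highProb_iff]
  refine tendsto_const_nhds.congr' ?_
  filter_upwards [eventually_ge_atTop b] with N hN
  simp [hN]

lemma tendstoInMeasure_iff_highProb {E : Type*} [PseudoMetricSpace E] {X : ℕ → Ω → E} {c : E} :
    TendstoInMeasure P X atTop (fun _ => c) ↔
      Tendsto (fun x : ℕ × Ω => X x.1 x.2) (highProb P) (𝓝 c) := by
  rw [tendstoInMeasure_iff_dist, Metric.tendsto_nhds]
  refine forall₂_congr fun ε _ => ?_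
  rw [eventually_highProb_iff]
  simp

lemma tendsto_highProb_of_ae [IsFiniteMeasure P] {E : Type*} [SeminormedAddCommGroup E]
    {X : ℕ → Ω → E} {c : E} (hX : ∀ N, AEStronglyMeasurable (X N) P)
    (h : ∀ᵐ ω ∂P, Tendsto (fun N => X N ω) atTop (𝓝 c)) :
    Tendsto (fun x : ℕ × Ω => X x.1 x.2) (highProb P) (𝓝 c) :=
  tendstoInMeasure_iff_highProb.1 (tendstoInMeasure_of_tendsto_ae hX h)

/-- Tightness (stochastic boundedness) of a sequence of random vectors. -/
def IsTight (P : Measure Ω) {E : Type*} [Norm E] (X : ℕ × Ω → E) : Prop :=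
  ∀ ε : ENNReal, 0 < ε → ∃ C : ℝ, ∀ᶠ N in atTop, P {ω | C < ‖X (N, ω)‖} ≤ ε

/-- To prove that an event has probability tending to one, it suffices to do so where a tight
sequence is bounded by a constant, for every constant. -/
lemma eventually_of_isTight {E : Type*} [Norm E] {X : ℕ × Ω → E} (hX : IsTight P X)
    {p : ℕ × Ω → Prop} (h : ∀ C : ℝ, ∀ᶠ x in highProb P ⊓ 𝓟 {x | ‖X x‖ ≤ C}, p x) :
    ∀ᶠ x in highProb P, p x := by
  rw [eventually_highProb_iff, ENNReal.tendsto_nhds_zero]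
  intro ε hε
  obtain ⟨C, hC⟩ := hX (ε / 2) (ENNReal.half_pos hε.ne')
  have h1 := h C
  rw [eventually_inf_principal, eventually_highProb_iff, ENNReal.tendsto_nhds_zero] at h1
  filter_upwards [hC, h1 (ε / 2) (ENNReal.half_pos hε.ne')] with N h2 h3
  calc P {ω | ¬ p (N, ω)}
      ≤ P ({ω | C < ‖X (N, ω)‖} ∪ {ω | ¬ ((N, ω) ∈ {x | ‖X x‖ ≤ C} → p (N, ω))}) := by
        refine measure_mono fun ω hω => ?_
        by_cases hc : C < ‖X (N, ω)‖
        · exact Or.inl hc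
        · exact Or.inr fun h' => hω (h' (not_lt.1 hc))
    _ ≤ ε / 2 + ε / 2 := (measure_union_le _ _).trans (add_le_add h2 h3)
    _ = ε := ENNReal.add_halves ε

lemma tendsto_of_isTight {E F : Type*} [Norm E] [TopologicalSpace F] {X : ℕ × Ω → E}
    (hX : IsTight P X) {f : ℕ × Ω → F} {c : F}
    (h : ∀ C : ℝ, Tendsto f (highProb P ⊓ 𝓟 {x | ‖X x‖ ≤ C}) (𝓝 c)) :
    Tendsto f (highProb P) (𝓝 c) :=
  tendsto_def.2 fun _ hs => eventually_of_isTight hX fun C => h C hs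

lemma measure_lt_norm_le [IsFiniteMeasure P] {X : Ω → ℝ} (hX : Integrable X P)
    {a : ℝ} (ha : 0 < a) :
    P {ω | a < |X ω|} ≤ ENNReal.ofReal ((∫ ω, |X ω| ∂P) / a) := by
  have h := mul_meas_ge_le_integral_of_nonneg (μ := P) (f := fun ω => |X ω|)
    (ae_of_all _ fun ω => abs_nonneg (X ω)) hX.abs a
  rw [← le_div_iff₀' ha] at h
  calc P {ω | a < |X ω|} ≤ P {ω | a ≤ |X ω|} := measure_mono fun ω hω => by
        simp only [Set.mem_ofPred_eq] at hω ⊢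
        exact hω.le
    _ = ENNReal.ofReal (P.real {ω | a ≤ |X ω|}) := (ofReal_measureReal (by finiteness)).symm
    _ ≤ _ := ENNReal.ofReal_le_ofReal h

/-- Convergence in mean implies convergence in probability. -/
lemma tendsto_highProb_of_integral [IsFiniteMeasure P] {X : ℕ → Ω → ℝ}
    (hX : ∀ᶠ N in atTop, Integrable (X N) P)
    (h : Tendsto (fun N => ∫ ω, |X N ω| ∂P) atTop (𝓝 0)) :
    Tendsto (fun x : ℕ × Ω => X x.1 x.2) (highProb P) (𝓝 0) := by
  rw [Metric.tendsto_nhds]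
  intro ε hε
  rw [eventually_highProb_iff]
  have h1 : Tendsto (fun N => ENNReal.ofReal ((∫ ω, |X N ω| ∂P) / (ε / 2))) atTop (𝓝 0) := by
    have := ENNReal.tendsto_ofReal (h.div_const (ε / 2))
    simpa using this
  refine tendsto_of_tendsto_of_tendsto_of_le_of_le' tendsto_const_nhds h1
    (Eventually.of_forall fun _ => zero_le) ?_
  filter_upwards [hX] with N hN
  refine (measure_mono fun ω hω => ?_).trans (measure_lt_norm_le hN (half_pos hε))
  simp only [dist_zero_right, Real.norm_eq_abs, not_lt, Set.mem_ofPred_eq] at hω ⊢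
  linarith

/-- Sequences bounded in `L²` are tight. -/
lemma isTight_of_integral_sq_le [IsFiniteMeasure P] {E : Type*} [NormedAddCommGroup E]
    {X : ℕ × Ω → E} (hX : ∀ N, Integrable (fun ω => ‖X (N, ω)‖ ^ 2) P) {K : ℝ}
    (hK : ∀ N, ∫ ω, ‖X (N, ω)‖ ^ 2 ∂P ≤ K) : IsTight P X := by
  intro ε hε
  have h1 : Tendsto (fun C : ℝ => ENNReal.ofReal (K / C)) atTop (𝓝 0) := by
    have := ENNReal.tendsto_ofReal (tendsto_const_nhds (x := K).div_atTop tendsto_id)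
    simpa using this
  obtain ⟨C, hC, hC0⟩ := ((ENNReal.tendsto_nhds_zero.1 h1 ε hε).and
    (eventually_gt_atTop (0 : ℝ))).exists
  refine ⟨√C, Eventually.of_forall fun N => le_trans ?_ hC⟩
  refine (measure_mono fun ω hω => ?_).trans ((measure_lt_norm_le (hX N) hC0).trans
    (ENNReal.ofReal_le_ofReal (div_le_div_of_nonneg_right ?_ hC0.le)))
  · simp only [Set.mem_ofPred_eq] at hω ⊢
    rw [abs_of_nonneg (by positivity)]
    exact (Real.sqrt_lt' ((Real.sqrt_nonneg C).trans_lt hω)).1 hω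
  · simpa using hK N

end HighProb

/-! ### Minimizers of convex functions converging pointwise -/

section Convex

variable {ι E : Type*} [NormedAddCommGroup E] [InnerProductSpace ℝ E] [FiniteDimensional ℝ E]
  {L : Filter ι}

/-- Convex functions that converge pointwise on a finite-dimensional space are eventually
Lipschitz, with a common constant, on every ball. -/
lemma exists_lipschitz_of_convexOn_of_tendsto {f : ι → E → ℝ} {g : E → ℝ}
    (hf : ∀ᶠ x in L, ConvexOn ℝ Set.univ (f x))
    (hfg : ∀ t, Tendsto (fun x => f x t) L (𝓝 (g t))) (R : ℝ) :
    ∃ K : NNReal, ∀ᶠ x in L, LipschitzOnWith K (f x) (Metric.ball 0 R) := by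
  obtain ⟨T, hT, -⟩ := (convex_closedBall (0 : E)
    (R + 1)).exists_subset_interior_convexHull_finset_of_isCompact (isCompact_closedBall 0 (R + 1))
    (t := Set.univ) Filter.univ_mem
  obtain ⟨M, hM⟩ : ∃ M : ℝ, ∀ t ∈ T, g t + 1 ≤ M := by
    obtain ⟨M, hM⟩ := (T.image fun t => g t + 1).bddAbove
    exact ⟨M, fun t ht => hM (Finset.mem_coe.2 (Finset.mem_image_of_mem _ ht))⟩
  have hT1 : ∀ᶠ x in L, ∀ t ∈ T, f x t ≤ M := by
    rw [Finset.eventually_all]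
    intro t ht
    filter_upwards [(hfg t).eventually (gt_mem_nhds (lt_add_one (g t)))] with x hx
    exact hx.le.trans (hM t ht)
  refine ⟨(2 * max M (M - 2 * (g 0 - 1)) / 1).toNNReal, ?_⟩
  filter_upwards [hf, hT1, (hfg 0).eventually (lt_mem_nhds (sub_one_lt (g 0)))] with x hx h1 h0
  have hup : ∀ a : E, dist a 0 < R + 1 → f x a ≤ M := fun a ha => by
    obtain ⟨y, hy, hxy⟩ := hx.exists_ge_of_mem_convexHull (Set.subset_univ _)
      (interior_subset (hT (Metric.mem_closedBall.2 ha.le)))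
    exact hxy.trans (h1 y hy)
  have key := (hx.subset (Set.subset_univ _)
    (convex_ball (0 : E) (R + 1))).lipschitzOnWith_of_abs_le
    (M := max M (M - 2 * (g 0 - 1))) one_pos fun a ha => by
    have h2 := hup a ha
    have h3 := hup (-a) (by simpa using ha)
    have h4 := hx.2 (Set.mem_univ a) (Set.mem_univ (-a)) (by norm_num : (0 : ℝ) ≤ 1 / 2)
      (by norm_num : (0 : ℝ) ≤ 1 / 2) (by norm_num)
    simp only [smul_neg, add_neg_cancel, smul_eq_mul] at h4
    rw [abs_le]
    constructor
    · linarith [le_max_right M (M - 2 * (g 0 - 1))]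
    · exact h2.trans (le_max_left _ _)
  simpa using key

/-- Pointwise convergence of convex functions on a finite-dimensional space is uniform on balls. -/
lemma eventually_abs_sub_lt_of_convexOn_of_tendsto {f : ι → E → ℝ} {g : E → ℝ}
    (hf : ∀ᶠ x in L, ConvexOn ℝ Set.univ (f x)) (hg : Continuous g)
    (hfg : ∀ t, Tendsto (fun x => f x t) L (𝓝 (g t))) (R : ℝ) {ε : ℝ} (hε : 0 < ε) :
    ∀ᶠ x in L, ∀ t ∈ Metric.closedBall (0 : E) R, |f x t - g t| < ε := by
  obtain ⟨K, hK⟩ := exists_lipschitz_of_convexOn_of_tendsto hf hfg (R + 1)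
  refine (isCompact_closedBall (0 : E) R).induction_on
    (p := fun s => ∀ᶠ x in L, ∀ t ∈ s, |f x t - g t| < ε) (by simp)
    (fun s t hst h => h.mono fun x hx y hy => hx y (hst hy))
    (fun s t hs ht => by
      filter_upwards [hs, ht] with x h1 h2 y hy
      exact hy.elim (h1 y) (h2 y)) ?_
  intro y hy
  have hU : {t : E | t ∈ Metric.ball 0 (R + 1) ∧ |g t - g y| < ε / 3 ∧ K * dist t y < ε / 3} ∈
      𝓝 y := by
    refine Filter.inter_mem (Metric.isOpen_ball.mem_nhds ?_) (Filter.inter_mem ?_ ?_)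
    · exact Metric.closedBall_subset_ball (lt_add_one R) hy
    · have := hg.tendsto y
      rw [Metric.tendsto_nhds] at this
      exact this _ (by positivity)
    · have : Tendsto (fun t => (K : ℝ) * dist t y) (𝓝 y) (𝓝 (K * dist y y)) :=
        Continuous.tendsto (by fun_prop) y
      rw [dist_self, mul_zero] at this
      exact this.eventually (gt_mem_nhds (by positivity))
  refine ⟨_, mem_nhdsWithin_of_mem_nhds hU, ?_⟩
  have hfy := Metric.tendsto_nhds.1 (hfg y) (ε / 3) (by positivity)
  filter_upwards [hK, hfy] with x hx hxy t ht
  have h1 := hx.dist_le_mul t ht.1 y (mem_of_mem_nhds hU).1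
  rw [Real.dist_eq] at h1 hxy
  have h2 := abs_sub_comm (g t) (g y)
  calc |f x t - g t| = |(f x t - f x y) + (f x y - g y) + (g y - g t)| := by ring_nf
    _ ≤ |f x t - f x y| + |f x y - g y| + |g y - g t| := abs_add_three _ _ _
    _ < ε := by linarith [ht.2.1, ht.2.2]

/-- A convex function that is larger on a sphere than at its centre has a minimizer, and all
minimizers lie in the ball. -/
lemma exists_isMinOn_of_lt_on_sphere {G : E → ℝ} (hG : ConvexOn ℝ Set.univ G) {c : E} {δ : ℝ}
    (hδ : 0 < δ) (h : ∀ t ∈ Metric.sphere c δ, G c < G t) :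
    (∃ t, IsMinOn G Set.univ t) ∧ ∀ t, IsMinOn G Set.univ t → dist t c < δ := by
  have key : ∀ t, δ ≤ dist t c → G c < G t := by
    intro t ht
    by_contra! hle
    have hpos : 0 < dist t c := hδ.trans_le ht
    set s := c + (δ / dist t c) • (t - c) with hs
    have hseg : s ∈ segment ℝ c t := by
      rw [segment_eq_image']
      exact ⟨δ / dist t c, ⟨by positivity, (div_le_one hpos).2 ht⟩, rfl⟩
    have hsph : s ∈ Metric.sphere c δ := by
      rw [Metric.mem_sphere, dist_eq_norm, hs, add_sub_cancel_left, norm_smul, ← dist_eq_norm,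
        Real.norm_of_nonneg (by positivity), div_mul_cancel₀ _ hpos.ne']
    have := hG.le_on_segment (Set.mem_univ _) (Set.mem_univ _) hseg
    rw [max_eq_left hle] at this
    exact (h s hsph).not_ge this
  refine ⟨?_, fun t ht => ?_⟩
  · have hcont : Continuous G := by
      rw [← continuousOn_univ]
      exact hG.continuousOn isOpen_univ
    obtain ⟨t, ht, hmin⟩ := (isCompact_closedBall c δ).exists_isMinOn
      ⟨c, Metric.mem_closedBall_self hδ.le⟩ hcont.continuousOn
    refine ⟨t, fun y _ => ?_⟩
    by_cases hy : y ∈ Metric.closedBall c δ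
    · exact hmin hy
    · exact (hmin (Metric.mem_closedBall_self hδ.le)).trans
        (key y (not_le.1 (by simpa using hy)).le).le
  · by_contra! hle
    exact (key t hle).not_ge (ht (Set.mem_univ c))

/-- If convex functions `G x` have a quadratic limit after subtraction of a bounded random linear
term `⟪U x, ·⟫`, then they eventually have minimizers, and these are `-A⁻¹ (U x)` up to a vanishing
error. -/
lemma eventually_isMinOn_near_of_quadratic {G : ι → E → ℝ} {U : ι → E} {A A' : E →L[ℝ] E}
    (hG : ∀ᶠ x in L, ConvexOn ℝ Set.univ (G x)) {C : ℝ} (hU : ∀ᶠ x in L, ‖U x‖ ≤ C)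
    (hsymm : ∀ s t : E, inner ℝ (A s) t = inner ℝ s (A t)) {c : ℝ} (hc : 0 < c)
    (hpos : ∀ t, c * ‖t‖ ^ 2 ≤ inner ℝ (A t) t) (hA' : ∀ v, A (A' v) = v)
    (hlim : ∀ t, Tendsto (fun x => G x t - inner ℝ (U x) t) L (𝓝 (1 / 2 * inner ℝ (A t) t)))
    {δ : ℝ} (hδ : 0 < δ) :
    ∀ᶠ x in L, (∃ t, IsMinOn (G x) Set.univ t) ∧
      ∀ t, IsMinOn (G x) Set.univ t → ‖t + A' (U x)‖ < δ := by
  have hconv : ∀ᶠ x in L, ConvexOn ℝ Set.univ fun t => G x t - inner ℝ (U x) t := by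
    filter_upwards [hG] with x hx
    exact hx.sub ((innerSL ℝ (U x)).toLinearMap.concaveOn convex_univ)
  have hunif := eventually_abs_sub_lt_of_convexOn_of_tendsto hconv
    (g := fun t => 1 / 2 * inner ℝ (A t) t) (by fun_prop) hlim (‖A'‖ * C + δ)
    (ε := c * δ ^ 2 / 8) (by positivity)
  filter_upwards [hG, hU, hunif] with x hGx hUx hx
  have hA'U : ‖A' (U x)‖ ≤ ‖A'‖ * C :=
    (A'.le_opNorm _).trans (mul_le_mul_of_nonneg_left hUx (norm_nonneg _))
  have := exists_isMinOn_of_lt_on_sphere hGx (c := -A' (U x)) hδ ?_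
  · simpa [dist_eq_norm] using this
  intro t ht
  rw [Metric.mem_sphere, dist_eq_norm, sub_neg_eq_add] at ht
  have h1 := hx t (by
    rw [mem_closedBall_zero_iff]
    calc ‖t‖ = ‖(t + A' (U x)) - A' (U x)‖ := by rw [add_sub_cancel_right]
      _ ≤ ‖t + A' (U x)‖ + ‖A' (U x)‖ := norm_sub_le _ _
      _ ≤ _ := by linarith)
  have h2 := hx (-A' (U x)) (by rw [mem_closedBall_zero_iff, norm_neg]; linarith)
  have h3 := hpos (t + A' (U x))
  -- completing the square
  have h4 : inner ℝ (A (t + A' (U x))) (t + A' (U x)) =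
      inner ℝ (A t) t + 2 * inner ℝ (U x) t + inner ℝ (U x) (A' (U x)) := by
    rw [map_add, hA', inner_add_left, inner_add_right, inner_add_right, hsymm t (A' (U x)), hA',
      real_inner_comm t (U x)]
    ring
  rw [ht, h4] at h3
  simp only [map_neg, inner_neg_left, inner_neg_right, hA', neg_neg] at h2
  rw [abs_lt] at h1 h2
  nlinarith [h1.1, h2.2, mul_pos hc (pow_pos hδ 2)]

end Convex

/-! ### Empirical likelihood weights and the Lagrange multiplier -/

section Multiplier

variable {𝒵 : Type*} {N k : ℕ} {φ : 𝒵 → ℝ} {α₀ : ℝ} {g : 𝒵 → Fin k → ℝ} {z : Fin N → 𝒵}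
  {d : Fin N → ℝ}

/-- The weights `p_i = (α₀ / ∑ d) d_i / (φ(z_i) + ⟪g(z_i), μ⟫)` attached to a multiplier `μ`. -/
noncomputable def multWeight (φ : 𝒵 → ℝ) (α₀ : ℝ) (g : 𝒵 → Fin k → ℝ) (z : Fin N → 𝒵)
    (d : Fin N → ℝ) (μ : EuclideanSpace ℝ (Fin k)) (i : Fin N) : ℝ :=
  α₀ / (∑ j, d j) * (d i / (φ (z i) + inner ℝ (WithLp.toLp 2 (g (z i))) μ))

lemma sum_inner_eq_zero {p : Fin N → ℝ} (hp : ∑ i, p i • g (z i) = 0)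
    (v : EuclideanSpace ℝ (Fin k)) :
    ∑ i, p i * inner ℝ (WithLp.toLp 2 (g (z i))) v = 0 := by
  have h : ∑ i, p i • (WithLp.toLp 2 (g (z i)) : EuclideanSpace ℝ (Fin k)) = 0 := by
    have := congrArg (WithLp.toLp 2) hp
    simpa using this
  have := congrArg (fun x => inner ℝ x v) h
  simpa [sum_inner, inner_smul_left] using this

lemma feasible_multWeight (hα : 0 < α₀) {e : EuclideanSpace ℝ (Fin k)}
    (he : ∀ z, φ z = α₀ + inner ℝ (WithLp.toLp 2 (g z)) e)
    (hn : 0 < ∑ i, d i) {μ : EuclideanSpace ℝ (Fin k)}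
    (hpos : ∀ i, 0 < φ (z i) + inner ℝ (WithLp.toLp 2 (g (z i))) μ)
    (hroot : ∑ i, (d i / (φ (z i) + inner ℝ (WithLp.toLp 2 (g (z i))) μ)) •
      (WithLp.toLp 2 (g (z i)) : EuclideanSpace ℝ (Fin k)) = 0) :
    Feasible g z d (multWeight φ α₀ g z d μ) := by
  have hroot' : ∑ i, (d i / (φ (z i) + inner ℝ (WithLp.toLp 2 (g (z i))) μ)) • g (z i) = 0 := by
    have := congrArg WithLp.ofLp hroot
    simpa using this
  refine ⟨⟨fun i hi => ?_, fun i hi => ?_, ?_⟩, ?_⟩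
  · have := hpos i
    rw [multWeight, hi]
    positivity
  · simp [multWeight, hi]
  · have h1 := sum_inner_eq_zero hroot' (e + μ)
    have h2 : ∑ i, d i = α₀ * ∑ i, d i / (φ (z i) + inner ℝ (WithLp.toLp 2 (g (z i))) μ) := by
      rw [← add_zero (α₀ * _), ← h1, Finset.mul_sum, ← Finset.sum_add_distrib]
      refine Finset.sum_congr rfl fun i _ => ?_
      have hw := (hpos i).ne'
      rw [inner_add_right]
      have := he (z i)
      field_simp
      linear_combination d i * this
    simp only [multWeight]
    rw [← Finset.mul_sum, div_mul_eq_mul_div, ← h2, div_self hn.ne']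
  · simp only [multWeight, mul_smul]
    rw [← Finset.smul_sum, hroot', smul_zero]

/-- Every other feasible weight has a strictly smaller likelihood, by `log x < x - 1`. -/
lemma logEL_lt_multWeight (hα : 0 < α₀) {e : EuclideanSpace ℝ (Fin k)}
    (he : ∀ z, φ z = α₀ + inner ℝ (WithLp.toLp 2 (g z)) e) (hd : ∀ i, d i = 0 ∨ d i = 1)
    (hn : 0 < ∑ i, d i) {μ : EuclideanSpace ℝ (Fin k)}
    (hpos : ∀ i, 0 < φ (z i) + inner ℝ (WithLp.toLp 2 (g (z i))) μ)
    {p : Fin N → ℝ} (hp : Feasible g z d p) (hne : p ≠ multWeight φ α₀ g z d μ) :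
    logEL φ z d α₀ p < logEL φ z d α₀ (multWeight φ α₀ g z d μ) := by
  have hsum : ∑ i, p i * (φ (z i) + inner ℝ (WithLp.toLp 2 (g (z i))) μ) = α₀ := by
    have h1 := sum_inner_eq_zero hp.2 (e + μ)
    calc _ = ∑ i, (α₀ * p i + p i * inner ℝ (WithLp.toLp 2 (g (z i))) (e + μ)) := by
          refine Finset.sum_congr rfl fun i _ => ?_
          rw [he (z i), inner_add_right]; ring
      _ = α₀ := by rw [Finset.sum_add_distrib, h1, ← Finset.mul_sum, hp.1.2.2]; ring
  have hzero : ∑ i, ((∑ j, d j) / α₀ * (p i * (φ (z i) + inner ℝ (WithLp.toLp 2 (g (z i))) μ))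
      - d i) = 0 := by
    rw [Finset.sum_sub_distrib, ← Finset.mul_sum, hsum, div_mul_cancel₀ _ hα.ne', sub_self]
  rw [← sub_neg, logEL, logEL, ← Finset.sum_sub_distrib, ← hzero]
  have hterm : ∀ i, d i = 1 → multWeight φ α₀ g z d μ i ≠ 0 ∧
      p i / multWeight φ α₀ g z d μ i = (∑ j, d j) / α₀ *
        (p i * (φ (z i) + inner ℝ (WithLp.toLp 2 (g (z i))) μ)) := by
    intro i hi
    have hw := hpos i
    rw [multWeight, hi]
    refine ⟨by positivity, ?_⟩
    field_simp
  have hle : ∀ i, d i * Real.log (p i) - d i * Real.log (multWeight φ α₀ g z d μ i) ≤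
      (∑ j, d j) / α₀ * (p i * (φ (z i) + inner ℝ (WithLp.toLp 2 (g (z i))) μ)) - d i ∧
      (p i ≠ multWeight φ α₀ g z d μ i →
      d i * Real.log (p i) - d i * Real.log (multWeight φ α₀ g z d μ i) <
      (∑ j, d j) / α₀ * (p i * (φ (z i) + inner ℝ (WithLp.toLp 2 (g (z i))) μ)) - d i) := by
    intro i
    rcases hd i with hi | hi
    · simp [hi, hp.1.2.1 i hi, multWeight]
    · obtain ⟨h1, h2⟩ := hterm i hi
      have hp0 := hp.1.1 i hi
      have hq0 : 0 < multWeight φ α₀ g z d μ i := by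
        have hw := hpos i
        rw [multWeight, hi]
        positivity
      rw [hi, one_mul, one_mul, ← Real.log_div hp0.ne' h1, ← h2]
      refine ⟨Real.log_le_sub_one_of_pos (by positivity), fun hpq => ?_⟩
      exact Real.log_lt_sub_one_of_pos (by positivity) fun h => hpq ((div_eq_one_iff_eq h1).1 h)
  refine Finset.sum_lt_sum (fun i _ => ?_) ?_
  · have := (hle i).1
    linarith
  · obtain ⟨i, hi⟩ := Function.ne_iff.1 hne
    refine ⟨i, Finset.mem_univ i, ?_⟩
    have := (hle i).2 hi
    linarith

/-- A root `μ` of the score equation yields the unique maximizer of the empirical likelihood. -/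
lemma isMaxEL_iff_eq_multWeight (hα : 0 < α₀) {e : EuclideanSpace ℝ (Fin k)}
    (he : ∀ z, φ z = α₀ + inner ℝ (WithLp.toLp 2 (g z)) e) (hd : ∀ i, d i = 0 ∨ d i = 1)
    (hn : 0 < ∑ i, d i) {μ : EuclideanSpace ℝ (Fin k)}
    (hpos : ∀ i, 0 < φ (z i) + inner ℝ (WithLp.toLp 2 (g (z i))) μ)
    (hroot : ∑ i, (d i / (φ (z i) + inner ℝ (WithLp.toLp 2 (g (z i))) μ)) •
      (WithLp.toLp 2 (g (z i)) : EuclideanSpace ℝ (Fin k)) = 0) (p : Fin N → ℝ) :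
    IsMaxEL φ α₀ g z d p ↔ p = multWeight φ α₀ g z d μ := by
  have hf := feasible_multWeight hα he hn hpos hroot
  refine ⟨fun hp => ?_, ?_⟩
  · by_contra hne
    exact (logEL_lt_multWeight hα he hd hn hpos hp.1 hne).not_ge (hp.2 _ hf)
  · rintro rfl
    refine ⟨hf, fun p' hp' => ?_⟩
    by_cases h : p' = multWeight φ α₀ g z d μ
    · rw [h]
    · exact (logEL_lt_multWeight hα he hd hn hpos hp' h).le

end Multiplier

section Root

variable {E : Type*} [NormedAddCommGroup E] [InnerProductSpace ℝ E] [FiniteDimensional ℝ E]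

lemma log_one_add_le {u : ℝ} (hu : |u| ≤ 1 / 8) : Real.log (1 + u) ≤ u - u ^ 2 / 4 := by
  have h := Real.abs_log_sub_add_sum_range_le (x := -u) (by rw [abs_neg]; linarith) 2
  have h2 : |u| ^ 3 / (1 - |u|) ≤ u ^ 2 / 4 := by
    rw [div_le_iff₀ (by linarith), ← sq_abs u]
    nlinarith [sq_nonneg |u|, abs_nonneg u]
  simp only [Finset.sum_range_succ, Finset.sum_range_zero, abs_neg] at h
  have h3 := (le_abs_self _).trans h
  norm_num at h3
  linarith

/-- Existence of a root of the score equation near the origin: the convex dual function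
`-∑ d log (φ + ⟪H, ·⟫)` is larger on a sphere than at `0`, hence has an interior minimum. -/
lemma exists_multiplier {N : ℕ} {φ d : Fin N → ℝ} {H : Fin N → E} {a r : ℝ} (ha : 0 < a)
    (hφ : ∀ i, a ≤ φ i) (hd : ∀ i, 0 ≤ d i) (hr : 0 < r) (hrH : ∀ i, r * ‖H i‖ ≤ a / 8)
    (hlt : ∀ u : E, ‖u‖ = r → inner ℝ (∑ i, (d i / φ i) • H i) u <
      1 / 4 * ∑ i, d i / φ i ^ 2 * inner ℝ (H i) u ^ 2) :
    ∃ μ : E, ‖μ‖ < r ∧ ∑ i, (d i / (φ i + inner ℝ (H i) μ)) • H i = 0 := by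
  have hφ0 : ∀ i, 0 < φ i := fun i => ha.trans_le (hφ i)
  have hinner : ∀ u : E, ‖u‖ ≤ r → ∀ i, |inner ℝ (H i) u| ≤ φ i / 8 := fun u hu i => by
    have h1 := abs_real_inner_le_norm (H i) u
    have h2 := mul_le_mul_of_nonneg_left hu (norm_nonneg (H i))
    have h3 := hrH i
    have h4 := hφ i
    linarith [mul_comm r ‖H i‖]
  have hpos : ∀ u : E, ‖u‖ ≤ r → ∀ i, 0 < φ i + inner ℝ (H i) u := fun u hu i => by
    have h1 := hφ0 i
    linarith [(abs_le.1 (hinner u hu i)).1]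
  set f : E → ℝ := fun u => -∑ i, d i * Real.log (φ i + inner ℝ (H i) u) with hf
  have hcont : ContinuousOn f (Metric.closedBall 0 r) := by
    refine ContinuousOn.neg (continuousOn_finsetSum _ fun i _ => ContinuousOn.mul
      continuousOn_const (ContinuousOn.log (by fun_prop) fun u hu => ?_))
    exact (hpos u (mem_closedBall_zero_iff.1 hu) i).ne'
  obtain ⟨μ, hμ, hmin⟩ := (isCompact_closedBall (0 : E) r).exists_isMinOn
    ⟨0, Metric.mem_closedBall_self hr.le⟩ hcont
  rw [mem_closedBall_zero_iff] at hμ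
  have hμr : ‖μ‖ < r := by
    refine lt_of_le_of_ne hμ fun heq => ?_
    have h0 : f μ ≤ f 0 := hmin (Metric.mem_closedBall_self hr.le)
    have h1 : ∀ i, d i * Real.log (φ i + inner ℝ (H i) μ) ≤ d i * Real.log (φ i) +
        (d i / φ i * inner ℝ (H i) μ - 1 / 4 * (d i / φ i ^ 2 * inner ℝ (H i) μ ^ 2)) := by
      intro i
      have h2 := (hφ0 i).ne'
      have h3 : φ i + inner ℝ (H i) μ = φ i * (1 + inner ℝ (H i) μ / φ i) := by field_simp
      have h5 : |inner ℝ (H i) μ / φ i| ≤ 1 / 8 := by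
        rw [abs_div, abs_of_pos (hφ0 i), div_le_iff₀ (hφ0 i)]
        linarith [hinner μ hμ i]
      have h6 := log_one_add_le h5
      have h4 : 1 + inner ℝ (H i) μ / φ i ≠ 0 := by
        rw [abs_le] at h5
        exact (by linarith [h5.1] : 0 < 1 + inner ℝ (H i) μ / φ i).ne'
      rw [h3, Real.log_mul h2 h4]
      calc d i * (Real.log (φ i) + Real.log (1 + inner ℝ (H i) μ / φ i))
          ≤ d i * (Real.log (φ i) + (inner ℝ (H i) μ / φ i - (inner ℝ (H i) μ / φ i) ^ 2 / 4)) := by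
            have := hd i
            gcongr
        _ = _ := by field_simp
    have h2 := Finset.sum_le_sum fun i (_ : i ∈ Finset.univ) => h1 i
    rw [Finset.sum_add_distrib, Finset.sum_sub_distrib, ← Finset.mul_sum] at h2
    have h3 := hlt μ heq
    rw [sum_inner] at h3
    simp only [inner_smul_left, RCLike.conj_to_real] at h3
    simp only [hf, inner_zero_right, add_zero] at h0
    linarith
  refine ⟨μ, hμr, ?_⟩
  have hloc : IsLocalMin f μ := hmin.isLocalMin
    (Metric.closedBall_mem_nhds_of_mem (mem_ball_zero_iff.2 hμr))
  set s := ∑ i, (d i / (φ i + inner ℝ (H i) μ)) • H i with hs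
  have hder : HasDerivAt (fun τ : ℝ => f (μ + τ • s))
      (-∑ i, d i * (inner ℝ (H i) s / (φ i + inner ℝ (H i) μ))) 0 := by
    refine HasDerivAt.neg (HasDerivAt.fun_sum fun i _ => HasDerivAt.const_mul _ ?_)
    have h1 : HasDerivAt (fun τ : ℝ => φ i + inner ℝ (H i) (μ + τ • s)) (inner ℝ (H i) s) 0 := by
      have : (fun τ : ℝ => φ i + inner ℝ (H i) (μ + τ • s)) =
          fun τ : ℝ => (φ i + inner ℝ (H i) μ) + τ * inner ℝ (H i) s := by
        ext τ; rw [inner_add_right, inner_smul_right]; ring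
      rw [this]
      simpa using ((hasDerivAt_id (0 : ℝ)).mul_const (inner ℝ (H i) s)).const_add
        (φ i + inner ℝ (H i) μ)
    have := h1.log (by simpa using (hpos μ hμ i).ne')
    simpa using this
  have hloc0 : IsLocalMin (fun τ : ℝ => f (μ + τ • s)) 0 := by
    have hc : Tendsto (fun τ : ℝ => μ + τ • s) (𝓝 0) (𝓝 μ) := by
      have : Tendsto (fun τ : ℝ => μ + τ • s) (𝓝 0) (𝓝 (μ + (0 : ℝ) • s)) :=
        Continuous.tendsto (by fun_prop) 0
      simpa using this
    have := hc.eventually hloc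
    simpa [IsLocalMin, IsMinFilter] using this
  have h0 := hloc0.hasDerivAt_eq_zero hder
  have h1 : inner ℝ s s = 0 := by
    rw [neg_eq_zero] at h0
    rw [hs, sum_inner, ← h0]
    refine Finset.sum_congr rfl fun i _ => ?_
    rw [inner_smul_left, RCLike.conj_to_real]
    ring
  exact inner_self_eq_zero.1 h1

end Root

/-! ### Expansion of the multiplier along a filter -/

section Expansion

variable {ι E E' : Type*} [NormedAddCommGroup E] [InnerProductSpace ℝ E]
  [NormedAddCommGroup E'] [InnerProductSpace ℝ E'] {L : Filter ι} {n : ι → ℕ}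
  {φ d : ∀ x, Fin (n x) → ℝ} {H : ∀ x, Fin (n x) → E} {a : ℝ}

lemma eventually_abs_inner_le (hmax : ∀ ε > 0, ∀ᶠ x in L, ∀ i, ‖H x i‖ ≤ ε * √(n x)) {μ : ι → E}
    {M : ℝ} (hμ : ∀ᶠ x in L, √(n x) * ‖μ x‖ ≤ M) {ε : ℝ} (hε : 0 < ε) :
    ∀ᶠ x in L, ∀ i, |inner ℝ (H x i) (μ x)| ≤ ε := by
  filter_upwards [hmax (ε / (|M| + 1)) (by positivity), hμ] with x h1 h2 i
  calc |inner ℝ (H x i) (μ x)| ≤ ‖H x i‖ * ‖μ x‖ := abs_real_inner_le_norm _ _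
    _ ≤ ε / (|M| + 1) * √(n x) * ‖μ x‖ := by gcongr; exact h1 i
    _ = ε / (|M| + 1) * (√(n x) * ‖μ x‖) := by ring
    _ ≤ ε / (|M| + 1) * (|M| + 1) := by
      gcongr
      linarith [le_abs_self M]
    _ = ε := by field_simp

/-- Second order bound for the effect of the multiplier on an inverse-probability-weighted mean. -/
lemma norm_sum_sub_le {N : ℕ} {φ d : Fin N → ℝ} {H : Fin N → E} {W : Fin N → E'} (ha : 0 < a)
    (hφ : ∀ i, a ≤ φ i) (hd : ∀ i, d i ∈ Set.Icc (0 : ℝ) 1) {μ : E} {ε : ℝ}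
    (hε : ∀ i, |inner ℝ (H i) μ| ≤ ε) (hεa : ε ≤ a / 2) :
    ‖∑ i, (d i / (φ i + inner ℝ (H i) μ)) • W i - ∑ i, (d i / φ i) • W i
      + (∑ i, (d i / φ i ^ 2) • InnerProductSpace.rankOne ℝ (W i) (H i)) μ‖
      ≤ 2 / a ^ 3 * ε * ‖μ‖ * ∑ i, ‖H i‖ * ‖W i‖ := by
  have hterm : ∀ i, ‖(d i / (φ i + inner ℝ (H i) μ)) • W i - (d i / φ i) • W i
      + ((d i / φ i ^ 2) • InnerProductSpace.rankOne ℝ (W i) (H i)) μ‖ ≤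
      2 / a ^ 3 * ε * ‖μ‖ * (‖H i‖ * ‖W i‖) := by
    intro i
    have h1 := hφ i
    have h2 := (abs_le.1 (hε i)).1
    have h3 : 0 < φ i := ha.trans_le h1
    have h4 : a / 2 ≤ φ i + inner ℝ (H i) μ := by linarith
    have h4' : 0 < φ i + inner ℝ (H i) μ := by linarith
    have heq : (d i / (φ i + inner ℝ (H i) μ)) • W i - (d i / φ i) • W i
        + ((d i / φ i ^ 2) • InnerProductSpace.rankOne ℝ (W i) (H i)) μ =
        (d i * inner ℝ (H i) μ ^ 2 / (φ i ^ 2 * (φ i + inner ℝ (H i) μ))) • W i := by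
      rw [_root_.smul_apply, InnerProductSpace.rankOne_apply, smul_smul, ← sub_smul,
        ← add_smul]
      congr 1
      field_simp
      ring
    have h5 : |d i| ≤ 1 := by rw [abs_of_nonneg (hd i).1]; exact (hd i).2
    rw [heq, norm_smul, Real.norm_eq_abs, abs_div, abs_mul, abs_pow, abs_mul, abs_pow,
      abs_of_pos h3, abs_of_pos h4']
    have h6 : |inner ℝ (H i) μ| ^ 2 ≤ ε * (‖H i‖ * ‖μ‖) := by
      rw [pow_two]
      exact mul_le_mul (hε i) (abs_real_inner_le_norm _ _) (abs_nonneg _)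
        ((abs_nonneg _).trans (hε i))
    calc |d i| * |inner ℝ (H i) μ| ^ 2 / (φ i ^ 2 * (φ i + inner ℝ (H i) μ)) * ‖W i‖
        ≤ 1 * (ε * (‖H i‖ * ‖μ‖)) / (a ^ 2 * (a / 2)) * ‖W i‖ := by
          gcongr
          exact mul_nonneg zero_le_one ((sq_nonneg _).trans h6)
      _ = _ := by field_simp
  have hsum : ∑ i, (d i / (φ i + inner ℝ (H i) μ)) • W i - ∑ i, (d i / φ i) • W i
      + (∑ i, (d i / φ i ^ 2) • InnerProductSpace.rankOne ℝ (W i) (H i)) μ =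
      ∑ i, ((d i / (φ i + inner ℝ (H i) μ)) • W i - (d i / φ i) • W i
        + ((d i / φ i ^ 2) • InnerProductSpace.rankOne ℝ (W i) (H i)) μ) := by
    rw [Finset.sum_add_distrib, Finset.sum_sub_distrib, _root_.sum_apply]
  rw [hsum, Finset.mul_sum]
  exact (norm_sum_le _ _).trans (Finset.sum_le_sum fun i _ => hterm i)

lemma tendsto_weighted_mean_expansion (ha : 0 < a) (hφ : ∀ x i, a ≤ φ x i)
    (hd : ∀ x i, d x i ∈ Set.Icc (0 : ℝ) 1)
    (hmax : ∀ ε > 0, ∀ᶠ x in L, ∀ i, ‖H x i‖ ≤ ε * √(n x))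
    {μ : ι → E} {M : ℝ} (hμ : ∀ᶠ x in L, √(n x) * ‖μ x‖ ≤ M) {W : ∀ x, Fin (n x) → E'} {K : ℝ}
    (hK : ∀ᶠ x in L, (n x : ℝ)⁻¹ * ∑ i, ‖H x i‖ * ‖W x i‖ ≤ K) {T : E →L[ℝ] E'}
    (hT : Tendsto (fun x => (n x : ℝ)⁻¹ •
      ∑ i, (d x i / φ x i ^ 2) • InnerProductSpace.rankOne ℝ (W x i) (H x i)) L (𝓝 T)) :
    Tendsto (fun x => √(n x) • ((n x : ℝ)⁻¹ •
        ∑ i, (d x i / (φ x i + inner ℝ (H x i) (μ x))) • W x i)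
      - (√(n x) • ((n x : ℝ)⁻¹ • ∑ i, (d x i / φ x i) • W x i) - T (√(n x) • μ x))) L (𝓝 0) := by
  have h1 : Tendsto (fun x => ((n x : ℝ)⁻¹ •
      ∑ i, (d x i / φ x i ^ 2) • InnerProductSpace.rankOne ℝ (W x i) (H x i) - T) (√(n x) • μ x))
      L (𝓝 0) := by
    rw [tendsto_iff_norm_sub_tendsto_zero] at hT
    have hT' := hT.mul_const M
    rw [zero_mul] at hT'
    refine squeeze_zero_norm' ?_ hT'
    filter_upwards [hμ] with x hx
    refine (ContinuousLinearMap.le_opNorm _ _).trans ?_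
    rw [norm_smul, Real.norm_of_nonneg (Real.sqrt_nonneg _)]
    gcongr
  have h2 : Tendsto (fun x => √(n x) • ((n x : ℝ)⁻¹ •
      (∑ i, (d x i / (φ x i + inner ℝ (H x i) (μ x))) • W x i - ∑ i, (d x i / φ x i) • W x i
      + (∑ i, (d x i / φ x i ^ 2) • InnerProductSpace.rankOne ℝ (W x i) (H x i)) (μ x)))) L
      (𝓝 0) := by
    rw [Metric.tendsto_nhds]
    intro δ hδ
    set ε := min (a / 2) (δ / 2 / (2 / a ^ 3 * (|M| + 1) * (|K| + 1))) with hε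
    have hε0 : 0 < ε := by positivity
    filter_upwards [eventually_abs_inner_le hmax hμ hε0, hμ, hK] with x hx hx2 hx3
    have h3 := norm_sum_sub_le (W := W x) ha (hφ x) (hd x) hx (min_le_left _ _)
    rw [dist_zero_right, norm_smul, norm_smul, norm_inv, Real.norm_of_nonneg (Real.sqrt_nonneg _),
      Real.norm_of_nonneg (Nat.cast_nonneg _)]
    have hM : √(n x) * ‖μ x‖ ≤ |M| + 1 := hx2.trans (by linarith [le_abs_self M])
    have hK' : (n x : ℝ)⁻¹ * ∑ i, ‖H x i‖ * ‖W x i‖ ≤ |K| + 1 :=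
      hx3.trans (by linarith [le_abs_self K])
    calc _ ≤ √(n x) * ((n x : ℝ)⁻¹ * (2 / a ^ 3 * ε * ‖μ x‖ * ∑ i, ‖H x i‖ * ‖W x i‖)) := by gcongr
      _ = 2 / a ^ 3 * ε * (√(n x) * ‖μ x‖) * ((n x : ℝ)⁻¹ * ∑ i, ‖H x i‖ * ‖W x i‖) := by ring
      _ ≤ 2 / a ^ 3 * ε * (|M| + 1) * (|K| + 1) := by gcongr
      _ ≤ 2 / a ^ 3 * (δ / 2 / (2 / a ^ 3 * (|M| + 1) * (|K| + 1))) * (|M| + 1) * (|K| + 1) := by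
          gcongr
          exact min_le_right _ _
      _ = δ / 2 := by field_simp
      _ < δ := half_lt_self hδ
  have h3 := h2.sub h1
  rw [sub_zero] at h3
  refine h3.congr fun x => ?_
  simp only [_root_.sub_apply, _root_.smul_apply, map_smul, smul_add,
    smul_sub]
  rw [smul_comm (√(n x)) ((n x : ℝ)⁻¹)
    ((∑ i, (d x i / φ x i ^ 2) • InnerProductSpace.rankOne ℝ (W x i) (H x i)) (μ x))]
  abel

/-- Eventually there is a multiplier of order `n ^ (-1/2)`. -/
lemma eventually_exists_multiplier [FiniteDimensional ℝ E] (hn : Tendsto n L atTop) (ha : 0 < a)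
    (hφ : ∀ x i, a ≤ φ x i)
    (hd : ∀ x i, d x i ∈ Set.Icc (0 : ℝ) 1)
    (hmax : ∀ ε > 0, ∀ᶠ x in L, ∀ i, ‖H x i‖ ≤ ε * √(n x)) {S : E →L[ℝ] E} {c : ℝ} (hc : 0 < c)
    (hS0 : ∀ v, c * ‖v‖ ^ 2 ≤ inner ℝ (S v) v)
    (hS : Tendsto (fun x => (n x : ℝ)⁻¹ •
      ∑ i, (d x i / φ x i ^ 2) • InnerProductSpace.rankOne ℝ (H x i) (H x i)) L (𝓝 S)) {C : ℝ}
    (hC : ∀ᶠ x in L, ‖√(n x) • ((n x : ℝ)⁻¹ • ∑ i, (d x i / φ x i) • H x i)‖ ≤ C) :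
    ∃ M : ℝ, ∀ᶠ x in L, ∃ μ : E, √(n x) * ‖μ‖ ≤ M ∧
      ∑ i, (d x i / (φ x i + inner ℝ (H x i) μ)) • H x i = 0 := by
  set M := 8 * |C| / c + 1 with hM
  have hM0 : 0 < M := by positivity
  refine ⟨M, ?_⟩
  have hS' := (tendsto_iff_norm_sub_tendsto_zero.1 hS).eventually (gt_mem_nhds (half_pos hc))
  filter_upwards [hn.eventually_gt_atTop 0, hmax (a / 8 / M) (by positivity), hC, hS'] with
    x hx0 hx1 hx2 hx3
  have hnpos : (0 : ℝ) < n x := by exact_mod_cast hx0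
  have hs : 0 < √(n x : ℝ) := Real.sqrt_pos.2 hnpos
  have hss : √(n x : ℝ) * √(n x) = n x := Real.mul_self_sqrt hnpos.le
  have hrH : ∀ i, M / √(n x) * ‖H x i‖ ≤ a / 8 := fun i => by
    calc M / √(n x) * ‖H x i‖ ≤ M / √(n x) * (a / 8 / M * √(n x)) := by gcongr; exact hx1 i
      _ = a / 8 := by field_simp
  have hlt : ∀ u : E, ‖u‖ = M / √(n x) → inner ℝ (∑ i, (d x i / φ x i) • H x i) u <
      1 / 4 * ∑ i, d x i / φ x i ^ 2 * inner ℝ (H x i) u ^ 2 := by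
    intro u hu
    set A := (n x : ℝ)⁻¹ • ∑ i, (d x i / φ x i) • H x i with hA
    set Sx := (n x : ℝ)⁻¹ •
      ∑ i, (d x i / φ x i ^ 2) • InnerProductSpace.rankOne ℝ (H x i) (H x i) with hSx
    have e1 : ∑ i, (d x i / φ x i) • H x i = (n x : ℝ) • A := by
      rw [hA, smul_inv_smul₀ hnpos.ne']
    have e2 : ∑ i, d x i / φ x i ^ 2 * inner ℝ (H x i) u ^ 2 = n x * inner ℝ (Sx u) u := by
      rw [hSx, _root_.smul_apply, inner_smul_left, RCLike.conj_to_real,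
        mul_inv_cancel_left₀ hnpos.ne', _root_.sum_apply, sum_inner]
      refine Finset.sum_congr rfl fun i _ => ?_
      rw [_root_.smul_apply, InnerProductSpace.rankOne_apply, inner_smul_left,
        inner_smul_left]
      simp only [RCLike.conj_to_real]
      ring
    have e3 : c / 2 * ‖u‖ ^ 2 ≤ inner ℝ (Sx u) u := by
      have h4 := hS0 u
      have h5 : |inner ℝ ((Sx - S) u) u| ≤ c / 2 * ‖u‖ ^ 2 := by
        calc |inner ℝ ((Sx - S) u) u| ≤ ‖(Sx - S) u‖ * ‖u‖ := abs_real_inner_le_norm _ _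
          _ ≤ ‖Sx - S‖ * ‖u‖ * ‖u‖ := by gcongr; exact ContinuousLinearMap.le_opNorm _ _
          _ ≤ c / 2 * ‖u‖ * ‖u‖ := by gcongr
          _ = _ := by ring
      rw [_root_.sub_apply, inner_sub_left] at h5
      linarith [(abs_le.1 h5).1]
    have e4 : inner ℝ A u * √(n x) ≤ |C| * ‖u‖ := by
      rw [norm_smul, Real.norm_of_nonneg hs.le] at hx2
      calc inner ℝ A u * √(n x) ≤ ‖A‖ * ‖u‖ * √(n x) := by gcongr; exact real_inner_le_norm _ _
        _ = √(n x) * ‖A‖ * ‖u‖ := by ring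
        _ ≤ |C| * ‖u‖ := by gcongr; exact hx2.trans (le_abs_self C)
    rw [e1, e2, inner_smul_left, RCLike.conj_to_real]
    have e5 : ‖u‖ * √(n x) = M := by rw [hu]; field_simp
    have e6 : 8 * |C| < c * M := by
      rw [hM, mul_add, mul_div_cancel₀ _ hc.ne']; linarith
    calc (n x : ℝ) * inner ℝ A u = √(n x) * (inner ℝ A u * √(n x)) := by
          linear_combination (-inner ℝ A u) * hss
      _ ≤ √(n x) * (|C| * ‖u‖) := by gcongr
      _ = |C| * M := by rw [← e5]; ring
      _ < c * M * M / 8 := by nlinarith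
      _ = 1 / 4 * (n x * (c / 2 * ‖u‖ ^ 2)) := by
          rw [← e5]
          linear_combination (c * ‖u‖ ^ 2 / 8) * hss
      _ ≤ 1 / 4 * (n x * inner ℝ (Sx u) u) := by gcongr
  obtain ⟨μ, h1, h2⟩ := exists_multiplier (φ := φ x) (d := d x) (H := H x) (r := M / √(n x)) ha
    (hφ x) (fun i => (hd x i).1) (by positivity) hrH hlt
  refine ⟨μ, ?_, h2⟩
  rw [lt_div_iff₀ hs] at h1
  linarith

/-- First order expansion of weighted means, with the multiplier eliminated. -/
lemma tendsto_weighted_mean_of_root (ha : 0 < a) (hφ : ∀ x i, a ≤ φ x i)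
    (hd : ∀ x i, d x i ∈ Set.Icc (0 : ℝ) 1)
    (hmax : ∀ ε > 0, ∀ᶠ x in L, ∀ i, ‖H x i‖ ≤ ε * √(n x))
    {μ : ι → E} {M : ℝ} (hμ : ∀ᶠ x in L, √(n x) * ‖μ x‖ ≤ M)
    (hroot : ∀ᶠ x in L, ∑ i, (d x i / (φ x i + inner ℝ (H x i) (μ x))) • H x i = 0)
    {W : ∀ x, Fin (n x) → E'} {K K' : ℝ}
    (hK : ∀ᶠ x in L, (n x : ℝ)⁻¹ * ∑ i, ‖H x i‖ * ‖W x i‖ ≤ K)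
    (hK' : ∀ᶠ x in L, (n x : ℝ)⁻¹ * ∑ i, ‖H x i‖ * ‖H x i‖ ≤ K') {T : E →L[ℝ] E'}
    (hT : Tendsto (fun x => (n x : ℝ)⁻¹ •
      ∑ i, (d x i / φ x i ^ 2) • InnerProductSpace.rankOne ℝ (W x i) (H x i)) L (𝓝 T))
    {S S' : E →L[ℝ] E} (hS' : ∀ v, S' (S v) = v)
    (hS : Tendsto (fun x => (n x : ℝ)⁻¹ •
      ∑ i, (d x i / φ x i ^ 2) • InnerProductSpace.rankOne ℝ (H x i) (H x i)) L (𝓝 S)) :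
    Tendsto (fun x => √(n x) • ((n x : ℝ)⁻¹ •
        ∑ i, (d x i / (φ x i + inner ℝ (H x i) (μ x))) • W x i)
      - √(n x) • ((n x : ℝ)⁻¹ • ∑ i, (d x i / φ x i) • (W x i - T (S' (H x i))))) L (𝓝 0) := by
  have h1 := tendsto_weighted_mean_expansion ha hφ hd hmax hμ hK hT
  have h2 := tendsto_weighted_mean_expansion ha hφ hd hmax hμ hK' hS
  have h3 := (((T ∘L S').continuous.tendsto 0).comp h2)
  rw [map_zero] at h3
  have h4 := h1.sub h3
  rw [sub_zero] at h4
  refine h4.congr' ?_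
  filter_upwards [hroot] with x hx
  simp only [Function.comp_apply, hx, smul_zero, zero_sub, neg_sub, ContinuousLinearMap.comp_apply,
    map_sub, hS', smul_sub, Finset.sum_sub_distrib, map_smul, map_sum]
  abel

/-- The multiplier does not affect the sum of the remainders to first order. -/
lemma tendsto_weighted_remainder (hn : Tendsto n L atTop) (ha : 0 < a) (hφ : ∀ x i, a ≤ φ x i)
    (hd : ∀ x i, d x i ∈ Set.Icc (0 : ℝ) 1)
    (hmax : ∀ ε > 0, ∀ᶠ x in L, ∀ i, ‖H x i‖ ≤ ε * √(n x))
    {μ : ι → E} {M : ℝ} (hμ : ∀ᶠ x in L, √(n x) * ‖μ x‖ ≤ M) {K : ℝ}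
    (hK : ∀ᶠ x in L, (n x : ℝ)⁻¹ * ∑ i, ‖H x i‖ * ‖H x i‖ ≤ K)
    {ξ : ∀ x, Fin (n x) → ℝ} (hξ2 : Tendsto (fun x => ∑ i, ξ x i ^ 2) L (𝓝 0)) {y : ℝ}
    (hξ : Tendsto (fun x => ∑ i, d x i / φ x i * ξ x i) L (𝓝 y)) :
    Tendsto (fun x => ∑ i, d x i / (φ x i + inner ℝ (H x i) (μ x)) * ξ x i) L (𝓝 y) := by
  suffices h : Tendsto (fun x => ∑ i, d x i / (φ x i + inner ℝ (H x i) (μ x)) * ξ x i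
      - ∑ i, d x i / φ x i * ξ x i) L (𝓝 0) by
    simpa using h.add hξ
  have hb : Tendsto (fun x => 2 / a ^ 2 * M * √K * √(∑ i, ξ x i ^ 2)) L (𝓝 0) := by
    have := (((Real.continuous_sqrt.tendsto 0).comp hξ2).const_mul (2 / a ^ 2 * M * √K))
    rw [Real.sqrt_zero, mul_zero] at this
    exact this
  refine squeeze_zero_norm' ?_ hb
  filter_upwards [eventually_abs_inner_le hmax hμ (half_pos ha), hμ, hK,
    hn.eventually_gt_atTop 0] with x h1 h2 h3 h4
  have hnpos : (0 : ℝ) < n x := by exact_mod_cast h4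
  have hM : 0 ≤ M := le_trans (by positivity) h2
  have hterm : ∀ i, |d x i / (φ x i + inner ℝ (H x i) (μ x)) * ξ x i - d x i / φ x i * ξ x i| ≤
      2 / a ^ 2 * ‖μ x‖ * (‖H x i‖ * |ξ x i|) := by
    intro i
    have e1 := hφ x i
    have e2 := (abs_le.1 (h1 i)).1
    have e3 : 0 < φ x i := ha.trans_le e1
    have e4 : a / 2 ≤ φ x i + inner ℝ (H x i) (μ x) := by linarith
    have e4' : 0 < φ x i + inner ℝ (H x i) (μ x) := by linarith
    have heq : d x i / (φ x i + inner ℝ (H x i) (μ x)) * ξ x i - d x i / φ x i * ξ x i =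
        -(d x i * inner ℝ (H x i) (μ x) / (φ x i * (φ x i + inner ℝ (H x i) (μ x))) * ξ x i) := by
      field_simp
      ring
    have e5 : |d x i| ≤ 1 := by rw [abs_of_nonneg (hd x i).1]; exact (hd x i).2
    rw [heq, abs_neg, abs_mul, abs_div, abs_mul, abs_mul, abs_of_pos e3, abs_of_pos e4']
    calc |d x i| * |inner ℝ (H x i) (μ x)| / (φ x i * (φ x i + inner ℝ (H x i) (μ x))) * |ξ x i|
        ≤ 1 * (‖H x i‖ * ‖μ x‖) / (a * (a / 2)) * |ξ x i| := by
          gcongr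
          exact abs_real_inner_le_norm _ _
      _ = _ := by field_simp
  have hCS : ∑ i, ‖H x i‖ * |ξ x i| ≤ √(∑ i, ‖H x i‖ ^ 2) * √(∑ i, ξ x i ^ 2) := by
    have := Real.sum_mul_le_sqrt_mul_sqrt Finset.univ (fun i => ‖H x i‖) fun i => |ξ x i|
    simpa [sq_abs] using this
  have hH : √(∑ i, ‖H x i‖ ^ 2) ≤ √(n x) * √K := by
    rw [← Real.sqrt_mul hnpos.le]
    refine Real.sqrt_le_sqrt ?_
    rw [inv_mul_le_iff₀ hnpos] at h3
    simpa [sq] using h3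
  rw [← Finset.sum_sub_distrib]
  calc _ ≤ ∑ i, 2 / a ^ 2 * ‖μ x‖ * (‖H x i‖ * |ξ x i|) :=
        (norm_sum_le _ _).trans (Finset.sum_le_sum fun i _ => hterm i)
    _ ≤ 2 / a ^ 2 * ‖μ x‖ * (√(n x) * √K * √(∑ i, ξ x i ^ 2)) := by
        rw [← Finset.mul_sum]
        gcongr
        exact hCS.trans (by gcongr)
    _ = 2 / a ^ 2 * (√(n x) * ‖μ x‖) * √K * √(∑ i, ξ x i ^ 2) := by ring
    _ ≤ _ := by gcongr

end Expansion

/-! ### The multivariate central limit theorem -/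

section CLT

variable {Ω : Type*} [MeasurableSpace Ω] {P : Measure Ω}

lemma charFun_map_eq_charFun_map_inner {q : ℕ} {Y : Ω → EuclideanSpace ℝ (Fin q)}
    (hY : AEMeasurable Y P) (t : EuclideanSpace ℝ (Fin q)) :
    charFun (P.map Y) t = charFun (P.map fun ω => inner ℝ (Y ω) t) 1 := by
  rw [charFun_apply, charFun_apply, integral_map hY (by fun_prop),
    integral_map (by fun_prop) (by fun_prop)]
  simp

/-- Multivariate central limit theorem for centred i.i.d. vectors, by the one-dimensional theorem
for all linear forms and Lévy's continuity theorem. -/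
theorem tendstoInDistribution_multivariateGaussian [IsProbabilityMeasure P] {q : ℕ}
    {X : ℕ → Ω → EuclideanSpace ℝ (Fin q)} (hindep : iIndepFun X P)
    (hident : ∀ i, IdentDistrib (X i) (X 0) P P) (hL2 : MemLp (X 0) 2 P) (h0 : ∫ ω, X 0 ω ∂P = 0)
    {S : Matrix (Fin q) (Fin q) ℝ} (hS : S.PosSemidef)
    (hcov : ∀ t : EuclideanSpace ℝ (Fin q), ∫ ω, inner ℝ (X 0 ω) t ^ 2 ∂P = t.ofLp ⬝ᵥ S *ᵥ t.ofLp) :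
    TendstoInDistribution (fun (n : ℕ) ω => (√(n : ℝ))⁻¹ • ∑ k ∈ Finset.range n, X k ω) atTop
      (id : EuclideanSpace ℝ (Fin q) → EuclideanSpace ℝ (Fin q)) (fun _ => P)
      (multivariateGaussian 0 S) := by
  have hm : ∀ i, AEMeasurable (X i) P := fun i => (hident i).aemeasurable_fst
  have hY : ∀ n : ℕ, AEMeasurable (fun ω => (√(n : ℝ))⁻¹ • ∑ k ∈ Finset.range n, X k ω) P :=
    fun n => (Finset.aemeasurable_fun_sum (Finset.range n) fun i _ => hm i).const_smul (√(n : ℝ))⁻¹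
  refine ⟨hY, aemeasurable_id, ProbabilityMeasure.tendsto_iff_tendsto_charFun.2 fun t => ?_⟩
  have hL2t : MemLp (fun ω => inner ℝ (X 0 ω) t) 2 P := by
    have := hL2.inner_const (𝕜 := ℝ) t
    exact this
  have hmean : ∫ ω, inner ℝ (X 0 ω) t ∂P = 0 := by
    have h := integral_inner (𝕜 := ℝ) (hL2.integrable one_le_two) t
    rw [h0, inner_zero_right] at h
    rw [← h]
    exact integral_congr_ae (ae_of_all _ fun ω => real_inner_comm _ _)
  have hvar : Var[fun ω => inner ℝ (X 0 ω) t; P] = t.ofLp ⬝ᵥ S *ᵥ t.ofLp := by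
    rw [variance_of_integral_eq_zero hL2t.aemeasurable hmean, ← hcov t]
  have hclt := tendstoInDistribution_inv_sqrt_mul_sum_sub (P := P)
    (X := fun i ω => inner ℝ (X i ω) t)
    (P' := gaussianReal 0 Var[fun ω => inner ℝ (X 0 ω) t; P].toNNReal) (Y := id)
    HasLaw.id hL2t
    (hindep.comp (fun _ y => inner ℝ y t) fun _ => by fun_prop)
    fun i => (hident i).comp (u := fun y => inner ℝ y t) (by fun_prop)
  have h1 := ProbabilityMeasure.tendsto_iff_tendsto_charFun.1 hclt.tendsto 1
  simp only [ProbabilityMeasure.coe_mk, Measure.map_id] at h1 ⊢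
  rw [charFun_gaussianReal, hvar] at h1
  rw [charFun_multivariateGaussian hS]
  have hnn : 0 ≤ t.ofLp ⬝ᵥ S *ᵥ t.ofLp := by simpa using hS.dotProduct_mulVec_nonneg t.ofLp
  rw [Real.coe_toNNReal _ hnn] at h1
  convert! h1 using 2 with n
  · rw [charFun_map_eq_charFun_map_inner (hY n)]
    simp only [hmean, mul_zero, sub_zero, inner_smul_left, sum_inner, RCLike.conj_to_real]
  · simp

end CLT

/-! ### Sampled i.i.d. data -/

section Sampling

lemma incl_zero_or_one {Ω : Type*} (D1 D2 : ℕ → Ω → ℝ) (i : ℕ) (ω : Ω) :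
    incl D1 D2 i ω = 0 ∨ incl D1 D2 i ω = 1 := by
  unfold incl
  split_ifs <;> simp

lemma incl_mem_Icc {Ω : Type*} (D1 D2 : ℕ → Ω → ℝ) (i : ℕ) (ω : Ω) :
    incl D1 D2 i ω ∈ Set.Icc (0 : ℝ) 1 := by
  rcases incl_zero_or_one D1 D2 i ω with h | h <;> simp [h]

variable {Ω 𝒵 : Type*} [MeasurableSpace Ω] [MeasurableSpace 𝒵] {P : Measure Ω}
  {F : Measure 𝒵} {Z : ℕ → Ω → 𝒵} {D1 D2 : ℕ → Ω → ℝ} {α10 α20 : ℝ} {π : 𝒵 → ℝ}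

namespace CaptureRecapture

variable (hdata : CaptureRecapture P F Z D1 D2 α10 α20 π)
include hdata

lemma isProbabilityMeasure [IsProbabilityMeasure P] : IsProbabilityMeasure F := by
  rw [← hdata.law_Z 0]
  exact Measure.isProbabilityMeasure_map (hdata.measurable_Z 0).aemeasurable

lemma incl_eq (i : ℕ) (ω : Ω) : incl D1 D2 i ω = D1 i ω + D2 i ω - D1 i ω * D2 i ω := by
  rcases hdata.D1_zero_one i ω with h1 | h1 <;> rcases hdata.D2_zero_one i ω with h2 | h2 <;>
    simp [incl, h1, h2]

lemma measurable_incl (i : ℕ) : Measurable (incl D1 D2 i) := by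
  have : incl D1 D2 i = fun ω => D1 i ω + D2 i ω - D1 i ω * D2 i ω := funext (hdata.incl_eq i)
  rw [this]
  exact ((hdata.measurable_D1 i).add (hdata.measurable_D2 i)).sub
    ((hdata.measurable_D1 i).mul (hdata.measurable_D2 i))

lemma iIndepFun_comp {E : Type*} [MeasurableSpace E] {f : 𝒵 → ℝ → E}
    (hf : Measurable (Function.uncurry f)) :
    iIndepFun (fun i ω => f (Z i ω) (incl D1 D2 i ω)) P := by
  have h := hdata.indep.comp (fun _ (y : 𝒵 × ℝ × ℝ) => f y.1 (y.2.1 + y.2.2 - y.2.1 * y.2.2))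
    fun _ => hf.comp (by fun_prop : Measurable fun y : 𝒵 × ℝ × ℝ =>
      (y.1, y.2.1 + y.2.2 - y.2.1 * y.2.2))
  convert! h using 3 with i ω
  simp [hdata.incl_eq]

lemma identDistrib_comp {E : Type*} [MeasurableSpace E] {f : 𝒵 → ℝ → E}
    (hf : Measurable (Function.uncurry f)) (i : ℕ) :
    IdentDistrib (fun ω => f (Z i ω) (incl D1 D2 i ω))
      (fun ω => f (Z 0 ω) (incl D1 D2 0 ω)) P P := by
  have h := (hdata.ident i).comp (u := fun (y : 𝒵 × ℝ × ℝ) =>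
    f y.1 (y.2.1 + y.2.2 - y.2.1 * y.2.2)) (hf.comp (by fun_prop : Measurable fun y : 𝒵 × ℝ × ℝ =>
      (y.1, y.2.1 + y.2.2 - y.2.1 * y.2.2)))
  convert! h using 2 with ω ω
  · simp [hdata.incl_eq]
  · simp [hdata.incl_eq]

lemma measurable_phi : Measurable (phi α10 π) :=
  measurable_const.sub (measurable_const.mul (measurable_const.sub hdata.measurable_pi))

lemma le_phi (h10 : α10 ∈ Set.Ioo (0 : ℝ) 1) (z : 𝒵) : α10 ≤ phi α10 π z := by
  have h := hdata.pi_mem z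
  unfold phi
  nlinarith [h.1, h.2, h10.1, h10.2]

lemma phi_le_one (h10 : α10 ∈ Set.Ioo (0 : ℝ) 1) (z : 𝒵) : phi α10 π z ≤ 1 := by
  have h := hdata.pi_mem z
  unfold phi
  nlinarith [h.1, h.2, h10.1, h10.2]

lemma condExp_incl [IsProbabilityMeasure P] (i : ℕ) :
    P[incl D1 D2 i | MeasurableSpace.comap (Z i) inferInstance]
      =ᵐ[P] fun ω => phi α10 π (Z i ω) := by
  have hb : ∀ (X : Ω → ℝ), Measurable X → (∀ ω, X ω = 0 ∨ X ω = 1) → Integrable X P := by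
    intro X hX h01
    refine Integrable.of_bound hX.aestronglyMeasurable 1 (ae_of_all _ fun ω => ?_)
    rcases h01 ω with h | h <;> simp [h]
  have h1 := hb _ (hdata.measurable_D1 i) (hdata.D1_zero_one i)
  have h2 := hb _ (hdata.measurable_D2 i) (hdata.D2_zero_one i)
  have h12 : Integrable (fun ω => D1 i ω * D2 i ω) P :=
    hb _ ((hdata.measurable_D1 i).mul (hdata.measurable_D2 i)) fun ω => by
      rcases hdata.D1_zero_one i ω with h | h <;> rcases hdata.D2_zero_one i ω with h' | h' <;>
        simp [h, h']
  have heq : incl D1 D2 i = (D1 i + D2 i) - fun ω => D1 i ω * D2 i ω := funext (hdata.incl_eq i)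
  rw [heq]
  filter_upwards [condExp_sub (h1.add h2) h12 (MeasurableSpace.comap (Z i) inferInstance),
    condExp_add h1 h2 (MeasurableSpace.comap (Z i) inferInstance), hdata.condExp_D1 i,
    hdata.condExp_D2 i, hdata.condExp_D1_mul_D2 i] with ω e1 e2 e3 e4 e5
  rw [e1, Pi.sub_apply, e2, Pi.add_apply, e3, e4, e5, phi]
  ring

/-- The law of `Z_i` weighted by the inclusion indicator has density `φ` with respect to `F`. -/
lemma map_withDensity_incl [IsProbabilityMeasure P] (h10 : α10 ∈ Set.Ioo (0 : ℝ) 1) (i : ℕ) :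
    (P.withDensity fun ω => ENNReal.ofReal (incl D1 D2 i ω)).map (Z i) =
      F.withDensity fun z => ENNReal.ofReal (phi α10 π z) := by
  have hZ := hdata.measurable_Z i
  have hφ0 : ∀ z, 0 ≤ phi α10 π z := fun z => h10.1.le.trans (hdata.le_phi h10 z)
  have hint : Integrable (incl D1 D2 i) P :=
    Integrable.of_bound (hdata.measurable_incl i).aestronglyMeasurable 1 (ae_of_all _ fun ω => by
      rcases incl_zero_or_one D1 D2 i ω with h | h <;> simp [h])
  have hintφ : Integrable (fun ω => phi α10 π (Z i ω)) P :=
    Integrable.of_bound (hdata.measurable_phi.comp hZ).aestronglyMeasurable 1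
      (ae_of_all _ fun ω => by
        rw [Real.norm_of_nonneg (hφ0 _)]; exact hdata.phi_le_one h10 _)
  ext s hs
  rw [Measure.map_apply hZ hs, withDensity_apply _ (hZ hs), withDensity_apply _ hs,
    ← hdata.law_Z i, setLIntegral_map hs hdata.measurable_phi.ennreal_ofReal hZ,
    ← ofReal_integral_eq_lintegral_ofReal hint.integrableOn
      (ae_of_all _ fun ω => (incl_mem_Icc D1 D2 i ω).1),
    ← ofReal_integral_eq_lintegral_ofReal hintφ.integrableOn (ae_of_all _ fun ω => hφ0 _)]
  congr 1
  rw [← setIntegral_condExp hZ.comap_le hint ⟨s, hs, rfl⟩]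
  exact integral_congr_ae (ae_restrict_of_ae (hdata.condExp_incl i))

lemma integral_incl_smul [IsProbabilityMeasure P] (h10 : α10 ∈ Set.Ioo (0 : ℝ) 1) {E : Type*}
    [NormedAddCommGroup E] [NormedSpace ℝ E] {f : 𝒵 → E} (hf : AEStronglyMeasurable f F) (i : ℕ) :
    ∫ ω, incl D1 D2 i ω • f (Z i ω) ∂P = ∫ z, phi α10 π z • f z ∂F := by
  have hφ0 : ∀ z, 0 ≤ phi α10 π z := fun z => h10.1.le.trans (hdata.le_phi h10 z)
  have hfφ : AEStronglyMeasurable f (F.withDensity fun z => ENNReal.ofReal (phi α10 π z)) :=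
    hf.mono_ac (withDensity_absolutelyContinuous _ _)
  have h1 : ∫ z, f z ∂(F.withDensity fun z => ENNReal.ofReal (phi α10 π z)) =
      ∫ z, phi α10 π z • f z ∂F := by
    rw [integral_withDensity_eq_integral_toReal_smul hdata.measurable_phi.ennreal_ofReal
      (ae_of_all _ fun _ => ENNReal.ofReal_lt_top)]
    exact integral_congr_ae (ae_of_all _ fun z => by
      simp only [ENNReal.toReal_ofReal (hφ0 z)])
  rw [← h1]
  rw [← hdata.map_withDensity_incl h10 i] at hfφ ⊢
  rw [integral_map (hdata.measurable_Z i).aemeasurable hfφ,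
    integral_withDensity_eq_integral_toReal_smul (hdata.measurable_incl i).ennreal_ofReal
      (ae_of_all _ fun _ => ENNReal.ofReal_lt_top)]
  exact integral_congr_ae (ae_of_all _ fun ω => by
    simp only [ENNReal.toReal_ofReal (incl_mem_Icc D1 D2 i ω).1])

lemma integral_comp_Z {E : Type*}
    [NormedAddCommGroup E] [NormedSpace ℝ E] {f : 𝒵 → E} (hf : AEStronglyMeasurable f F) (i : ℕ) :
    ∫ ω, f (Z i ω) ∂P = ∫ z, f z ∂F := by
  rw [← hdata.law_Z i] at hf ⊢
  exact (integral_map (hdata.measurable_Z i).aemeasurable hf).symm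

lemma memLp_comp_Z {E : Type*} [NormedAddCommGroup E] {f : 𝒵 → E} {p : ENNReal}
    (hf : MemLp f p F) (i : ℕ) : MemLp (fun ω => f (Z i ω)) p P := by
  rw [← hdata.law_Z i] at hf
  exact hf.comp_of_map (hdata.measurable_Z i).aemeasurable

lemma memLp_incl_smul {E : Type*} [NormedAddCommGroup E] [NormedSpace ℝ E]
    {f : 𝒵 → E} {p : ENNReal} (hf : MemLp f p F) (i : ℕ) :
    MemLp (fun ω => incl D1 D2 i ω • f (Z i ω)) p P := by
  refine (hdata.memLp_comp_Z hf i).of_le ?_ (ae_of_all _ fun ω => ?_)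
  · exact (hdata.measurable_incl i).aestronglyMeasurable.smul
      (hdata.memLp_comp_Z hf i).aestronglyMeasurable
  · rcases incl_zero_or_one D1 D2 i ω with h | h <;> simp [h]

/-- Weak law of large numbers along the filter `highProb P`. -/
lemma tendsto_mean [IsProbabilityMeasure P] {E : Type*} [NormedAddCommGroup E] [NormedSpace ℝ E]
    [CompleteSpace E] [MeasurableSpace E] [BorelSpace E] {f : 𝒵 → ℝ → E}
    (hf : Measurable (Function.uncurry f))
    (hint : Integrable (fun ω => f (Z 0 ω) (incl D1 D2 0 ω)) P) :
    Tendsto (fun x : ℕ × Ω => (x.1 : ℝ)⁻¹ • ∑ i : Fin x.1, f (Z i x.2) (incl D1 D2 i x.2))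
      (highProb P) (𝓝 (∫ ω, f (Z 0 ω) (incl D1 D2 0 ω) ∂P)) := by
  have h := strong_law_ae (fun i ω => f (Z i ω) (incl D1 D2 i ω)) hint
    (fun i j hij => (hdata.iIndepFun_comp hf).indepFun hij) (hdata.identDistrib_comp hf)
  have hm : ∀ i, AEStronglyMeasurable (fun ω => f (Z i ω) (incl D1 D2 i ω)) P := fun i =>
    ((hdata.identDistrib_comp hf i).integrable_iff.2 hint).aestronglyMeasurable
  have := tendsto_highProb_of_ae (P := P)
    (X := fun N ω => (N : ℝ)⁻¹ • ∑ i ∈ Finset.range N, f (Z i ω) (incl D1 D2 i ω))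
    (fun N => (Finset.aestronglyMeasurable_fun_sum _ fun i _ => hm i).const_smul _) h
  simpa only [Finset.sum_range] using this

/-- The maximum of `N` i.i.d. square integrable vectors is of smaller order than `√N`, by the
union bound and `N P(‖H‖ > ε √N) ≤ ε⁻² E[‖H‖² 1(‖H‖ > ε √N)]`. -/
lemma eventually_forall_norm_le [IsProbabilityMeasure P] {E : Type*} [NormedAddCommGroup E]
    {H : 𝒵 → E} (hH : MemLp H 2 F) {ε : ℝ} (hε : 0 < ε) :
    ∀ᶠ x : ℕ × Ω in highProb P, ∀ i : Fin x.1, ‖H (Z i x.2)‖ ≤ ε * √(x.1 : ℝ) := by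
  have hF := hdata.isProbabilityMeasure
  have hsq : Integrable (fun z => ‖H z‖ ^ 2) F := hH.integrable_norm_pow two_ne_zero
  set A : ℕ → Set 𝒵 := fun N => {z | ε * √(N : ℝ) < ‖H z‖} with hA
  have hnull : ∀ N, NullMeasurableSet (A N) F := fun N =>
    nullMeasurableSet_lt aemeasurable_const hH.1.norm.aemeasurable
  have hlim : Tendsto (fun N => ∫ z, (A N).indicator (fun z => ‖H z‖ ^ 2) z ∂F) atTop (𝓝 0) := by
    rw [← integral_zero 𝒵 ℝ (μ := F)]
    refine tendsto_integral_of_dominated_convergence (fun z => ‖H z‖ ^ 2)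
      (fun N => hsq.1.indicator₀ (hnull N)) hsq (fun N => ae_of_all _ fun z => ?_)
      (ae_of_all _ fun z => ?_)
    · by_cases hz : z ∈ A N <;> simp [hz]
    · refine tendsto_const_nhds.congr' ?_
      have h1 : Tendsto (fun N : ℕ => ε * √(N : ℝ)) atTop atTop :=
        (Real.tendsto_sqrt_atTop.comp tendsto_natCast_atTop_atTop).const_mul_atTop hε
      filter_upwards [h1.eventually_ge_atTop ‖H z‖] with N hN
      rw [Set.indicator_of_notMem]
      simpa [hA] using hN
  have hbound : ∀ N : ℕ, P {ω | ¬ ∀ i : Fin N, ‖H (Z i ω)‖ ≤ ε * √(N : ℝ)} ≤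
      ENNReal.ofReal ((ε ^ 2)⁻¹ * ∫ z, (A N).indicator (fun z => ‖H z‖ ^ 2) z ∂F) := by
    intro N
    have h1 : {ω | ¬ ∀ i : Fin N, ‖H (Z i ω)‖ ≤ ε * √(N : ℝ)} ⊆ ⋃ i : Fin N, Z i ⁻¹' A N := by
      intro ω hω
      simpa [hA] using hω
    have h2 : ∀ i : ℕ, P (Z i ⁻¹' A N) = ENNReal.ofReal (F.real (A N)) := by
      intro i
      rw [ofReal_measureReal, ← hdata.law_Z i,
        Measure.map_apply₀ (hdata.measurable_Z i).aemeasurable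
          (by rw [hdata.law_Z i]; exact hnull N)]
    have h3 : ε ^ 2 * N * F.real (A N) ≤ ∫ z, (A N).indicator (fun z => ‖H z‖ ^ 2) z ∂F := by
      rw [integral_indicator₀ (hnull N)]
      have h4 : ∫ z in A N, ε ^ 2 * (N : ℝ) ∂F ≤ ∫ z in A N, ‖H z‖ ^ 2 ∂F := by
        refine integral_mono_ae integrableOn_const hsq.integrableOn ?_
        refine (ae_restrict_iff'₀ (hnull N)).2 (ae_of_all _ fun z hz => ?_)
        have h5 : ε * √(N : ℝ) < ‖H z‖ := hz
        calc ε ^ 2 * (N : ℝ) = (ε * √(N : ℝ)) ^ 2 := by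
              rw [mul_pow, Real.sq_sqrt (Nat.cast_nonneg N)]
          _ ≤ ‖H z‖ ^ 2 := by gcongr
      rw [setIntegral_const, smul_eq_mul] at h4
      linarith
    calc _ ≤ ∑ i : Fin N, P (Z i ⁻¹' A N) := (measure_mono h1).trans (measure_iUnion_fintype_le _ _)
      _ = ENNReal.ofReal (N * F.real (A N)) := by
          simp only [h2, Finset.sum_const, Finset.card_univ, Fintype.card_fin, nsmul_eq_mul]
          rw [ENNReal.ofReal_mul (Nat.cast_nonneg N), ENNReal.ofReal_natCast]
      _ ≤ _ := by
          refine ENNReal.ofReal_le_ofReal ?_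
          rw [le_inv_mul_iff₀ (by positivity)]
          linarith
  rw [eventually_highProb_iff]
  have hlim2 := ENNReal.tendsto_ofReal (hlim.const_mul (ε ^ 2)⁻¹)
  rw [mul_zero, ENNReal.ofReal_zero] at hlim2
  exact tendsto_of_tendsto_of_tendsto_of_le_of_le tendsto_const_nhds hlim2 (fun _ => zero_le) hbound

end CaptureRecapture

end Sampling

/-! ### Normalized sums and triangular arrays -/

section NormalizedSums

variable {Ω : Type*} [MeasurableSpace Ω] {P : Measure Ω}

lemma IsTight.prodMk {E E' : Type*} [SeminormedAddGroup E] [SeminormedAddGroup E']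
    {X : ℕ × Ω → E} {Y : ℕ × Ω → E'}
    (hX : IsTight P X) (hY : IsTight P Y) : IsTight P fun x => (X x, Y x) := by
  intro ε hε
  obtain ⟨C, hC⟩ := hX (ε / 2) (ENNReal.half_pos hε.ne')
  obtain ⟨C', hC'⟩ := hY (ε / 2) (ENNReal.half_pos hε.ne')
  refine ⟨max C C', ?_⟩
  filter_upwards [hC, hC'] with N h1 h2
  calc P {ω | max C C' < ‖(X (N, ω), Y (N, ω))‖}
      ≤ P ({ω | C < ‖X (N, ω)‖} ∪ {ω | C' < ‖Y (N, ω)‖}) := by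
        refine measure_mono fun ω hω => ?_
        simp only [Set.mem_ofPred_eq, Prod.norm_mk, Set.mem_union] at hω ⊢
        rcases lt_max_iff.1 hω with h | h
        · exact Or.inl ((le_max_left _ _).trans_lt h)
        · exact Or.inr ((le_max_right _ _).trans_lt h)
    _ ≤ ε / 2 + ε / 2 := (measure_union_le _ _).trans (add_le_add h1 h2)
    _ = ε := ENNReal.add_halves ε

variable [IsProbabilityMeasure P]

lemma integral_sum_sq_of_iid {X : ℕ → Ω → ℝ} (hindep : iIndepFun X P)
    (hident : ∀ i, IdentDistrib (X i) (X 0) P P) (hL2 : MemLp (X 0) 2 P)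
    (h0 : ∫ ω, X 0 ω ∂P = 0) (N : ℕ) :
    ∫ ω, (∑ i : Fin N, X i ω) ^ 2 ∂P = N * ∫ ω, X 0 ω ^ 2 ∂P := by
  have hL : ∀ i, MemLp (X i) 2 P := fun i => (hident i).memLp_iff.2 hL2
  have hv := IndepFun.variance_sum (s := (Finset.univ : Finset (Fin N)))
    (X := fun i : Fin N => X i) (fun i _ => hL i)
    (fun i _ j _ hij => hindep.indepFun fun h => hij (Fin.ext h))
  have hm : ∀ i, ∫ ω, X i ω ∂P = 0 := fun i => by rw [(hident i).integral_eq, h0]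
  have hmem : MemLp (∑ i : Fin N, X i) 2 P := memLp_finsetSum' _ fun (i : Fin N) _ => hL i
  rw [variance_of_integral_eq_zero hmem.aemeasurable] at hv
  · simp only [fun i => (hident i).variance_eq, Finset.sum_const, Finset.card_univ,
      Fintype.card_fin, nsmul_eq_mul, Finset.sum_apply] at hv
    rw [hv, variance_of_integral_eq_zero hL2.aemeasurable h0]
  · simp only [Finset.sum_apply]
    rw [integral_finsetSum _ fun (i : Fin N) _ => (hL i).integrable one_le_two]
    simp [hm]

/-- Normalized sums of centred square integrable i.i.d. vectors are tight. -/
lemma isTight_normalized_sum {r : ℕ} {X : ℕ → Ω → EuclideanSpace ℝ (Fin r)}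
    (hindep : iIndepFun X P) (hident : ∀ i, IdentDistrib (X i) (X 0) P P)
    (hL2 : MemLp (X 0) 2 P) (h0 : ∫ ω, X 0 ω ∂P = 0) :
    IsTight P fun x : ℕ × Ω => √(x.1 : ℝ) • ((x.1 : ℝ)⁻¹ • ∑ i : Fin x.1, X i x.2) := by
  have hL : ∀ i, MemLp (X i) 2 P := fun i => (hident i).memLp_iff.2 hL2
  have hmem : ∀ N : ℕ, MemLp (fun ω => √(N : ℝ) • ((N : ℝ)⁻¹ • ∑ i : Fin N, X i ω)) 2 P :=
    fun N => ((memLp_finsetSum Finset.univ fun (i : Fin N) _ => hL i).const_smul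
      ((N : ℝ)⁻¹)).const_smul √(N : ℝ)
  refine isTight_of_integral_sq_le (K := ∑ j, ∫ ω, X 0 ω j ^ 2 ∂P)
    (fun N => (hmem N).integrable_norm_pow two_ne_zero) fun N => ?_
  have hcoord : ∀ j, MemLp (fun ω => X 0 ω j) 2 P := fun j =>
    (EuclideanSpace.proj (𝕜 := ℝ) j).comp_memLp' hL2
  have hmean : ∀ j, ∫ ω, X 0 ω j ∂P = 0 := fun j => by
    have := (EuclideanSpace.proj (𝕜 := ℝ) j).integral_comp_comm (hL2.integrable one_le_two)
    rw [h0, map_zero] at this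
    exact this
  have hj : ∀ j, ∫ ω, (∑ i : Fin N, X i ω j) ^ 2 ∂P = N * ∫ ω, X 0 ω j ^ 2 ∂P := fun j =>
    integral_sum_sq_of_iid (X := fun i ω => X i ω j)
      (hindep.comp (fun _ y => y j) fun _ => by fun_prop)
      (fun i => (hident i).comp (u := fun y : EuclideanSpace ℝ (Fin r) => y j) (by fun_prop))
      (hcoord j) (hmean j) N
  have hjint : ∀ j, Integrable (fun ω => (∑ i : Fin N, X i ω j) ^ 2) P := fun j =>
    (memLp_finsetSum Finset.univ fun (i : Fin N) _ =>
      (EuclideanSpace.proj (𝕜 := ℝ) j).comp_memLp' (hL i)).integrable_sq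
  have hexp : ∀ ω, ‖√(N : ℝ) • ((N : ℝ)⁻¹ • ∑ i : Fin N, X i ω)‖ ^ 2 =
      (N : ℝ)⁻¹ * ∑ j, (∑ i : Fin N, X i ω j) ^ 2 := by
    intro ω
    rw [smul_smul, norm_smul, mul_pow, EuclideanSpace.norm_sq_eq, norm_mul, mul_pow]
    congr 1
    · rw [Real.norm_eq_abs, Real.norm_eq_abs, sq_abs, sq_abs, Real.sq_sqrt (Nat.cast_nonneg N)]
      rcases eq_or_ne (N : ℝ) 0 with h | h
      · simp [h]
      · field_simp
    · simp
  simp only [hexp]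
  rw [integral_const_mul, integral_finsetSum _ fun j _ => hjint j]
  simp only [hj, ← Finset.mul_sum]
  rcases eq_or_ne (N : ℝ) 0 with h | h
  · rw [h]
    simp only [_root_.inv_zero, zero_mul]
    exact Finset.sum_nonneg fun j _ => integral_nonneg_of_ae (ae_of_all _ fun ω => sq_nonneg _)
  · rw [inv_mul_cancel_left₀ h]

end NormalizedSums

section TriangularArray

variable {Ω 𝒵 : Type*} [MeasurableSpace Ω] [MeasurableSpace 𝒵] {P : Measure Ω}
  [IsProbabilityMeasure P]
  {F : Measure 𝒵} {Z : ℕ → Ω → 𝒵} {D1 D2 : ℕ → Ω → ℝ} {α10 α20 : ℝ} {π : 𝒵 → ℝ}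

namespace CaptureRecapture

variable (hdata : CaptureRecapture P F Z D1 D2 α10 α20 π)
include hdata

lemma tendsto_sum_sq {ξ : ℕ → 𝒵 → ℝ} (hmem : ∀ᶠ N in atTop, MemLp (ξ N) 2 F)
    (hsq : Tendsto (fun N : ℕ => N * ∫ z, ξ N z ^ 2 ∂F) atTop (𝓝 0)) :
    Tendsto (fun x : ℕ × Ω => ∑ i : Fin x.1, ξ x.1 (Z i x.2) ^ 2) (highProb P) (𝓝 0) := by
  refine tendsto_highProb_of_integral (X := fun N ω => ∑ i : Fin N, ξ N (Z i ω) ^ 2) ?_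
    (hsq.congr' ?_)
  · filter_upwards [hmem] with N hN
    exact integrable_finsetSum _ fun (i : Fin N) _ => (hdata.memLp_comp_Z hN i).integrable_sq
  · filter_upwards [hmem] with N hN
    have h1 : ∀ ω, |∑ i : Fin N, ξ N (Z i ω) ^ 2| = ∑ i : Fin N, ξ N (Z i ω) ^ 2 := fun ω =>
      abs_of_nonneg (Finset.sum_nonneg fun i _ => sq_nonneg _)
    simp only [h1]
    rw [integral_finsetSum _ fun (i : Fin N) _ => (hdata.memLp_comp_Z hN i).integrable_sq]
    simp only [fun i => hdata.integral_comp_Z (f := fun z => ξ N z ^ 2)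
      hN.integrable_sq.aestronglyMeasurable i, Finset.sum_const, Finset.card_univ,
      Fintype.card_fin, nsmul_eq_mul]

/-- Weak law for a triangular array whose second moments vanish, by Chebyshev's inequality. -/
lemma tendsto_sum_incl_div (h10 : α10 ∈ Set.Ioo (0 : ℝ) 1) {ξ : ℕ → 𝒵 → ℝ}
    (hmeas : ∀ N, Measurable (ξ N)) (hmem : ∀ᶠ N in atTop, MemLp (ξ N) 2 F)
    (hsq : Tendsto (fun N : ℕ => N * ∫ z, ξ N z ^ 2 ∂F) atTop (𝓝 0)) {y : ℝ}
    (hmean : Tendsto (fun N : ℕ => N * ∫ z, ξ N z ∂F) atTop (𝓝 y)) :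
    Tendsto (fun x : ℕ × Ω => ∑ i : Fin x.1,
      incl D1 D2 i x.2 / phi α10 π (Z i x.2) * ξ x.1 (Z i x.2)) (highProb P) (𝓝 y) := by
  have hF := hdata.isProbabilityMeasure
  have hφ0 : ∀ z, 0 < phi α10 π z := fun z => h10.1.trans_le (hdata.le_phi h10 z)
  set m : ℕ → ℝ := fun N => ∫ z, ξ N z ∂F with hm
  -- the centred summands
  set Y : ℕ → ℕ → Ω → ℝ := fun N i ω =>
    incl D1 D2 i ω / phi α10 π (Z i ω) * ξ N (Z i ω) - m N with hY
  have hfm : ∀ N, Measurable (Function.uncurry fun (z : 𝒵) (d : ℝ) =>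
      d / phi α10 π z * ξ N z - m N) := fun N =>
    ((measurable_snd.div (hdata.measurable_phi.comp measurable_fst)).mul
      ((hmeas N).comp measurable_fst)).sub measurable_const
  have hquot : ∀ N, MemLp (ξ N) 2 F → MemLp (fun z => (phi α10 π z)⁻¹ * ξ N z) 2 F := by
    intro N hN
    refine hN.of_le_mul (c := α10⁻¹)
      ((hdata.measurable_phi.inv.mul (hmeas N)).aestronglyMeasurable) (ae_of_all _ fun z => ?_)
    rw [norm_mul, norm_inv, Real.norm_of_nonneg (hφ0 z).le]
    gcongr
    · exact h10.1
    · exact hdata.le_phi h10 z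
  have hYL : ∀ N, MemLp (ξ N) 2 F →
      MemLp (fun ω => incl D1 D2 0 ω / phi α10 π (Z 0 ω) * ξ N (Z 0 ω)) 2 P := by
    intro N hN
    refine (hdata.memLp_incl_smul (hquot N hN) 0).ae_eq (ae_of_all _ fun ω => ?_)
    simp only [smul_eq_mul]
    ring
  have hint : ∀ N, MemLp (ξ N) 2 F →
      ∫ ω, incl D1 D2 0 ω / phi α10 π (Z 0 ω) * ξ N (Z 0 ω) ∂P = m N := by
    intro N hN
    have h1 := hdata.integral_incl_smul h10 (hquot N hN).1 0
    calc _ = ∫ ω, incl D1 D2 0 ω • ((phi α10 π (Z 0 ω))⁻¹ * ξ N (Z 0 ω)) ∂P :=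
          integral_congr_ae (ae_of_all _ fun ω => by simp only [smul_eq_mul]; ring)
      _ = _ := by
          rw [h1]
          refine integral_congr_ae (ae_of_all _ fun z => ?_)
          have := (hφ0 z).ne'
          simp only [smul_eq_mul]
          field_simp
  have hsqint : ∀ N, MemLp (ξ N) 2 F →
      ∫ ω, (∑ i : Fin N, Y N i ω) ^ 2 ∂P ≤ α10⁻¹ * (N * ∫ z, ξ N z ^ 2 ∂F) := by
    intro N hN
    have hL2 : MemLp (Y N 0) 2 P := (hYL N hN).sub (memLp_const _)
    have h0 : ∫ ω, Y N 0 ω ∂P = 0 := by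
      simp only [hY]
      rw [integral_sub ((hYL N hN).integrable one_le_two) (integrable_const _), hint N hN]
      simp
    rw [integral_sum_sq_of_iid (hdata.iIndepFun_comp (hfm N)) (hdata.identDistrib_comp (hfm N))
      hL2 h0, mul_left_comm]
    gcongr
    have h1 : ∫ ω, Y N 0 ω ^ 2 ∂P ≤
        ∫ ω, (incl D1 D2 0 ω / phi α10 π (Z 0 ω) * ξ N (Z 0 ω)) ^ 2 ∂P := by
      rw [← variance_of_integral_eq_zero hL2.aemeasurable h0]
      simp only [hY]
      rw [variance_sub_const (hYL N hN).1]
      exact variance_le_expectation_sq (hYL N hN).1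
    refine h1.trans ?_
    have h2 := hdata.integral_comp_Z hN.integrable_sq.aestronglyMeasurable 0
    have h3 : ∫ ω, (incl D1 D2 0 ω / phi α10 π (Z 0 ω) * ξ N (Z 0 ω)) ^ 2 ∂P =
        ∫ ω, incl D1 D2 0 ω • ((phi α10 π (Z 0 ω))⁻¹ * ξ N (Z 0 ω)) ^ 2 ∂P := by
      refine integral_congr_ae (ae_of_all _ fun ω => ?_)
      rcases incl_zero_or_one D1 D2 0 ω with h | h <;> simp [h]
    rw [h3, hdata.integral_incl_smul h10 (hquot N hN).integrable_sq.aestronglyMeasurable 0,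
      ← integral_const_mul]
    refine integral_mono_of_nonneg (ae_of_all _ fun z => ?_) (hN.integrable_sq.const_mul _)
      (ae_of_all _ fun z => ?_)
    · exact smul_nonneg (hφ0 z).le (sq_nonneg _)
    · have h4 := hφ0 z
      simp only [smul_eq_mul, mul_pow]
      calc phi α10 π z * ((phi α10 π z)⁻¹ ^ 2 * ξ N z ^ 2) = (phi α10 π z)⁻¹ * ξ N z ^ 2 := by
            field_simp
        _ ≤ α10⁻¹ * ξ N z ^ 2 := by
            gcongr
            · exact h10.1
            · exact hdata.le_phi h10 z
  have hYmem : ∀ N, MemLp (ξ N) 2 F → ∀ i, MemLp (Y N i) 2 P := fun N hN i =>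
    (hdata.identDistrib_comp (hfm N) i).memLp_iff.2 ((hYL N hN).sub (memLp_const _))
  have hlim : Tendsto (fun x : ℕ × Ω => (∑ i : Fin x.1, Y x.1 i x.2) ^ 2) (highProb P) (𝓝 0) := by
    have hb := hsq.const_mul α10⁻¹
    rw [mul_zero] at hb
    refine tendsto_highProb_of_integral (X := fun N ω => (∑ i : Fin N, Y N i ω) ^ 2) ?_
      (squeeze_zero' (Eventually.of_forall fun N => integral_nonneg fun ω => abs_nonneg _) ?_ hb)
    · filter_upwards [hmem] with N hN
      exact (memLp_finsetSum Finset.univ fun (i : Fin N) _ => hYmem N hN i).integrable_sq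
    · filter_upwards [hmem] with N hN
      simp only [abs_sq]
      exact hsqint N hN
  have hlim2 : Tendsto (fun x : ℕ × Ω => ∑ i : Fin x.1, Y x.1 i x.2) (highProb P) (𝓝 0) := by
    rw [tendsto_zero_iff_abs_tendsto_zero]
    have := (Real.continuous_sqrt.tendsto 0).comp hlim
    rw [Real.sqrt_zero] at this
    exact this.congr fun x => Real.sqrt_sq_eq_abs _
  have := hlim2.add (hmean.comp tendsto_fst_highProb)
  rw [zero_add] at this
  refine this.congr fun x => ?_
  simp only [hY, Function.comp_apply, Finset.sum_sub_distrib, Finset.sum_const, Finset.card_univ,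
    Fintype.card_fin, nsmul_eq_mul]
  ring

end CaptureRecapture

end TriangularArray

/-! ### Inverse-probability-weighted second moments -/

section Moments

variable {𝒵 : Type*} [MeasurableSpace 𝒵] {F : Measure 𝒵} {φ : 𝒵 → ℝ} {a : ℝ} {k r : ℕ}
  {W : 𝒵 → EuclideanSpace ℝ (Fin r)} {H : 𝒵 → EuclideanSpace ℝ (Fin k)}

/-- A positive definite matrix is bounded below by a positive multiple of the identity. -/
lemma exists_pos_le_inner_of_posDef {A : Matrix (Fin k) (Fin k) ℝ} (hA : A.PosDef) :
    ∃ c > 0, ∀ v : EuclideanSpace ℝ (Fin k),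
      c * ‖v‖ ^ 2 ≤ inner ℝ (Matrix.toEuclideanCLM (𝕜 := ℝ) A v) v := by
  have hpos : ∀ v : EuclideanSpace ℝ (Fin k), v ≠ 0 →
      0 < inner ℝ (Matrix.toEuclideanCLM (𝕜 := ℝ) A v) v := by
    intro v hv
    rw [real_inner_comm, inner_toEuclideanCLM]
    have := hA.dotProduct_mulVec_pos (x := v.ofLp) (by simpa using hv)
    simpa using this
  obtain hE | hE := subsingleton_or_nontrivial (EuclideanSpace ℝ (Fin k))
  · exact ⟨1, one_pos, fun v => by simp [Subsingleton.elim v 0]⟩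
  obtain ⟨v₀, hv₀, hmin⟩ := (isCompact_sphere (0 : EuclideanSpace ℝ (Fin k)) 1).exists_isMinOn
    (NormedSpace.sphere_nonempty.2 zero_le_one)
    (f := fun v => inner ℝ (Matrix.toEuclideanCLM (𝕜 := ℝ) A v) v)
    (Continuous.continuousOn (by fun_prop))
  refine ⟨_, hpos v₀ (ne_zero_of_mem_unit_sphere ⟨v₀, hv₀⟩), fun v => ?_⟩
  rcases eq_or_ne v 0 with rfl | hv
  · simp
  have hn : ‖v‖ ≠ 0 := norm_ne_zero_iff.2 hv
  have h1 := hmin (show ‖v‖⁻¹ • v ∈ Metric.sphere 0 1 by simp [norm_smul, hn])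
  simp only [map_smul, inner_smul_left, inner_smul_right, RCLike.conj_to_real,
    Set.mem_ofPred_eq] at h1
  calc _ ≤ ‖v‖⁻¹ * (‖v‖⁻¹ * inner ℝ (Matrix.toEuclideanCLM (𝕜 := ℝ) A v) v) * ‖v‖ ^ 2 := by
        gcongr
    _ = _ := by field_simp

lemma measurable_inv_smul_rankOne (hφm : Measurable φ) (hW : Measurable W) (hH : Measurable H) :
    Measurable fun z => (φ z)⁻¹ • InnerProductSpace.rankOne ℝ (W z) (H z) := by
  have hc : Continuous fun y : ℝ × EuclideanSpace ℝ (Fin r) × EuclideanSpace ℝ (Fin k) =>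
      y.1 • InnerProductSpace.rankOne ℝ y.2.1 y.2.2 := by
    refine continuous_fst.smul ?_
    change Continuous fun y : ℝ × EuclideanSpace ℝ (Fin r) × EuclideanSpace ℝ (Fin k) =>
      ContinuousLinearMap.smulRightL ℝ _ _ (innerSL ℝ y.2.2) y.2.1
    fun_prop
  exact hc.measurable.comp (hφm.inv.prodMk (hW.prodMk hH))

lemma integrable_inv_smul_rankOne (ha : 0 < a) (hφ : ∀ z, a ≤ φ z) (hφm : Measurable φ)
    (hW : Measurable W) (hH : Measurable H) (hW2 : MemLp W 2 F) (hH2 : MemLp H 2 F) :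
    Integrable (fun z => (φ z)⁻¹ • InnerProductSpace.rankOne ℝ (W z) (H z)) F := by
  refine ((hW2.norm.integrable_mul hH2.norm).const_mul a⁻¹).mono'
    (measurable_inv_smul_rankOne hφm hW hH).aestronglyMeasurable (ae_of_all _ fun z => ?_)
  have h := ha.trans_le (hφ z)
  rw [norm_smul, norm_inv, Real.norm_of_nonneg h.le, InnerProductSpace.norm_rankOne]
  simp only [Pi.mul_apply]
  gcongr
  exact hφ z

lemma integrable_mul_div (ha : 0 < a) (hφ : ∀ z, a ≤ φ z) (hφm : Measurable φ)
    {f f' : 𝒵 → ℝ} (hf : MemLp f 2 F) (hf' : MemLp f' 2 F) :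
    Integrable (fun z => f z * f' z / φ z) F := by
  refine ((hf.integrable_mul hf').norm.const_mul a⁻¹).mono'
    ((hf.aemeasurable.mul hf'.aemeasurable).div hφm.aemeasurable).aestronglyMeasurable
    (ae_of_all _ fun z => ?_)
  have h := ha.trans_le (hφ z)
  rw [norm_div, Real.norm_of_nonneg h.le, div_eq_inv_mul]
  simp only [Pi.mul_apply]
  gcongr
  exact hφ z

lemma integral_inner_mul_inner_div (ha : 0 < a) (hφ : ∀ z, a ≤ φ z) (hφm : Measurable φ)
    (hW2 : MemLp W 2 F) (hH2 : MemLp H 2 F) (u : EuclideanSpace ℝ (Fin r))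
    (v : EuclideanSpace ℝ (Fin k)) :
    ∫ z, inner ℝ (W z) u * inner ℝ (H z) v / φ z ∂F =
      u.ofLp ⬝ᵥ B F φ (fun z => (W z).ofLp) (fun z => (H z).ofLp) *ᵥ v.ofLp := by
  have hWj : ∀ j, MemLp (fun z => W z j) 2 F := fun j =>
    (EuclideanSpace.proj (𝕜 := ℝ) j).comp_memLp' hW2
  have hHj : ∀ j, MemLp (fun z => H z j) 2 F := fun j =>
    (EuclideanSpace.proj (𝕜 := ℝ) j).comp_memLp' hH2
  have hint : ∀ i j, Integrable (fun z => W z i * H z j / φ z) F := fun i j =>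
    integrable_mul_div ha hφ hφm (hWj i) (hHj j)
  have hexp : ∀ z, inner ℝ (W z) u * inner ℝ (H z) v / φ z =
      ∑ i, ∑ j, (u i * v j) * (W z i * H z j / φ z) := by
    intro z
    simp only [PiLp.inner_apply, RCLike.inner_apply, RCLike.conj_to_real, Finset.sum_mul_sum,
      Finset.sum_div]
    exact Finset.sum_congr rfl fun i _ => Finset.sum_congr rfl fun j _ => by ring
  simp only [hexp]
  rw [integral_finsetSum _ fun i _ => integrable_finsetSum _ fun j _ => (hint i j).const_mul _]
  simp only [dotProduct, mulVec, B, Matrix.of_apply, Finset.mul_sum]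
  refine Finset.sum_congr rfl fun i _ => ?_
  rw [integral_finsetSum _ fun j _ => (hint i j).const_mul _]
  refine Finset.sum_congr rfl fun j _ => ?_
  rw [integral_const_mul]
  ring

/-- The operator `E[W Hᵀ / φ]` acts as the matrix `B`. -/
lemma integral_rankOne_apply (ha : 0 < a) (hφ : ∀ z, a ≤ φ z) (hφm : Measurable φ)
    (hW : Measurable W) (hH : Measurable H) (hW2 : MemLp W 2 F) (hH2 : MemLp H 2 F)
    (v : EuclideanSpace ℝ (Fin k)) :
    (∫ z, (φ z)⁻¹ • InnerProductSpace.rankOne ℝ (W z) (H z) ∂F) v =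
      WithLp.toLp 2 (B F φ (fun z => (W z).ofLp) (fun z => (H z).ofLp) *ᵥ v.ofLp) := by
  have hint := integrable_inv_smul_rankOne ha hφ hφm hW hH hW2 hH2
  refine ext_inner_left ℝ fun u => ?_
  have h1 : inner ℝ u ((∫ z, (φ z)⁻¹ • InnerProductSpace.rankOne ℝ (W z) (H z) ∂F) v) =
      ∫ z, inner ℝ (W z) u * inner ℝ (H z) v / φ z ∂F := by
    rw [ContinuousLinearMap.integral_apply hint,
      ← integral_inner (hint.apply_continuousLinearMap v)]
    refine integral_congr_ae (ae_of_all _ fun z => ?_)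
    simp only [_root_.smul_apply, InnerProductSpace.rankOne_apply, inner_smul_right]
    rw [real_inner_comm u]
    ring
  rw [h1, integral_inner_mul_inner_div ha hφ hφm hW2 hH2]
  simp only [PiLp.inner_apply, RCLike.inner_apply, RCLike.conj_to_real, dotProduct]
  exact Finset.sum_congr rfl fun i _ => mul_comm _ _

/-- The weighted second moments of the residual of `W` after regression on `H`. -/
lemma integral_inner_residual_sq_div (ha : 0 < a) (hφ : ∀ z, a ≤ φ z) (hφm : Measurable φ)
    (hW2 : MemLp W 2 F) (hH2 : MemLp H 2 F)
    (hB : (B F φ (fun z => (H z).ofLp) (fun z => (H z).ofLp)).PosDef)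
    (s : EuclideanSpace ℝ (Fin r)) :
    ∫ z, inner ℝ (W z - WithLp.toLp 2 (B F φ (fun z => (W z).ofLp) (fun z => (H z).ofLp) *ᵥ
        ((B F φ (fun z => (H z).ofLp) (fun z => (H z).ofLp))⁻¹ *ᵥ (H z).ofLp))) s ^ 2 / φ z ∂F =
      s.ofLp ⬝ᵥ (B F φ (fun z => (W z).ofLp) (fun z => (W z).ofLp) -
        B F φ (fun z => (W z).ofLp) (fun z => (H z).ofLp) *
        (B F φ (fun z => (H z).ofLp) (fun z => (H z).ofLp))⁻¹ *
        (B F φ (fun z => (W z).ofLp) (fun z => (H z).ofLp))ᵀ) *ᵥ s.ofLp := by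
  set Bll := B F φ (fun z => (W z).ofLp) (fun z => (W z).ofLp)
  set Blh := B F φ (fun z => (W z).ofLp) (fun z => (H z).ofLp)
  set Bhh := B F φ (fun z => (H z).ofLp) (fun z => (H z).ofLp)
  have hdet : IsUnit Bhh.det := hB.det_pos.ne'.isUnit
  have hsymm : Bhh⁻¹ᵀ = Bhh⁻¹ := by
    have h1 : Bhhᵀ = Bhh := hB.1
    rw [Matrix.transpose_nonsing_inv, h1]
  set v : EuclideanSpace ℝ (Fin k) := WithLp.toLp 2 (Bhh⁻¹ *ᵥ (Blhᵀ *ᵥ s.ofLp)) with hv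
  have hinner : ∀ z, inner ℝ (W z - WithLp.toLp 2 (Blh *ᵥ (Bhh⁻¹ *ᵥ (H z).ofLp))) s =
      inner ℝ (W z) s - inner ℝ (H z) v := by
    intro z
    have h1 : inner ℝ (WithLp.toLp 2 (Blh *ᵥ (Bhh⁻¹ *ᵥ (H z).ofLp))) s =
        s.ofLp ⬝ᵥ (Blh *ᵥ (Bhh⁻¹ *ᵥ (H z).ofLp)) := by
      simp [PiLp.inner_apply, dotProduct]
    have h2 : inner ℝ (H z) v = (Bhh⁻¹ *ᵥ (Blhᵀ *ᵥ s.ofLp)) ⬝ᵥ (H z).ofLp := by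
      simp [PiLp.inner_apply, dotProduct, hv]
    rw [inner_sub_left, h1, h2, Matrix.dotProduct_mulVec, Matrix.dotProduct_mulVec,
      ← Matrix.mulVec_transpose, ← Matrix.mulVec_transpose, hsymm]
  have hWs : MemLp (fun z => inner ℝ (W z) s) 2 F := hW2.inner_const (𝕜 := ℝ) s
  have hHv : MemLp (fun z => inner ℝ (H z) v) 2 F := hH2.inner_const (𝕜 := ℝ) v
  have e1 := integral_inner_mul_inner_div ha hφ hφm hW2 hW2 s s
  have e2 := integral_inner_mul_inner_div ha hφ hφm hW2 hH2 s v
  have e3 := integral_inner_mul_inner_div ha hφ hφm hH2 hH2 v v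
  have i1 := integrable_mul_div ha hφ hφm hWs hWs
  have i2 := integrable_mul_div ha hφ hφm hWs hHv
  have i3 := integrable_mul_div ha hφ hφm hHv hHv
  have i12 : Integrable (fun z => inner ℝ (W z) s * inner ℝ (W z) s / φ z -
      2 * (inner ℝ (W z) s * inner ℝ (H z) v / φ z)) F := i1.sub (i2.const_mul 2)
  have hexp : ∀ z, inner ℝ (W z - WithLp.toLp 2 (Blh *ᵥ (Bhh⁻¹ *ᵥ (H z).ofLp))) s ^ 2 / φ z =
      inner ℝ (W z) s * inner ℝ (W z) s / φ z - 2 * (inner ℝ (W z) s * inner ℝ (H z) v / φ z) +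
        inner ℝ (H z) v * inner ℝ (H z) v / φ z := by
    intro z
    rw [hinner]
    ring
  simp only [hexp]
  rw [integral_add i12 i3, integral_sub i1 (i2.const_mul 2),
    integral_const_mul, e1, e2, e3]
  have hBv : Bhh *ᵥ v.ofLp = Blhᵀ *ᵥ s.ofLp := by
    rw [hv, Matrix.mulVec_mulVec, Matrix.mul_nonsing_inv _ hdet, Matrix.one_mulVec]
  have h3 : v.ofLp ⬝ᵥ Bhh *ᵥ v.ofLp = s.ofLp ⬝ᵥ Blh *ᵥ v.ofLp := by
    rw [hBv, Matrix.dotProduct_mulVec s.ofLp, ← Matrix.mulVec_transpose, dotProduct_comm]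
  have h4 : s.ofLp ⬝ᵥ Blh *ᵥ v.ofLp = s.ofLp ⬝ᵥ (Blh * Bhh⁻¹ * Blhᵀ) *ᵥ s.ofLp := by
    rw [hv, Matrix.mulVec_mulVec, Matrix.mulVec_mulVec]
  rw [h3, h4, Matrix.sub_mulVec, dotProduct_sub]
  ring

end Moments

/-! ### Inverse-probability-weighted sums -/

section IPW

variable {Ω 𝒵 : Type*} [MeasurableSpace Ω] [MeasurableSpace 𝒵] {P : Measure Ω}
  {F : Measure 𝒵} {Z : ℕ → Ω → 𝒵} {D1 D2 : ℕ → Ω → ℝ} {α10 α20 : ℝ} {π : 𝒵 → ℝ}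

/-- The normalized inverse-probability-weighted sum `√N · N⁻¹ ∑ D_i R(Z_i) / φ(Z_i)`, as a function
of `(N, ω)`. -/
noncomputable def ipwSum {r : ℕ} (Z : ℕ → Ω → 𝒵) (D1 D2 : ℕ → Ω → ℝ) (φ : 𝒵 → ℝ)
    (R : 𝒵 → EuclideanSpace ℝ (Fin r)) (x : ℕ × Ω) : EuclideanSpace ℝ (Fin r) :=
  √(x.1 : ℝ) • ((x.1 : ℝ)⁻¹ • ∑ i : Fin x.1,
    (incl D1 D2 i x.2 / φ (Z i x.2)) • R (Z i x.2))

namespace CaptureRecapture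

variable (hdata : CaptureRecapture P F Z D1 D2 α10 α20 π)
include hdata

lemma measurable_div_phi_smul {E : Type*} [NormedAddCommGroup E] [NormedSpace ℝ E]
    [MeasurableSpace E] [BorelSpace E] [SecondCountableTopology E] {R : 𝒵 → E}
    (hR : Measurable R) :
    Measurable (Function.uncurry fun (z : 𝒵) (d : ℝ) => (d / phi α10 π z) • R z) :=
  (measurable_snd.div (hdata.measurable_phi.comp measurable_fst)).smul (hR.comp measurable_fst)

lemma memLp_inv_phi_smul (h10 : α10 ∈ Set.Ioo (0 : ℝ) 1) {E : Type*} [NormedAddCommGroup E]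
    [NormedSpace ℝ E] {R : 𝒵 → E} {p : ENNReal} (hR : MemLp R p F) :
    MemLp (fun z => (phi α10 π z)⁻¹ • R z) p F := by
  refine hR.of_le_mul (c := α10⁻¹)
    (hdata.measurable_phi.inv.aestronglyMeasurable.smul hR.1) (ae_of_all _ fun z => ?_)
  have h1 := hdata.le_phi h10 z
  rw [norm_smul, norm_inv, Real.norm_of_nonneg (h10.1.le.trans h1)]
  gcongr
  exact h10.1

lemma memLp_incl_div_phi_smul (h10 : α10 ∈ Set.Ioo (0 : ℝ) 1) {E : Type*} [NormedAddCommGroup E]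
    [NormedSpace ℝ E] {R : 𝒵 → E} {p : ENNReal} (hR : MemLp R p F) (i : ℕ) :
    MemLp (fun ω => (incl D1 D2 i ω / phi α10 π (Z i ω)) • R (Z i ω)) p P := by
  refine (hdata.memLp_incl_smul (hdata.memLp_inv_phi_smul h10 hR) i).ae_eq
    (ae_of_all _ fun ω => ?_)
  simp only [smul_smul, div_eq_mul_inv]

variable [IsProbabilityMeasure P]

lemma integral_incl_div_phi_smul (h10 : α10 ∈ Set.Ioo (0 : ℝ) 1) {E : Type*} [NormedAddCommGroup E]
    [NormedSpace ℝ E] {R : 𝒵 → E} (hR : MemLp R 1 F) (i : ℕ) :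
    ∫ ω, (incl D1 D2 i ω / phi α10 π (Z i ω)) • R (Z i ω) ∂P = ∫ z, R z ∂F := by
  have h := hdata.integral_incl_smul h10 (hdata.memLp_inv_phi_smul h10 hR).1 i
  simp only [smul_smul, ← div_eq_mul_inv] at h
  rw [h]
  refine integral_congr_ae (ae_of_all _ fun z => ?_)
  have h1 := h10.1.trans_le (hdata.le_phi h10 z)
  simp only [div_self h1.ne', one_smul]

lemma isTight_ipwSum (h10 : α10 ∈ Set.Ioo (0 : ℝ) 1) {r : ℕ} {R : 𝒵 → EuclideanSpace ℝ (Fin r)}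
    (hRm : Measurable R) (hR : MemLp R 2 F) (hR0 : ∫ z, R z ∂F = 0) :
    IsTight P (ipwSum Z D1 D2 (phi α10 π) R) := by
  have hF := hdata.isProbabilityMeasure
  have hf := hdata.measurable_div_phi_smul hRm
  refine isTight_normalized_sum
    (X := fun i ω => (incl D1 D2 i ω / phi α10 π (Z i ω)) • R (Z i ω))
    (hdata.iIndepFun_comp hf) (hdata.identDistrib_comp hf)
    (hdata.memLp_incl_div_phi_smul h10 hR 0) ?_
  rw [hdata.integral_incl_div_phi_smul h10 (hR.mono_exponent one_le_two), hR0]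

/-- Central limit theorem for inverse-probability-weighted sums. -/
lemma tendstoInDistribution_ipwSum (h10 : α10 ∈ Set.Ioo (0 : ℝ) 1) {r : ℕ}
    {R : 𝒵 → EuclideanSpace ℝ (Fin r)}
    (hRm : Measurable R) (hR : MemLp R 2 F) (hR0 : ∫ z, R z ∂F = 0)
    {S : Matrix (Fin r) (Fin r) ℝ} (hS : S.PosSemidef)
    (hcov : ∀ t : EuclideanSpace ℝ (Fin r),
      ∫ z, inner ℝ (R z) t ^ 2 / phi α10 π z ∂F = t.ofLp ⬝ᵥ S *ᵥ t.ofLp) :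
    TendstoInDistribution (fun (N : ℕ) ω => ipwSum Z D1 D2 (phi α10 π) R (N, ω)) atTop
      (id : EuclideanSpace ℝ (Fin r) → EuclideanSpace ℝ (Fin r)) (fun _ => P)
      (multivariateGaussian 0 S) := by
  have hF := hdata.isProbabilityMeasure
  have hf := hdata.measurable_div_phi_smul hRm
  have h := tendstoInDistribution_multivariateGaussian (hdata.iIndepFun_comp hf)
    (hdata.identDistrib_comp hf) (hdata.memLp_incl_div_phi_smul h10 hR 0)
    (by rw [hdata.integral_incl_div_phi_smul h10 (hR.mono_exponent one_le_two), hR0]) hS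
    fun t => by
      rw [← hcov t]
      have hRt : MemLp (fun z => inner ℝ (R z) t) 2 F := hR.inner_const (𝕜 := ℝ) t
      have h1 := hdata.integral_incl_div_phi_smul h10
        (R := fun z => inner ℝ (R z) t ^ 2 / phi α10 π z)
        (memLp_one_iff_integrable.2 (by
          simpa only [sq] using integrable_mul_div h10.1 (hdata.le_phi h10) hdata.measurable_phi
            hRt hRt)) 0
      rw [← h1]
      refine integral_congr_ae (ae_of_all _ fun ω => ?_)
      rcases incl_zero_or_one D1 D2 0 ω with h | h
      · simp [h]
      · simp only [h, inner_smul_left, RCLike.conj_to_real, smul_eq_mul]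
        ring
  convert! h using 3 with N ω
  rw [ipwSum, smul_smul, Finset.sum_range]
  congr 1
  rcases eq_or_ne (N : ℝ) 0 with h0 | h0
  · simp [h0]
  · have h2 : 0 < √(N : ℝ) := Real.sqrt_pos.2 (lt_of_le_of_ne (Nat.cast_nonneg N) h0.symm)
    have h3 : √(N : ℝ) * √(N : ℝ) = N := Real.mul_self_sqrt (Nat.cast_nonneg N)
    rw [← div_eq_mul_inv, div_eq_iff h0]
    nth_rw 3 [← h3]
    field_simp

lemma tendsto_mean_rankOne (h10 : α10 ∈ Set.Ioo (0 : ℝ) 1) {r k : ℕ}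
    {W : 𝒵 → EuclideanSpace ℝ (Fin r)} {H : 𝒵 → EuclideanSpace ℝ (Fin k)}
    (hW : Measurable W) (hH : Measurable H) (hW2 : MemLp W 2 F) (hH2 : MemLp H 2 F) :
    Tendsto (fun x : ℕ × Ω => (x.1 : ℝ)⁻¹ • ∑ i : Fin x.1,
      (incl D1 D2 i x.2 / phi α10 π (Z i x.2) ^ 2) •
        InnerProductSpace.rankOne ℝ (W (Z i x.2)) (H (Z i x.2)))
      (highProb P) (𝓝 (∫ z, (phi α10 π z)⁻¹ • InnerProductSpace.rankOne ℝ (W z) (H z) ∂F)) := by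
  have hint := integrable_inv_smul_rankOne h10.1 (hdata.le_phi h10) hdata.measurable_phi hW hH hW2
    hH2
  have hm := measurable_inv_smul_rankOne hdata.measurable_phi hW hH
  have hc : ∀ (z : 𝒵) (d : ℝ), (d / phi α10 π z ^ 2) • InnerProductSpace.rankOne ℝ (W z) (H z) =
      (d / phi α10 π z) • ((phi α10 π z)⁻¹ • InnerProductSpace.rankOne ℝ (W z) (H z)) := by
    intro z d
    rw [smul_smul]
    congr 1
    ring
  have h := hdata.tendsto_mean (hdata.measurable_div_phi_smul hm)
    (memLp_one_iff_integrable.1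
      (hdata.memLp_incl_div_phi_smul h10 (memLp_one_iff_integrable.2 hint) 0))
  rw [hdata.integral_incl_div_phi_smul h10 (memLp_one_iff_integrable.2 hint)] at h
  simpa only [hc] using h

/-- Empirical means of `‖H‖ ‖W‖` are bounded with probability tending to one. -/
lemma exists_mean_norm_mul_norm_le {E E' : Type*} [NormedAddCommGroup E] [MeasurableSpace E]
    [BorelSpace E] [NormedAddCommGroup E'] [MeasurableSpace E'] [BorelSpace E']
    {H : 𝒵 → E} {W : 𝒵 → E'} (hH : Measurable H) (hW : Measurable W) (hH2 : MemLp H 2 F)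
    (hW2 : MemLp W 2 F) :
    ∃ K : ℝ, ∀ᶠ x : ℕ × Ω in highProb P,
      (x.1 : ℝ)⁻¹ * ∑ i : Fin x.1, ‖H (Z i x.2)‖ * ‖W (Z i x.2)‖ ≤ K := by
  have hint : Integrable (fun z => ‖H z‖ * ‖W z‖) F := hH2.norm.integrable_mul hW2.norm
  have h := hdata.tendsto_mean (f := fun z _ => ‖H z‖ * ‖W z‖)
    ((hH.norm.mul hW.norm).comp measurable_fst)
    (memLp_one_iff_integrable.1 (hdata.memLp_comp_Z (memLp_one_iff_integrable.2 hint) 0))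
  exact ⟨∫ ω, ‖H (Z 0 ω)‖ * ‖W (Z 0 ω)‖ ∂P + 1,
    (h.eventually (gt_mem_nhds (lt_add_one _))).mono fun x hx => hx.le⟩

lemma tendsto_mean_incl (h10 : α10 ∈ Set.Ioo (0 : ℝ) 1) :
    Tendsto (fun x : ℕ × Ω => (x.1 : ℝ)⁻¹ * ∑ i : Fin x.1, incl D1 D2 i x.2) (highProb P)
      (𝓝 (∫ z, phi α10 π z ∂F)) := by
  have hF := hdata.isProbabilityMeasure
  have h1 : MemLp (fun _ : 𝒵 => (1 : ℝ)) 1 F := memLp_const 1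
  have h2 := hdata.memLp_incl_smul h1 0
  have h3 := hdata.integral_incl_smul h10 h1.1 0
  simp only [smul_eq_mul, mul_one] at h2 h3
  have h := hdata.tendsto_mean (f := fun _ d => d) measurable_snd (memLp_one_iff_integrable.1 h2)
  rw [h3] at h
  exact h

end CaptureRecapture

end IPW

/-! ### The estimator -/

section Estimator

variable {Ω 𝒵 : Type*} [MeasurableSpace Ω] [MeasurableSpace 𝒵] {P : Measure Ω}
  [IsProbabilityMeasure P]
  {F : Measure 𝒵} {Z : ℕ → Ω → 𝒵} {D1 D2 : ℕ → Ω → ℝ} {α10 α20 α₀ : ℝ} {π : 𝒵 → ℝ}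
  {q k : ℕ} {ℓ : 𝒵 → EuclideanSpace ℝ (Fin q) → ℝ} {θ₀ : EuclideanSpace ℝ (Fin q)}
  {dl : 𝒵 → EuclideanSpace ℝ (Fin q)} {V : Matrix (Fin q) (Fin q) ℝ} {g : 𝒵 → Fin k → ℝ}

/-- Conditions on a constraint function `g` for the asymptotic theory of the weights. The last one
says that `φ - α₀` is among the linear combinations of the components of `g`; it lets the multiplier
of the total mass be absorbed into that of `g`, which makes `N p_i` close to `D_i / φ(Z_i)`. -/
structure RegularConstraint (F : Measure 𝒵) (φ : 𝒵 → ℝ) (α₀ : ℝ) (g : 𝒵 → Fin k → ℝ) : Prop where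
  measurable : Measurable g
  memLp : MemLp (fun z => (WithLp.toLp 2 (g z) : EuclideanSpace ℝ (Fin k))) 2 F
  integral_eq_zero : ∫ z, (WithLp.toLp 2 (g z) : EuclideanSpace ℝ (Fin k)) ∂F = 0
  posDef : (B F φ g g).PosDef
  span : ∃ e : EuclideanSpace ℝ (Fin k), ∀ z,
    φ z = α₀ + inner ℝ (WithLp.toLp 2 (g z) : EuclideanSpace ℝ (Fin k)) e

/-- The residual `ℓ̇ - B_ℓ̇g B_gg⁻¹ g` of the gradient after regression on the constraint
function. -/
noncomputable def residual (F : Measure 𝒵) (φ : 𝒵 → ℝ) (g : 𝒵 → Fin k → ℝ)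
    (dl : 𝒵 → EuclideanSpace ℝ (Fin q)) (z : 𝒵) : EuclideanSpace ℝ (Fin q) :=
  dl z - WithLp.toLp 2 (B F φ (fun z => (dl z).ofLp) g *ᵥ ((B F φ g g)⁻¹ *ᵥ g z))

lemma RegularConstraint.measurable_toLp {φ : 𝒵 → ℝ} (hg : RegularConstraint F φ α₀ g) :
    Measurable fun z => (WithLp.toLp 2 (g z) : EuclideanSpace ℝ (Fin k)) :=
  (WithLp.measurable_toLp 2 _).comp hg.measurable

lemma RegularConstraint.integral_phi {φ : 𝒵 → ℝ} [IsProbabilityMeasure F]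
    (hg : RegularConstraint F φ α₀ g) : ∫ z, φ z ∂F = α₀ := by
  obtain ⟨e, he⟩ := hg.span
  have hint := hg.memLp.integrable one_le_two
  have h := integral_inner (𝕜 := ℝ) hint e
  rw [hg.integral_eq_zero, inner_zero_right] at h
  simp only [he]
  rw [integral_add (integrable_const _) (hint.inner_const e)]
  simp only [real_inner_comm e, h]
  simp

namespace LossConditions

variable (hdata : CaptureRecapture P F Z D1 D2 α10 α20 π) (h10 : α10 ∈ Set.Ioo (0 : ℝ) 1)
  (hloss : LossConditions F (phi α10 π) ℓ θ₀ dl V)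
include hdata h10 hloss

omit [IsProbabilityMeasure P] in
lemma memLp_grad : MemLp dl 2 F := by
  have hj : ∀ j, MemLp (fun z => dl z j) 2 F := by
    intro j
    have hm : Measurable fun z => dl z j :=
      ((EuclideanSpace.proj (𝕜 := ℝ) j).continuous.measurable).comp hloss.measurable_grad
    refine (memLp_two_iff_integrable_sq hm.aestronglyMeasurable).2 ?_
    refine (hloss.finite_Bll j j).mono' (hm.pow_const 2).aestronglyMeasurable
      (ae_of_all _ fun z => ?_)
    have h1 := h10.1.trans_le (hdata.le_phi h10 z)
    rw [Real.norm_of_nonneg (sq_nonneg _), ← sq, le_div_iff₀ h1]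
    exact mul_le_of_le_one_right (sq_nonneg _) (hdata.phi_le_one h10 z)
  exact MemLp.of_eval_piLp hj

omit hdata h10 in
lemma measurable_remainder (t : EuclideanSpace ℝ (Fin q)) : Measurable (remainder ℓ θ₀ dl t) :=
  ((hloss.measurable_loss _).sub (hloss.measurable_loss _)).sub
    (hloss.measurable_grad.inner_const)

omit hdata h10 in
lemma tendsto_local_remainder (t : EuclideanSpace ℝ (Fin q)) :
    (∀ᶠ N : ℕ in atTop, MemLp (remainder ℓ θ₀ dl ((√(N : ℝ))⁻¹ • t)) 2 F) ∧
    Tendsto (fun N : ℕ => N * ∫ z, remainder ℓ θ₀ dl ((√(N : ℝ))⁻¹ • t) z ^ 2 ∂F) atTop (𝓝 0) ∧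
    Tendsto (fun N : ℕ => N * ∫ z, remainder ℓ θ₀ dl ((√(N : ℝ))⁻¹ • t) z ∂F) atTop
      (𝓝 (1 / 2 * (t.ofLp ⬝ᵥ V *ᵥ t.ofLp))) := by
  have hs : Tendsto (fun N : ℕ => (√(N : ℝ))⁻¹ • t) atTop (𝓝 0) := by
    have h1 : Tendsto (fun N : ℕ => (√(N : ℝ))⁻¹) atTop (𝓝 0) :=
      tendsto_inv_atTop_zero.comp (Real.tendsto_sqrt_atTop.comp tendsto_natCast_atTop_atTop)
    simpa using h1.smul_const t
  have hN : ∀ᶠ N : ℕ in atTop, (0 : ℝ) < N := by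
    filter_upwards [eventually_gt_atTop 0] with N hN
    exact_mod_cast hN
  have hO : (fun N : ℕ => (N : ℝ) * ‖(√(N : ℝ))⁻¹ • t‖ ^ 2) =O[atTop] fun _ => (1 : ℝ) := by
    refine (isBigO_const_const (‖t‖ ^ 2) one_ne_zero atTop).congr' ?_ EventuallyEq.rfl
    filter_upwards [hN] with N hN
    rw [norm_smul, mul_pow, norm_inv, inv_pow, Real.norm_eq_abs, sq_abs, Real.sq_sqrt hN.le,
      mul_inv_cancel_left₀ hN.ne']
  have hscale : ∀ {f : EuclideanSpace ℝ (Fin q) → ℝ}, (f =o[𝓝 0] fun t => ‖t‖ ^ 2) →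
      Tendsto (fun N : ℕ => (N : ℝ) * f ((√(N : ℝ))⁻¹ • t)) atTop (𝓝 0) := by
    intro f hf
    exact (isLittleO_one_iff ℝ).1 (((isBigO_refl (fun N : ℕ => (N : ℝ)) atTop).mul_isLittleO
      (hf.comp_tendsto hs)).trans_isBigO hO)
  refine ⟨hs.eventually hloss.memLp_remainder, hscale hloss.sq_remainder, ?_⟩
  have h := (hscale hloss.mean_remainder).add_const (1 / 2 * (t.ofLp ⬝ᵥ V *ᵥ t.ofLp))
  rw [zero_add] at h
  refine h.congr' ?_
  filter_upwards [hN] with N hN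
  have hq : (N : ℝ) * ((√(N : ℝ))⁻¹ * (√(N : ℝ))⁻¹) = 1 := by
    rw [← mul_inv, Real.mul_self_sqrt hN.le, mul_inv_cancel₀ hN.ne']
  simp only [WithLp.ofLp_smul, Matrix.mulVec_smul, dotProduct_smul, smul_dotProduct, smul_eq_mul]
  linear_combination (-(1 / 2 * (t.ofLp ⬝ᵥ V *ᵥ t.ofLp))) * hq

end LossConditions

omit [MeasurableSpace 𝒵] in
lemma scaled_weightedRisk_eq (ℓ : 𝒵 → EuclideanSpace ℝ (Fin q) → ℝ)
    (θ₀ : EuclideanSpace ℝ (Fin q)) (dl : 𝒵 → EuclideanSpace ℝ (Fin q)) {N : ℕ}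
    (z : Fin N → 𝒵) (p : Fin N → ℝ) (t : EuclideanSpace ℝ (Fin q)) :
    N * (weightedRisk ℓ z p (θ₀ + (√(N : ℝ))⁻¹ • t) - weightedRisk ℓ z p θ₀) =
      N * (∑ i, p i * remainder ℓ θ₀ dl ((√(N : ℝ))⁻¹ • t) (z i)) +
        inner ℝ (√(N : ℝ) • ∑ i, p i • dl (z i)) t := by
  have h1 : (N : ℝ) * (√(N : ℝ))⁻¹ = √(N : ℝ) := by
    rw [← div_eq_mul_inv, Real.div_sqrt]
  rw [inner_smul_left, sum_inner, weightedRisk, weightedRisk, ← Finset.sum_sub_distrib,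
    RCLike.conj_to_real]
  nth_rw 3 [← h1]
  rw [mul_assoc, ← mul_add]
  congr 1
  rw [Finset.mul_sum, ← Finset.sum_add_distrib]
  refine Finset.sum_congr rfl fun i _ => ?_
  rw [remainder, inner_smul_right, inner_smul_left, RCLike.conj_to_real]
  ring

end Estimator

/-! ### Expansion of the estimator -/

section Expansion

variable {Ω 𝒵 : Type*} [MeasurableSpace Ω] [MeasurableSpace 𝒵] {P : Measure Ω}
  [IsProbabilityMeasure P]
  {F : Measure 𝒵} {Z : ℕ → Ω → 𝒵} {D1 D2 : ℕ → Ω → ℝ} {α10 α20 α₀ : ℝ} {π : 𝒵 → ℝ}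
  {q k : ℕ} {ℓ : 𝒵 → EuclideanSpace ℝ (Fin q) → ℝ} {θ₀ : EuclideanSpace ℝ (Fin q)}
  {dl : 𝒵 → EuclideanSpace ℝ (Fin q)} {V : Matrix (Fin q) (Fin q) ℝ} {g : 𝒵 → Fin k → ℝ}
  {phat : (N : ℕ) → Ω → Fin N → ℝ} {θhat : ℕ → Ω → EuclideanSpace ℝ (Fin q)}

lemma exists_forall_eventually_of_eventually_exists {α β : Type*} [Nonempty β] {r : α → β → Prop}
    {l : Filter α} (h : ∀ᶠ x in l, ∃ y, r x y) : ∃ f : α → β, ∀ᶠ x in l, r x (f x) :=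
  ⟨fun x => Classical.epsilon (r x), h.mono fun _ hx => Classical.epsilon_spec hx⟩

/-- The multiplier and the resulting form of the weights, where the normalized score is bounded:
for a multiplier `μ` of order `N ^ (-1/2)`, `N p_i = c D_i / (φ(Z_i) + ⟪g(Z_i), μ⟫)` with
`c → 1`. -/
lemma exists_multiplier_along (hdata : CaptureRecapture P F Z D1 D2 α10 α20 π)
    (h10 : α10 ∈ Set.Ioo (0 : ℝ) 1) (hg : RegularConstraint F (phi α10 π) α₀ g)
    (hphat : ∀ N ω, IsELWeights (phi α10 π) α₀ g (fun i : Fin N => Z i ω)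
      (fun i : Fin N => incl D1 D2 i ω) (phat N ω))
    {L : Filter (ℕ × Ω)} (hL : L ≤ highProb P) {C : ℝ}
    (hC : ∀ᶠ x in L, ‖ipwSum Z D1 D2 (phi α10 π) (fun z => WithLp.toLp 2 (g z)) x‖ ≤ C) :
    ∃ (μ : ℕ × Ω → EuclideanSpace ℝ (Fin k)) (c : ℕ × Ω → ℝ) (M : ℝ),
      (∀ᶠ x in L, √(x.1 : ℝ) * ‖μ x‖ ≤ M) ∧
      (∀ᶠ x in L, ∑ i : Fin x.1, (incl D1 D2 i x.2 /
        (phi α10 π (Z i x.2) + inner ℝ (WithLp.toLp 2 (g (Z i x.2))) (μ x))) •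
          (WithLp.toLp 2 (g (Z i x.2)) : EuclideanSpace ℝ (Fin k)) = 0) ∧
      Tendsto c L (𝓝 1) ∧
      (∀ᶠ x in L, 0 ≤ c x) ∧
      (∀ᶠ x in L, ∀ i : Fin x.1,
        0 < phi α10 π (Z i x.2) + inner ℝ (WithLp.toLp 2 (g (Z i x.2))) (μ x)) ∧
      ∀ᶠ x in L, ∀ i : Fin x.1, x.1 * phat x.1 x.2 i = c x * (incl D1 D2 i x.2 /
        (phi α10 π (Z i x.2) + inner ℝ (WithLp.toLp 2 (g (Z i x.2))) (μ x))) := by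
  have hF := hdata.isProbabilityMeasure
  have hα : 0 < α₀ := by
    rw [← hg.integral_phi]
    have h1 : ∫ _ : 𝒵, α10 ∂F ≤ ∫ z, phi α10 π z ∂F := by
      refine integral_mono (integrable_const _) ?_ (hdata.le_phi h10)
      exact Integrable.of_bound hdata.measurable_phi.aestronglyMeasurable 1 (ae_of_all _ fun z => by
        rw [Real.norm_of_nonneg (h10.1.le.trans (hdata.le_phi h10 z))]
        exact hdata.phi_le_one h10 z)
    rw [integral_const, probReal_univ, one_smul] at h1
    exact h10.1.trans_le h1
  obtain ⟨e, he⟩ := hg.span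
  obtain ⟨c₀, hc₀, hcoer⟩ := exists_pos_le_inner_of_posDef hg.posDef
  have hop : ∀ v, (∫ z, (phi α10 π z)⁻¹ • InnerProductSpace.rankOne ℝ
      (WithLp.toLp 2 (g z) : EuclideanSpace ℝ (Fin k)) (WithLp.toLp 2 (g z)) ∂F) v =
      Matrix.toEuclideanCLM (𝕜 := ℝ) (B F (phi α10 π) g g) v := fun v =>
    integral_rankOne_apply h10.1 (hdata.le_phi h10) hdata.measurable_phi hg.measurable_toLp
      hg.measurable_toLp hg.memLp hg.memLp v
  have hfst : Tendsto Prod.fst L atTop := tendsto_fst_highProb.mono_left hL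
  have hmax : ∀ ε > 0, ∀ᶠ x : ℕ × Ω in L, ∀ i : Fin x.1,
      ‖(WithLp.toLp 2 (g (Z i x.2)) : EuclideanSpace ℝ (Fin k))‖ ≤ ε * √(x.1 : ℝ) :=
    fun ε hε => hL (hdata.eventually_forall_norm_le hg.memLp hε)
  obtain ⟨M, hM⟩ := eventually_exists_multiplier (n := Prod.fst)
    (φ := fun (x : ℕ × Ω) i => phi α10 π (Z i x.2)) (d := fun (x : ℕ × Ω) i => incl D1 D2 i x.2)
    (H := fun (x : ℕ × Ω) i => (WithLp.toLp 2 (g (Z i x.2)) : EuclideanSpace ℝ (Fin k)))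
    hfst h10.1 (fun x i => hdata.le_phi h10 _)
    (fun x i => incl_mem_Icc D1 D2 i x.2) hmax hc₀ (fun v => by rw [hop]; exact hcoer v)
    ((hdata.tendsto_mean_rankOne h10 hg.measurable_toLp hg.measurable_toLp hg.memLp
      hg.memLp).mono_left hL) hC
  obtain ⟨μ, hμ⟩ := exists_forall_eventually_of_eventually_exists hM
  have hμ1 := hμ.mono fun x hx => hx.1
  have hμ2 := hμ.mono fun x hx => hx.2
  have hmean := (hdata.tendsto_mean_incl h10).mono_left hL
  rw [hg.integral_phi] at hmean
  have hsmall := eventually_abs_inner_le (n := Prod.fst)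
    (H := fun (x : ℕ × Ω) i => (WithLp.toLp 2 (g (Z i x.2)) : EuclideanSpace ℝ (Fin k)))
    hmax hμ1 (half_pos h10.1)
  have hpos : ∀ᶠ x in L, ∀ i : Fin x.1,
      0 < phi α10 π (Z i x.2) + inner ℝ (WithLp.toLp 2 (g (Z i x.2))) (μ x) := by
    filter_upwards [hsmall] with x hx i
    have h1 := (abs_le.1 (hx i)).1
    have h2 := hdata.le_phi h10 (Z i x.2)
    have h3 := h10.1
    linarith
  have hNpos : ∀ᶠ x : ℕ × Ω in L, (0 : ℝ) < x.1 := by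
    filter_upwards [hfst.eventually_gt_atTop 0] with x hx
    exact_mod_cast hx
  refine ⟨μ, fun x => α₀ / ((x.1 : ℝ)⁻¹ * ∑ i : Fin x.1, incl D1 D2 i x.2), M, hμ1, hμ2, ?_, ?_,
    hpos, ?_⟩
  · have := (tendsto_const_nhds (x := α₀)).div hmean hα.ne'
    rwa [div_self hα.ne'] at this
  · filter_upwards [hmean.eventually (lt_mem_nhds hα)] with x hx
    positivity
  · filter_upwards [hmean.eventually (lt_mem_nhds hα), hNpos, hpos, hμ2] with x h1 h2 h3 h4 i
    have hn : 0 < ∑ i : Fin x.1, incl D1 D2 i x.2 := by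
      rwa [mul_pos_iff_of_pos_left (inv_pos.2 h2)] at h1
    have hiff := isMaxEL_iff_eq_multWeight (z := fun i : Fin x.1 => Z i x.2)
      (d := fun i : Fin x.1 => incl D1 D2 i x.2) hα he
      (fun i => incl_zero_or_one D1 D2 i x.2) hn h3 h4
    have hp := (hiff _).1 ((hphat x.1 x.2).1 ⟨_, (hiff _).2 rfl⟩)
    rw [hp, multWeight]
    field_simp

lemma RegularConstraint.operator_comp_eq_residual {φ : 𝒵 → ℝ} {a : ℝ} (ha : 0 < a)
    (hφ : ∀ z, a ≤ φ z) (hφm : Measurable φ) (hg : RegularConstraint F φ α₀ g)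
    (hdlm : Measurable dl) (hdl : MemLp dl 2 F) (z : 𝒵) :
    dl z - (∫ z, (φ z)⁻¹ • InnerProductSpace.rankOne ℝ (dl z)
      (WithLp.toLp 2 (g z) : EuclideanSpace ℝ (Fin k)) ∂F)
      (Matrix.toEuclideanCLM (𝕜 := ℝ) (B F φ g g)⁻¹ (WithLp.toLp 2 (g z))) =
      residual F φ g dl z := by
  rw [integral_rankOne_apply ha hφ hφm hdlm hg.measurable_toLp hdl hg.memLp, residual]
  rfl

/-- Expansion of the estimator along a filter on which the normalized sums are bounded. -/
lemma estimator_expansion_along (hdata : CaptureRecapture P F Z D1 D2 α10 α20 π)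
    (h10 : α10 ∈ Set.Ioo (0 : ℝ) 1) (hg : RegularConstraint F (phi α10 π) α₀ g)
    (hloss : LossConditions F (phi α10 π) ℓ θ₀ dl V)
    (hest : IsELWEstimator P Z D1 D2 (phi α10 π) α₀ g ℓ phat θhat)
    {L : Filter (ℕ × Ω)} (hL : L ≤ highProb P) {C : ℝ}
    (hC : ∀ᶠ x in L, ‖ipwSum Z D1 D2 (phi α10 π) (fun z => WithLp.toLp 2 (g z)) x‖ ≤ C)
    (hC' : ∀ᶠ x in L, ‖ipwSum Z D1 D2 (phi α10 π) (residual F (phi α10 π) g dl) x‖ ≤ C) :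
    Tendsto (fun x : ℕ × Ω => √(x.1 : ℝ) • ∑ i : Fin x.1, phat x.1 x.2 i • dl (Z i x.2) -
      ipwSum Z D1 D2 (phi α10 π) (residual F (phi α10 π) g dl) x) L (𝓝 0) ∧
    Tendsto (fun x : ℕ × Ω => √(x.1 : ℝ) • (θhat x.1 x.2 - θ₀) +
      Matrix.toEuclideanCLM (𝕜 := ℝ) V⁻¹
        (ipwSum Z D1 D2 (phi α10 π) (residual F (phi α10 π) g dl) x)) L (𝓝 0) := by
  obtain ⟨μ, c, M, hμ, hroot, hc, hc0, hpos, hp⟩ :=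
    exists_multiplier_along hdata h10 hg hest.weights hL hC
  set U := ipwSum Z D1 D2 (phi α10 π) (residual F (phi α10 π) g dl) with hU
  have hdl := hloss.memLp_grad hdata h10
  have hdlm := hloss.measurable_grad
  have hle := hdata.le_phi h10
  have hfst : Tendsto Prod.fst L atTop := tendsto_fst_highProb.mono_left hL
  have hNpos : ∀ᶠ x : ℕ × Ω in L, (0 : ℝ) < x.1 := by
    filter_upwards [hfst.eventually_gt_atTop 0] with x hx
    exact_mod_cast hx
  have hmax : ∀ ε > 0, ∀ᶠ x : ℕ × Ω in L, ∀ i : Fin x.1,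
      ‖(WithLp.toLp 2 (g (Z i x.2)) : EuclideanSpace ℝ (Fin k))‖ ≤ ε * √(x.1 : ℝ) :=
    fun ε hε => hL (hdata.eventually_forall_norm_le hg.memLp hε)
  obtain ⟨K, hK⟩ := hdata.exists_mean_norm_mul_norm_le hg.measurable_toLp hdlm hg.memLp hdl
  obtain ⟨K', hK'⟩ := hdata.exists_mean_norm_mul_norm_le hg.measurable_toLp hg.measurable_toLp
    hg.memLp hg.memLp
  have hinv : ∀ v, Matrix.toEuclideanCLM (𝕜 := ℝ) (B F (phi α10 π) g g)⁻¹
      ((∫ z, (phi α10 π z)⁻¹ • InnerProductSpace.rankOne ℝ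
      (WithLp.toLp 2 (g z) : EuclideanSpace ℝ (Fin k)) (WithLp.toLp 2 (g z)) ∂F) v) = v := by
    intro v
    rw [integral_rankOne_apply h10.1 hle hdata.measurable_phi hg.measurable_toLp
      hg.measurable_toLp hg.memLp hg.memLp, Matrix.toEuclideanCLM_toLp, Matrix.mulVec_mulVec]
    change WithLp.toLp 2 (((B F (phi α10 π) g g)⁻¹ * B F (phi α10 π) g g) *ᵥ v.ofLp) = v
    rw [Matrix.nonsing_inv_mul _ hg.posDef.det_pos.ne'.isUnit, Matrix.one_mulVec]
  -- the weighted mean with denominators `φ + ⟪g, μ⟫`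
  set Y : ℕ × Ω → EuclideanSpace ℝ (Fin q) := fun x => √(x.1 : ℝ) • ((x.1 : ℝ)⁻¹ •
    ∑ i : Fin x.1, (incl D1 D2 i x.2 / (phi α10 π (Z i x.2) +
      inner ℝ (WithLp.toLp 2 (g (Z i x.2))) (μ x))) • dl (Z i x.2)) with hY
  have hYU : Tendsto (fun x => Y x - U x) L (𝓝 0) := by
    have h := tendsto_weighted_mean_of_root (n := Prod.fst)
      (φ := fun (x : ℕ × Ω) i => phi α10 π (Z i x.2)) (d := fun (x : ℕ × Ω) i => incl D1 D2 i x.2)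
      (H := fun (x : ℕ × Ω) i => (WithLp.toLp 2 (g (Z i x.2)) : EuclideanSpace ℝ (Fin k)))
      (W := fun (x : ℕ × Ω) i => dl (Z i x.2)) (K := K) (K' := K') h10.1
      (fun x i => hle _) (fun x i => incl_mem_Icc D1 D2 i x.2) hmax hμ hroot (hL hK) (hL hK')
      ((hdata.tendsto_mean_rankOne h10 hdlm hg.measurable_toLp hdl hg.memLp).mono_left hL) hinv
      ((hdata.tendsto_mean_rankOne h10 hg.measurable_toLp hg.measurable_toLp hg.memLp
        hg.memLp).mono_left hL)
    simp only [hg.operator_comp_eq_residual h10.1 hle hdata.measurable_phi hdlm hdl] at h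
    exact h
  have hscore : ∀ᶠ x : ℕ × Ω in L,
      √(x.1 : ℝ) • ∑ i : Fin x.1, phat x.1 x.2 i • dl (Z i x.2) = c x • Y x := by
    filter_upwards [hp, hNpos] with x hx hN
    simp only [hY]
    rw [smul_comm (c x)]
    congr 1
    rw [smul_smul, Finset.smul_sum]
    refine Finset.sum_congr rfl fun i _ => ?_
    rw [smul_smul]
    congr 1
    rw [mul_assoc, mul_left_comm, ← hx i, inv_mul_cancel_left₀ hN.ne']
  have hfirst : Tendsto (fun x : ℕ × Ω => √(x.1 : ℝ) • ∑ i : Fin x.1,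
      phat x.1 x.2 i • dl (Z i x.2) - U x) L (𝓝 0) := by
    have h1 : Tendsto (fun x => (c x - 1) • U x) L (𝓝 0) := by
      have h2 := (tendsto_iff_norm_sub_tendsto_zero.1 hc).mul_const C
      rw [zero_mul] at h2
      refine squeeze_zero_norm' ?_ h2
      filter_upwards [hC'] with x hx
      rw [norm_smul]
      gcongr
    have h3 := (hc.smul hYU).add h1
    rw [smul_zero, add_zero] at h3
    refine h3.congr' ?_
    filter_upwards [hscore] with x hx
    rw [hx]
    module
  refine ⟨hfirst, ?_⟩
  -- the localized and rescaled criterion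
  set G : ℕ × Ω → EuclideanSpace ℝ (Fin q) → ℝ := fun x t =>
    x.1 * (weightedRisk ℓ (fun i : Fin x.1 => Z i x.2) (phat x.1 x.2) (θ₀ + (√(x.1 : ℝ))⁻¹ • t) -
      weightedRisk ℓ (fun i : Fin x.1 => Z i x.2) (phat x.1 x.2) θ₀) with hG
  have hpnonneg : ∀ᶠ x in L, ∀ i : Fin x.1, 0 ≤ phat x.1 x.2 i := by
    filter_upwards [hp, hNpos, hpos, hc0] with x h1 h2 h3 h4 i
    have h5 : 0 ≤ x.1 * phat x.1 x.2 i := by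
      rw [h1 i]
      exact mul_nonneg h4 (div_nonneg (incl_mem_Icc D1 D2 i x.2).1 (h3 i).le)
    exact nonneg_of_mul_nonneg_right h5 h2
  have hconv : ∀ᶠ x in L, ConvexOn ℝ Set.univ (G x) := by
    filter_upwards [hpnonneg] with x hx
    have h1 : ConvexOn ℝ Set.univ
        (weightedRisk ℓ (fun i : Fin x.1 => Z i x.2) (phat x.1 x.2)) := by
      have h2 : ∀ s : Finset (Fin x.1), ConvexOn ℝ Set.univ
          (fun θ => ∑ i ∈ s, phat x.1 x.2 i * ℓ (Z i x.2) θ) := by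
        intro s
        induction s using Finset.cons_induction with
        | empty => simpa using convexOn_const (0 : ℝ) convex_univ
        | cons i s hi ih =>
          simp only [Finset.sum_cons]
          exact ((hloss.convex (Z i x.2)).smul (hx i)).add ih
      exact h2 Finset.univ
    have h2 : ConvexOn ℝ Set.univ fun t : EuclideanSpace ℝ (Fin q) =>
        weightedRisk ℓ (fun i : Fin x.1 => Z i x.2) (phat x.1 x.2)
          (θ₀ + (√(x.1 : ℝ))⁻¹ • t) := by
      refine ⟨convex_univ, fun s _ t _ a b ha hb hab => ?_⟩
      have h3 := h1.2 (Set.mem_univ (θ₀ + (√(x.1 : ℝ))⁻¹ • s))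
        (Set.mem_univ (θ₀ + (√(x.1 : ℝ))⁻¹ • t)) ha hb hab
      have h4 : a • (θ₀ + (√(x.1 : ℝ))⁻¹ • s) + b • (θ₀ + (√(x.1 : ℝ))⁻¹ • t) =
          θ₀ + (√(x.1 : ℝ))⁻¹ • (a • s + b • t) := by
        rw [smul_add, smul_add, add_add_add_comm, ← add_smul, hab, one_smul, smul_add,
          smul_comm a, smul_comm b]
      rwa [h4] at h3
    have h3 := (h2.add_const (-weightedRisk ℓ (fun i : Fin x.1 => Z i x.2) (phat x.1 x.2) θ₀)).smul
      (Nat.cast_nonneg (α := ℝ) x.1)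
    exact h3
  have hlim : ∀ t, Tendsto (fun x => G x t - inner ℝ (U x) t) L
      (𝓝 (1 / 2 * inner ℝ (Matrix.toEuclideanCLM (𝕜 := ℝ) V t) t)) := by
    intro t
    obtain ⟨e1, e2, e3⟩ := hloss.tendsto_local_remainder t
    have h1 := tendsto_weighted_remainder (n := Prod.fst)
      (φ := fun (x : ℕ × Ω) i => phi α10 π (Z i x.2)) (d := fun (x : ℕ × Ω) i => incl D1 D2 i x.2)
      (H := fun (x : ℕ × Ω) i => (WithLp.toLp 2 (g (Z i x.2)) : EuclideanSpace ℝ (Fin k)))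
      (ξ := fun (x : ℕ × Ω) i => remainder ℓ θ₀ dl ((√(x.1 : ℝ))⁻¹ • t) (Z i x.2))
      (K := K') hfst h10.1 (fun x i => hle _) (fun x i => incl_mem_Icc D1 D2 i x.2) hmax hμ (hL hK')
      ((hdata.tendsto_sum_sq e1 e2).mono_left hL)
      ((hdata.tendsto_sum_incl_div h10 (fun N => hloss.measurable_remainder _) e1 e2 e3).mono_left
        hL)
    have h2 := (hc.mul h1).add (hfirst.inner (tendsto_const_nhds (x := t)))
    rw [one_mul, inner_zero_left, add_zero] at h2
    rw [real_inner_comm, inner_toEuclideanCLM]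
    refine h2.congr' ?_
    filter_upwards [hp] with x hx
    simp only [hG]
    rw [scaled_weightedRisk_eq ℓ θ₀ dl, inner_sub_left, Finset.mul_sum, Finset.mul_sum]
    have h3 : ∀ i : Fin x.1, (x.1 : ℝ) * (phat x.1 x.2 i *
        remainder ℓ θ₀ dl ((√(x.1 : ℝ))⁻¹ • t) (Z i x.2)) =
        c x * (incl D1 D2 i x.2 / (phi α10 π (Z i x.2) +
          inner ℝ (WithLp.toLp 2 (g (Z i x.2))) (μ x)) *
          remainder ℓ θ₀ dl ((√(x.1 : ℝ))⁻¹ • t) (Z i x.2)) := by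
      intro i
      rw [← mul_assoc, hx i, mul_assoc]
    simp only [h3]
    ring
  obtain ⟨c₀, hc₀, hcoer⟩ := exists_pos_le_inner_of_posDef hloss.posDef
  have hVsymm : ∀ s t : EuclideanSpace ℝ (Fin q),
      inner ℝ (Matrix.toEuclideanCLM (𝕜 := ℝ) V s) t =
        inner ℝ s (Matrix.toEuclideanCLM (𝕜 := ℝ) V t) := by
    intro s t
    have hVt : Vᵀ = V := hloss.posDef.1
    rw [real_inner_comm, inner_toEuclideanCLM, inner_toEuclideanCLM, Matrix.dotProduct_mulVec,
      ← Matrix.mulVec_transpose, hVt, dotProduct_comm]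
  have hVinv : ∀ v, Matrix.toEuclideanCLM (𝕜 := ℝ) V
      (Matrix.toEuclideanCLM (𝕜 := ℝ) V⁻¹ v) = v := by
    intro v
    change WithLp.toLp 2 (V *ᵥ (V⁻¹ *ᵥ v.ofLp)) = v
    rw [Matrix.mulVec_mulVec, Matrix.mul_nonsing_inv _ hloss.posDef.det_pos.ne'.isUnit,
      Matrix.one_mulVec]
  rw [Metric.tendsto_nhds]
  intro δ hδ
  filter_upwards [eventually_isMinOn_near_of_quadratic hconv hC' hVsymm hc₀ hcoer hVinv hlim hδ,
    hNpos] with x hx hN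
  have hs : √(x.1 : ℝ) ≠ 0 := (Real.sqrt_pos.2 hN).ne'
  -- minimizers of `G x` correspond to minimizers of the weighted risk
  have hmin : ∀ t, IsMinOn (G x) Set.univ t ↔
      IsMinOn (weightedRisk ℓ (fun i : Fin x.1 => Z i x.2) (phat x.1 x.2)) Set.univ
        (θ₀ + (√(x.1 : ℝ))⁻¹ • t) := by
    intro t
    simp only [isMinOn_univ_iff, hG, mul_le_mul_iff_right₀ hN, sub_le_sub_iff_right]
    refine ⟨fun h θ => ?_, fun h s => h _⟩
    have h1 := h (√(x.1 : ℝ) • (θ - θ₀))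
    rwa [inv_smul_smul₀ hs, add_sub_cancel] at h1
  obtain ⟨t, ht⟩ := hx.1
  have hθ := hest.argmin x.1 x.2 ⟨_, (hmin t).1 ht⟩
  rw [dist_zero_right]
  refine hx.2 _ ((hmin _).2 ?_)
  rwa [inv_smul_smul₀ hs, add_sub_cancel]

end Expansion

/-! ### Limit law of the estimator -/

section Limit

variable {Ω 𝒵 : Type*} [MeasurableSpace Ω] [MeasurableSpace 𝒵] {P : Measure Ω}
  [IsProbabilityMeasure P]
  {F : Measure 𝒵} {Z : ℕ → Ω → 𝒵} {D1 D2 : ℕ → Ω → ℝ} {α10 α20 α₀ : ℝ} {π : 𝒵 → ℝ}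
  {q k : ℕ} {ℓ : 𝒵 → EuclideanSpace ℝ (Fin q) → ℝ} {θ₀ : EuclideanSpace ℝ (Fin q)}
  {dl : 𝒵 → EuclideanSpace ℝ (Fin q)} {V : Matrix (Fin q) (Fin q) ℝ} {g : 𝒵 → Fin k → ℝ}
  {phat : (N : ℕ) → Ω → Fin N → ℝ} {θhat : ℕ → Ω → EuclideanSpace ℝ (Fin q)}

omit [MeasurableSpace Ω] [MeasurableSpace 𝒵] in
lemma ipwSum_clm {r : ℕ} (T : EuclideanSpace ℝ (Fin q) →L[ℝ] EuclideanSpace ℝ (Fin r))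
    (φ : 𝒵 → ℝ) (R : 𝒵 → EuclideanSpace ℝ (Fin q)) (x : ℕ × Ω) :
    ipwSum Z D1 D2 φ (fun z => T (R z)) x = T (ipwSum Z D1 D2 φ R x) := by
  simp [ipwSum]

lemma residual_spec (hdata : CaptureRecapture P F Z D1 D2 α10 α20 π)
    (h10 : α10 ∈ Set.Ioo (0 : ℝ) 1) (hg : RegularConstraint F (phi α10 π) α₀ g)
    (hloss : LossConditions F (phi α10 π) ℓ θ₀ dl V) :
    Measurable (residual F (phi α10 π) g dl) ∧ MemLp (residual F (phi α10 π) g dl) 2 F ∧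
      ∫ z, residual F (phi α10 π) g dl z ∂F = 0 := by
  have hF := hdata.isProbabilityMeasure
  have hdl := hloss.memLp_grad hdata h10
  obtain ⟨T, hT⟩ : ∃ T : EuclideanSpace ℝ (Fin k) →L[ℝ] EuclideanSpace ℝ (Fin q),
      residual F (phi α10 π) g dl = fun z => dl z - T (WithLp.toLp 2 (g z)) :=
    ⟨(∫ z, (phi α10 π z)⁻¹ • InnerProductSpace.rankOne ℝ (dl z)
      (WithLp.toLp 2 (g z) : EuclideanSpace ℝ (Fin k)) ∂F) ∘L
      (Matrix.toEuclideanCLM (𝕜 := ℝ) (B F (phi α10 π) g g)⁻¹), funext fun z =>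
      (hg.operator_comp_eq_residual h10.1 (hdata.le_phi h10) hdata.measurable_phi
        hloss.measurable_grad hdl z).symm⟩
  have hTg : MemLp (fun z => T (WithLp.toLp 2 (g z))) 2 F := T.comp_memLp' hg.memLp
  rw [hT]
  refine ⟨hloss.measurable_grad.sub (T.continuous.measurable.comp hg.measurable_toLp),
    hdl.sub hTg, ?_⟩
  rw [integral_sub (hdl.integrable one_le_two) (hTg.integrable one_le_two), hloss.integral_grad,
    T.integral_comp_comm (hg.memLp.integrable one_le_two), hg.integral_eq_zero, map_zero, sub_zero]

omit [IsProbabilityMeasure P] in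
lemma integral_inner_influence_sq (hdata : CaptureRecapture P F Z D1 D2 α10 α20 π)
    (h10 : α10 ∈ Set.Ioo (0 : ℝ) 1) (hg : RegularConstraint F (phi α10 π) α₀ g)
    (hloss : LossConditions F (phi α10 π) ℓ θ₀ dl V) (t : EuclideanSpace ℝ (Fin q)) :
    ∫ z, inner ℝ ((-Matrix.toEuclideanCLM (𝕜 := ℝ) V⁻¹) (residual F (phi α10 π) g dl z)) t ^ 2 /
      phi α10 π z ∂F = t.ofLp ⬝ᵥ SigmaELW F (phi α10 π) g dl V *ᵥ t.ofLp := by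
  have h := integral_inner_residual_sq_div h10.1 (hdata.le_phi h10) hdata.measurable_phi
    (hloss.memLp_grad hdata h10) hg.memLp hg.posDef (WithLp.toLp 2 (V⁻¹ *ᵥ t.ofLp))
  have hVt : V⁻¹ᵀ = V⁻¹ := by
    have h1 : Vᵀ = V := hloss.posDef.1
    rw [Matrix.transpose_nonsing_inv, h1]
  have hmove : ∀ u w : Fin q → ℝ, u ⬝ᵥ V⁻¹ *ᵥ w = (V⁻¹ *ᵥ u) ⬝ᵥ w := fun u w => by
    rw [Matrix.dotProduct_mulVec, ← Matrix.mulVec_transpose, hVt]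
  rw [SigmaELW, ← Matrix.mulVec_mulVec, ← Matrix.mulVec_mulVec, hmove, ← h]
  refine integral_congr_ae (ae_of_all _ fun z => ?_)
  have h1 : inner ℝ ((-Matrix.toEuclideanCLM (𝕜 := ℝ) V⁻¹) (residual F (phi α10 π) g dl z)) t =
      -inner ℝ (residual F (phi α10 π) g dl z) (WithLp.toLp 2 (V⁻¹ *ᵥ t.ofLp)) := by
    rw [_root_.neg_apply, inner_neg_left, real_inner_comm, inner_toEuclideanCLM, hmove]
    simp [PiLp.inner_apply, dotProduct]
  simp only [h1, neg_sq]
  rfl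

omit [IsProbabilityMeasure P] in
lemma posSemidef_sigmaELW (hdata : CaptureRecapture P F Z D1 D2 α10 α20 π)
    (h10 : α10 ∈ Set.Ioo (0 : ℝ) 1) (hg : RegularConstraint F (phi α10 π) α₀ g)
    (hloss : LossConditions F (phi α10 π) ℓ θ₀ dl V) :
    (SigmaELW F (phi α10 π) g dl V).PosSemidef := by
  refine Matrix.PosSemidef.of_dotProduct_mulVec_nonneg ?_ fun u => ?_
  · have h1 : Vᵀ = V := hloss.posDef.1
    have h2 : (B F (phi α10 π) g g)ᵀ = B F (phi α10 π) g g := hg.posDef.1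
    have h3 : (B F (phi α10 π) (fun z => (dl z).ofLp) fun z => (dl z).ofLp)ᵀ =
        B F (phi α10 π) (fun z => (dl z).ofLp) fun z => (dl z).ofLp := by
      ext i j
      simp only [B, Matrix.transpose_apply, Matrix.of_apply, mul_comm]
    rw [Matrix.IsHermitian, Matrix.conjTranspose_eq_transpose_of_trivial, SigmaELW]
    simp only [Matrix.transpose_mul, Matrix.transpose_sub, Matrix.transpose_nonsing_inv,
      Matrix.transpose_transpose, h1, h2, h3, Matrix.mul_assoc]
  · rw [star_trivial]
    have h := integral_inner_influence_sq hdata h10 hg hloss (WithLp.toLp 2 u)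
    change 0 ≤ (WithLp.toLp 2 u : EuclideanSpace ℝ (Fin q)).ofLp ⬝ᵥ _
    rw [← h]
    exact integral_nonneg_of_ae (ae_of_all _ fun z =>
      div_nonneg (sq_nonneg _) (h10.1.le.trans (hdata.le_phi h10 z)))

/-- Consistency, linearization and asymptotic normality of the estimator for a constraint function
whose span contains `φ - α₀`. -/
theorem asymptotics_of_regularConstraint (hdata : CaptureRecapture P F Z D1 D2 α10 α20 π)
    (h10 : α10 ∈ Set.Ioo (0 : ℝ) 1) (hg : RegularConstraint F (phi α10 π) α₀ g)
    (hloss : LossConditions F (phi α10 π) ℓ θ₀ dl V)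
    (hest : IsELWEstimator P Z D1 D2 (phi α10 π) α₀ g ℓ phat θhat) :
    TendstoInMeasure P θhat atTop (fun _ => θ₀) ∧
    TendstoInMeasure P
      (fun (N : ℕ) ω => √(N : ℝ) • (θhat N ω - θ₀)
        - (-(Matrix.toEuclideanCLM (𝕜 := ℝ) V⁻¹)
            (√(N : ℝ) • ∑ i : Fin N, phat N ω i • dl (Z i ω))))
      atTop (fun _ => (0 : EuclideanSpace ℝ (Fin q))) ∧
    AsympNormal P θhat θ₀ (SigmaELW F (phi α10 π) g dl V) := by
  have hF := hdata.isProbabilityMeasure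
  set A := ipwSum Z D1 D2 (phi α10 π) (fun z => WithLp.toLp 2 (g z)) with hA
  set U := ipwSum Z D1 D2 (phi α10 π) (residual F (phi α10 π) g dl) with hU
  set V' := Matrix.toEuclideanCLM (𝕜 := ℝ) V⁻¹ with hV'
  obtain ⟨hRm, hR, hR0⟩ := residual_spec hdata h10 hg hloss
  have htight : IsTight P fun x => (A x, U x) :=
    (hdata.isTight_ipwSum h10 hg.measurable_toLp hg.memLp hg.integral_eq_zero).prodMk
      (hdata.isTight_ipwSum h10 hRm hR hR0)
  have hnorm_le : ∀ C : ℝ, ∀ᶠ x in highProb P ⊓ 𝓟 {x | ‖(A x, U x)‖ ≤ C}, ‖(A x, U x)‖ ≤ C :=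
    fun C => mem_inf_of_right (mem_principal_self _)
  have hA_le : ∀ C : ℝ, ∀ᶠ x in highProb P ⊓ 𝓟 {x | ‖(A x, U x)‖ ≤ C}, ‖A x‖ ≤ C := fun C =>
    (hnorm_le C).mono fun x hx => (norm_fst_le (A x, U x)).trans hx
  have hU_le : ∀ C : ℝ, ∀ᶠ x in highProb P ⊓ 𝓟 {x | ‖(A x, U x)‖ ≤ C}, ‖U x‖ ≤ C := fun C =>
    (hnorm_le C).mono fun x hx => (norm_snd_le (A x, U x)).trans hx
  have hexp := fun C => estimator_expansion_along hdata h10 hg hloss hest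
    (L := highProb P ⊓ 𝓟 {x | ‖(A x, U x)‖ ≤ C}) inf_le_left (hA_le C) (hU_le C)
  have h1 := tendsto_of_isTight htight fun C => (hexp C).1
  have h2 := tendsto_of_isTight htight fun C => (hexp C).2
  have hsqrt : Tendsto (fun x : ℕ × Ω => (√(x.1 : ℝ))⁻¹) (highProb P) (𝓝 0) :=
    (tendsto_inv_atTop_zero.comp (Real.tendsto_sqrt_atTop.comp
      tendsto_natCast_atTop_atTop)).comp tendsto_fst_highProb
  refine ⟨?_, ?_, posSemidef_sigmaELW hdata h10 hg hloss, ?_⟩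
  · rw [tendstoInMeasure_iff_highProb]
    have h3 : Tendsto (fun x : ℕ × Ω => (√(x.1 : ℝ))⁻¹ • V' (U x)) (highProb P) (𝓝 0) := by
      refine tendsto_of_isTight htight fun C => ?_
      have h4 := (hsqrt.mono_left
        (inf_le_left : highProb P ⊓ 𝓟 {x | ‖(A x, U x)‖ ≤ C} ≤ _)).norm.mul_const (‖V'‖ * C)
      rw [norm_zero, zero_mul] at h4
      refine squeeze_zero_norm' ?_ h4
      filter_upwards [hU_le C] with x hx
      rw [norm_smul]
      gcongr
      exact V'.le_opNorm_of_le hx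
    have h5 := ((hsqrt.smul h2).sub h3).add_const θ₀
    rw [smul_zero, sub_zero, zero_add] at h5
    refine h5.congr' ?_
    filter_upwards [tendsto_fst_highProb.eventually_gt_atTop 0] with x hx
    have hs : √(x.1 : ℝ) ≠ 0 := (Real.sqrt_pos.2 (by exact_mod_cast hx)).ne'
    rw [smul_add, inv_smul_smul₀ hs]
    abel
  · rw [tendstoInMeasure_iff_highProb]
    have h3 := h2.add ((V'.continuous.tendsto 0).comp h1)
    rw [map_zero, add_zero] at h3
    refine h3.congr fun x => ?_
    simp only [Function.comp_apply, map_sub]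
    abel
  · have hcm : Measurable fun z => (-V') (residual F (phi α10 π) g dl z) :=
      (-V').continuous.measurable.comp hRm
    have hclt := hdata.tendstoInDistribution_ipwSum h10 hcm ((-V').comp_memLp' hR)
      (by rw [(-V').integral_comp_comm (hR.integrable one_le_two), hR0, map_zero])
      (posSemidef_sigmaELW hdata h10 hg hloss)
      (integral_inner_influence_sq hdata h10 hg hloss)
    refine tendstoInDistribution_of_tendstoInMeasure_sub _ _ hclt ?_ fun N =>
      ((hest.aemeasurable N).sub_const θ₀).const_smul √(N : ℝ)
    refine (tendstoInMeasure_iff_highProb (c := (0 : EuclideanSpace ℝ (Fin q)))).2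
      (h2.congr fun x => ?_)
    change _ = _ - ipwSum Z D1 D2 (phi α10 π)
      (fun z => (-V') (residual F (phi α10 π) g dl z)) x
    rw [ipwSum_clm, _root_.neg_apply, sub_neg_eq_add]

end Limit

/-! ### The two constraint functions -/

section Constraints

variable {Ω 𝒵 : Type*} [MeasurableSpace Ω] [MeasurableSpace 𝒵] {P : Measure Ω}
  [IsProbabilityMeasure P]
  {F : Measure 𝒵} {Z : ℕ → Ω → 𝒵} {D1 D2 : ℕ → Ω → ℝ} {α10 α20 : ℝ} {π : 𝒵 → ℝ} {q m : ℕ}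

variable (hdata : CaptureRecapture P F Z D1 D2 α10 α20 π) (h10 : α10 ∈ Set.Ioo (0 : ℝ) 1)
include hdata h10

lemma CaptureRecapture.integrable_phi : Integrable (phi α10 π) F := by
  have hF := hdata.isProbabilityMeasure
  exact Integrable.of_bound hdata.measurable_phi.aestronglyMeasurable 1 (ae_of_all _ fun z => by
    rw [Real.norm_of_nonneg (h10.1.le.trans (hdata.le_phi h10 z))]
    exact hdata.phi_le_one h10 z)

omit h10 in
lemma CaptureRecapture.integral_phi : ∫ z, phi α10 π z ∂F = alpha0 α10 α20 := by
  have hF := hdata.isProbabilityMeasure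
  have hint : Integrable π F :=
    Integrable.of_bound hdata.measurable_pi.aestronglyMeasurable 1 (ae_of_all _ fun z => by
      rw [Real.norm_of_nonneg (hdata.pi_mem z).1]
      exact (hdata.pi_mem z).2)
  have h1 : Integrable (fun z => 1 - π z) F := (integrable_const 1).sub hint
  simp only [phi, alpha0]
  rw [integral_sub (integrable_const 1) (h1.const_mul _), integral_const_mul,
    integral_sub (integrable_const 1) hint, hdata.alpha20_eq]
  simp

omit [IsProbabilityMeasure P] in
lemma memLp_two_of_integrable_sq_div {f : 𝒵 → ℝ} (hf : Measurable f)
    (hint : Integrable (fun z => f z * f z / phi α10 π z) F) : MemLp f 2 F := by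
  refine (memLp_two_iff_integrable_sq hf.aestronglyMeasurable).2 ?_
  refine hint.mono' (hf.pow_const 2).aestronglyMeasurable (ae_of_all _ fun z => ?_)
  have h1 := h10.1.trans_le (hdata.le_phi h10 z)
  rw [Real.norm_of_nonneg (sq_nonneg _), ← sq, le_div_iff₀ h1]
  exact mul_le_of_le_one_right (sq_nonneg _) (hdata.phi_le_one h10 z)

lemma integral_phi_sub_alpha0 : ∫ z, (phi α10 π z - alpha0 α10 α20) ∂F = 0 := by
  have hF := hdata.isProbabilityMeasure
  rw [integral_sub (hdata.integrable_phi h10) (integrable_const _), hdata.integral_phi]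
  simp

lemma regularConstraint_hExt {h : 𝒵 → Fin m → ℝ} (hh : Measurable h) (hh0 : ∫ z, h z ∂F = 0)
    (hfin : ∀ j k, Integrable (fun z => hExt (phi α10 π) (alpha0 α10 α20) h z j *
      hExt (phi α10 π) (alpha0 α10 α20) h z k / phi α10 π z) F)
    (hB : (B F (phi α10 π) (hExt (phi α10 π) (alpha0 α10 α20) h)
      (hExt (phi α10 π) (alpha0 α10 α20) h)).PosDef) :
    RegularConstraint F (phi α10 π) (alpha0 α10 α20)
      (hExt (phi α10 π) (alpha0 α10 α20) h) := by
  have hF := hdata.isProbabilityMeasure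
  have hmeas : Measurable (hExt (phi α10 π) (alpha0 α10 α20) h) := by
    refine measurable_pi_iff.2 fun j => ?_
    refine Fin.cases ?_ (fun j => ?_) j
    · exact hdata.measurable_phi.sub_const _
    · exact (measurable_pi_apply j).comp hh
  have hmem : ∀ j, MemLp (fun z => hExt (phi α10 π) (alpha0 α10 α20) h z j) 2 F := fun j =>
    memLp_two_of_integrable_sq_div hdata h10 ((measurable_pi_apply j).comp hmeas) (hfin j j)
  have hmem' : MemLp (fun z => (WithLp.toLp 2 (hExt (phi α10 π) (alpha0 α10 α20) h z) :
      EuclideanSpace ℝ (Fin (m + 1)))) 2 F := MemLp.of_eval_piLp hmem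
  refine ⟨hmeas, hmem', ?_, hB, EuclideanSpace.single 0 1, fun z => ?_⟩
  · ext j
    have h1 := (EuclideanSpace.proj (𝕜 := ℝ) j).integral_comp_comm (hmem'.integrable one_le_two)
    change (EuclideanSpace.proj (𝕜 := ℝ) j) _ = 0
    rw [← h1]
    refine Fin.cases ?_ (fun j => ?_) j
    · exact integral_phi_sub_alpha0 hdata h10
    · have h2 := eval_integral (μ := F) (f := h) (fun i => (hmem i.succ).integrable one_le_two) j
      rw [hh0] at h2
      exact h2.symm
  · rw [EuclideanSpace.inner_single_right]
    simp [hExt]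

lemma regularConstraint_hNone
    (hpos : 0 < ∫ z, (phi α10 π z - alpha0 α10 α20) * (phi α10 π z - alpha0 α10 α20) /
      phi α10 π z ∂F) :
    RegularConstraint F (phi α10 π) (alpha0 α10 α20) (hNone (phi α10 π) (alpha0 α10 α20)) := by
  have hF := hdata.isProbabilityMeasure
  have hm : Measurable fun z => phi α10 π z - alpha0 α10 α20 := hdata.measurable_phi.sub_const _
  have hmem : MemLp (fun z => phi α10 π z - alpha0 α10 α20) 2 F := by
    refine MemLp.sub ?_ (memLp_const _)
    exact MemLp.of_bound hdata.measurable_phi.aestronglyMeasurable 1 (ae_of_all _ fun z => by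
      rw [Real.norm_of_nonneg (h10.1.le.trans (hdata.le_phi h10 z))]
      exact hdata.phi_le_one h10 z)
  have hmem' : MemLp (fun z => (WithLp.toLp 2 (hNone (phi α10 π) (alpha0 α10 α20) z) :
      EuclideanSpace ℝ (Fin 1))) 2 F := MemLp.of_eval_piLp fun _ => hmem
  refine ⟨measurable_pi_iff.2 fun _ => hm, hmem', ?_, ?_, EuclideanSpace.single 0 1, fun z => ?_⟩
  · ext j
    have h1 := (EuclideanSpace.proj (𝕜 := ℝ) j).integral_comp_comm (hmem'.integrable one_le_two)
    change (EuclideanSpace.proj (𝕜 := ℝ) j) _ = 0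
    rw [← h1]
    exact integral_phi_sub_alpha0 hdata h10
  · have h1 : B F (phi α10 π) (hNone (phi α10 π) (alpha0 α10 α20))
        (hNone (phi α10 π) (alpha0 α10 α20)) = Matrix.diagonal fun _ =>
        ∫ z, (phi α10 π z - alpha0 α10 α20) * (phi α10 π z - alpha0 α10 α20) /
          phi α10 π z ∂F := by
      ext i j
      rw [Subsingleton.elim i j, Matrix.diagonal_apply_eq]
      rfl
    rw [h1]
    exact Matrix.PosDef.diagonal fun _ => hpos
  · rw [EuclideanSpace.inner_single_right]
    simp [hNone]

/-- Without auxiliary information, `B_gg = α₀² (B₁₁ - α₀⁻¹)` and `B_ℓ̇g = -α₀ B_ℓ̇1`. -/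
lemma sigmaELW_hNone (h20 : α20 ∈ Set.Ioo (0 : ℝ) 1)
    {dl : 𝒵 → EuclideanSpace ℝ (Fin q)} (hdl : MemLp dl 2 F)
    (hdl0 : ∫ z, dl z ∂F = 0) (V : Matrix (Fin q) (Fin q) ℝ) :
    SigmaELW F (phi α10 π) (hNone (phi α10 π) (alpha0 α10 α20)) dl V =
      SigmaELW0 F (phi α10 π) (alpha0 α10 α20) dl V := by
  have hF := hdata.isProbabilityMeasure
  have hα : alpha0 α10 α20 ≠ 0 := by
    have : 0 < alpha0 α10 α20 := by
      unfold alpha0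
      nlinarith [h10.1, h10.2, h20.1, h20.2]
    exact this.ne'
  set α := alpha0 α10 α20
  have hφ0 : ∀ z, phi α10 π z ≠ 0 := fun z => (h10.1.trans_le (hdata.le_phi h10 z)).ne'
  have hone : MemLp (fun _ : 𝒵 => (1 : ℝ)) 2 F := memLp_const 1
  have hj : ∀ j, MemLp (fun z => dl z j) 2 F := fun j =>
    (EuclideanSpace.proj (𝕜 := ℝ) j).comp_memLp' hdl
  have hinv : Integrable (fun z => 1 / phi α10 π z) F := by
    simpa using integrable_mul_div h10.1 (hdata.le_phi h10) hdata.measurable_phi hone hone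
  have hjinv : ∀ j, Integrable (fun z => dl z j / phi α10 π z) F := fun j => by
    simpa using integrable_mul_div h10.1 (hdata.le_phi h10) hdata.measurable_phi (hj j) hone
  have hb : B F (phi α10 π) (hNone (phi α10 π) α) (hNone (phi α10 π) α) =
      Matrix.diagonal fun _ => α ^ 2 * (B11 F (phi α10 π) - α⁻¹) := by
    ext i j
    rw [Subsingleton.elim i j, Matrix.diagonal_apply_eq]
    simp only [B, Matrix.of_apply, hNone]
    have h1 : ∀ z, (phi α10 π z - α) * (phi α10 π z - α) / phi α10 π z =
        (phi α10 π z - 2 * α) + α ^ 2 * (1 / phi α10 π z) := by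
      intro z
      have := hφ0 z
      field_simp
      ring
    have h2 : Integrable (fun z => phi α10 π z - 2 * α) F :=
      (hdata.integrable_phi h10).sub (integrable_const _)
    simp only [h1]
    rw [integral_add h2 (hinv.const_mul _), integral_const_mul,
      integral_sub (hdata.integrable_phi h10) (integrable_const _), hdata.integral_phi,
      integral_const, probReal_univ, one_smul, B11]
    field_simp
    ring
  have hl : ∀ j i, B F (phi α10 π) (fun z => (dl z).ofLp) (hNone (phi α10 π) α) j i =
      -(α * Bl1 F (phi α10 π) dl j) := by
    intro j i
    simp only [B, Matrix.of_apply, hNone, Bl1]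
    have h1 : ∀ z, dl z j * (phi α10 π z - α) / phi α10 π z =
        dl z j - α * (dl z j / phi α10 π z) := by
      intro z
      have := hφ0 z
      field_simp
    have h2 := (EuclideanSpace.proj (𝕜 := ℝ) j).integral_comp_comm (hdl.integrable one_le_two)
    rw [hdl0, map_zero] at h2
    have h3 : ∫ z, dl z j ∂F = 0 := h2
    simp only [h1]
    rw [integral_sub ((hj j).integrable one_le_two) ((hjinv j).const_mul _), integral_const_mul, h3,
      zero_sub]
  rw [SigmaELW, SigmaELW0]
  congr 3
  ext j l
  rw [hb, Matrix.inv_subsingleton, Matrix.mul_assoc, Matrix.mul_apply]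
  simp only [Finset.univ_unique, Finset.sum_singleton, Matrix.diagonal_mul, Matrix.transpose_apply,
    hl, Matrix.smul_apply, vecMulVec_apply, smul_eq_mul]
  rw [Ring.inverse_eq_inv, Matrix.diagonal_apply_eq, mul_inv]
  field_simp

end Constraints

end ELW

theorem theorem2 {Ω 𝒵 : Type*} [MeasurableSpace Ω] [MeasurableSpace 𝒵]
    (P : Measure Ω) [IsProbabilityMeasure P] (F : Measure 𝒵)
    (Z : ℕ → Ω → 𝒵) (D1 D2 : ℕ → Ω → ℝ)
    (α10 α20 : ℝ) (hα10 : α10 ∈ Set.Ioo (0 : ℝ) 1) (hα20 : α20 ∈ Set.Ioo (0 : ℝ) 1)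
    (π : 𝒵 → ℝ) (hdata : ELW.CaptureRecapture P F Z D1 D2 α10 α20 π)
    (φ : 𝒵 → ℝ) (hφ : φ = ELW.phi α10 π)
    (α₀ : ℝ) (hα₀ : α₀ = ELW.alpha0 α10 α20)
    {q : ℕ} (ℓ : 𝒵 → EuclideanSpace ℝ (Fin q) → ℝ) (θ₀ : EuclideanSpace ℝ (Fin q))
    (dl : 𝒵 → EuclideanSpace ℝ (Fin q)) (V : Matrix (Fin q) (Fin q) ℝ)
    (hloss : ELW.LossConditions F φ ℓ θ₀ dl V)
    {m : ℕ} (h : 𝒵 → Fin m → ℝ) (hh_meas : Measurable h) (hh_mean : ∫ z, h z ∂F = 0)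
    (hBhh_fin : ∀ j k, Integrable
      (fun z => ELW.hExt φ α₀ h z j * ELW.hExt φ α₀ h z k / φ z) F)
    (hBhh : (ELW.B F φ (ELW.hExt φ α₀ h) (ELW.hExt φ α₀ h)).PosDef) :
    -- parts (a) and (b): the estimator with the auxiliary constraint
    (∀ (phat : (N : ℕ) → Ω → Fin N → ℝ) (θhat : ℕ → Ω → EuclideanSpace ℝ (Fin q)),
      ELW.IsELWEstimator P Z D1 D2 φ α₀ (ELW.hExt φ α₀ h) ℓ phat θhat →
        TendstoInMeasure P θhat atTop (fun _ => θ₀) ∧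
        TendstoInMeasure P
          (fun (N : ℕ) ω => √(N : ℝ) • (θhat N ω - θ₀)
            - (-(Matrix.toEuclideanCLM (𝕜 := ℝ) V⁻¹)
                (√(N : ℝ) • ∑ i : Fin N, phat N ω i • dl (Z i ω))))
          atTop (fun _ => (0 : EuclideanSpace ℝ (Fin q))) ∧
        ELW.AsympNormal P θhat θ₀ (ELW.SigmaELW F φ (ELW.hExt φ α₀ h) dl V)) ∧
    -- part (c): the estimator that ignores the auxiliary constraint
    (∀ (phat : (N : ℕ) → Ω → Fin N → ℝ) (θhat : ℕ → Ω → EuclideanSpace ℝ (Fin q)),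
      ELW.IsELWEstimator P Z D1 D2 φ α₀ (ELW.hNone φ α₀) ℓ phat θhat →
        ELW.AsympNormal P θhat θ₀ (ELW.SigmaELW0 F φ α₀ dl V)) := by
  subst hφ hα₀
  refine ⟨fun phat θhat hest => ?_, fun phat θhat hest => ?_⟩
  · exact ELW.asymptotics_of_regularConstraint hdata hα10
      (ELW.regularConstraint_hExt hdata hα10 hh_meas hh_mean hBhh_fin hBhh) hloss hest
  · -- The `(0, 0)` entry of `B_hh` is `E{(φ - α₀)² / φ}`.
    have hpos := hBhh.diag_pos (i := 0)
    rw [← ELW.sigmaELW_hNone hdata hα10 hα20 (hloss.memLp_grad hdata hα10) hloss.integral_grad V]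
    exact (ELW.asymptotics_of_regularConstraint hdata hα10
      (ELW.regularConstraint_hNone hdata hα10 hpos) hloss hest).2.2
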